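/- Let $n\ge 2$ and $m\ge 0$ be integers and let $\Omega\subset\mathbb{R}^n\times\mathbb{R}^m$ be open, with coordinates $x_1,\dots,x_n,v^1,\dots,v^m$ (a chart adapted to a fiber bundle, $x_i$ being coordinates on the base and $v^\alpha$ along the fibers). A connection $\partial_{x_i}\mapsto\partial_{x_i}+\sum_\alpha v_i^\alpha\,\partial_{v^\alpha}$ over $\Omega$ is given by functions $v_i^\alpha$ on $\Omega$, and it is flat if and only if $$\frac{\partial v_j^\alpha}{\partial x_i}+\sum_{\beta=1}^m v_i^\beta\frac{\partial v_j^\alpha}{\partial v^\beta}=\frac{\partial v_i^\alpha}{\partial x_j}+\sum_{\beta=1}^m v_j^\beta\frac{\partial v_i^\alpha}{\partial v^\beta}\qquad(1\le i<j\le n,\ 1\le\alpha\le m).$$ Let $J^\infty$ be the space of infinite jets over $\Omega$ of such tuples $(v_i^\alpha)$, and let $D_{x_i}$, $D_{v^\beta}$ be the total derivatives on $J^\infty$. Let $\mathcal{E}_{\mathrm{fc}}\subset J^\infty$ be the infinite prolongation of this system, i.e. the set of jets at which the equations and all their iterated total derivatives hold. Let $C^\infty(\mathcal{E}_{\mathrm{fc}})$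 be the algebra of restrictions to $\mathcal{E}_{\mathrm{fc}}$ of smooth functions on $J^\infty$ depending on finitely many jet coordinates. A (higher) symmetry is a derivation $S$ of $C^\infty(\mathcal{E}_{\mathrm{fc}})$ that annihilates all smooth functions of $(x,v)$ and for which $[S,Y]$ lies in the Cartan distribution whenever the derivation $Y$ does; here a derivation of $C^\infty(\mathcal{E}_{\mathrm{fc}})$ lies in the Cartan distribution if at every point of $\mathcal{E}_{\mathrm{fc}}$ it is a linear combination of the total derivatives. The generating section of $S$ is $\varphi_i^\alpha=S(v_i^\alpha)$. Then the total derivatives $D_{x_i}$, $D_{v^\beta}$ are tangent to $\mathcal{E}_{\mathrm{fc}}$, and so act on $C^\infty(\mathcal{E}_{\mathrm{fc}})$. Put $D_i=D_{x_i}+\sum_\beta v_i^\beta D_{v^\beta}$. For every symmetry, with generating section $(\varphi_i^\alpha)$, there is exactly one tuple $(f^1,\dots,f^m)$ of functions $f^\alpha\in C^\infty(\mathcal{E}_{\mathrm{fc}})$ such that $$\varphi_i^\alpha=D_i(f^\alpha)-\sum_{\beta=1}^m D_{v^\beta}(v_i^\alpha)\,f^\beta\qquad(1\le i\le n,\ 1\le\alpha\le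 m).$$ Conversely, for arbitrary $f^1,\dots,f^m\in C^\infty(\mathcal{E}_{\mathrm{fc}})$ there is exactly one symmetry whose generating section is given by this formula. -/

import Mathlib

open scoped ContDiff

namespace FlatConn

variable {n m : ℕ}

/-- Labels of the coordinates `x_1,…,x_n` (left) and `v^1,…,v^m` (right) on the total space of the
bundle; a connection is a section over this space, so these are the independent variables. -/
abbrev BaseIx (n m : ℕ) : Type := Fin n ⊕ Fin m

/-- Multi-indices of partial derivatives with respect to `x_1,…,x_n,v^1,…,v^m`. -/
abbrev MultiIx (n m : ℕ) : Type := BaseIx n m →₀ ℕ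

/-- The label `(i, α, σ)` stands for the jet coordinate `∂^σ v_i^α`. -/
abbrev JetIx (n m : ℕ) : Type := Fin n × Fin m × MultiIx n m

/-- Infinite jets, in adapted coordinates, of connections
`∂_{x_i} ↦ ∂_{x_i} + ∑_α v_i^α(x, v) ∂_{v^α}`: a point `(x, v)`
together with the values of all derivatives `∂^σ v_i^α`. -/
abbrev Jet (n m : ℕ) : Type := (BaseIx n m → ℝ) × (JetIx n m → ℝ)

/-- `F` is a smooth function on the infinite jets over the open set `Ω`: over `Ω` it is a smooth
function of `(x, v)` and of finitely many jet coordinates. Its values off `Ω` are irrelevant. -/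
def IsSmooth (Ω : Set (BaseIx n m → ℝ)) (F : Jet n m → ℝ) : Prop :=
  ∃ (s : Finset (JetIx n m)) (G : (BaseIx n m → ℝ) × (s → ℝ) → ℝ),
    ContDiffOn ℝ ∞ G (Ω ×ˢ Set.univ) ∧
      ∀ θ : Jet n m, θ.1 ∈ Ω → F θ = G (θ.1, fun k => θ.2 k)

/-- The Cartan tangent vector at the jet `θ` over the coordinate vector number `a`: its component
along the coordinate `∂^σ v_i^α` is the value at `θ` of the coordinate `∂^{σ+a} v_i^α`. -/
noncomputable def cartanVec (a : BaseIx n m) (θ : Jet n m) : Jet n m :=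
  (Pi.single a 1, fun k => θ.2 (k.1, k.2.1, k.2.2 + Finsupp.single a 1))

/-- The total derivative with respect to the base coordinate number `a`: the derivative along
`cartanVec a`. On smooth functions it is `∂_a + ∑ u_{i,σ+a}^α ∂/∂u_{i,σ}^α`. -/
noncomputable def totalDeriv (a : BaseIx n m) (F : Jet n m → ℝ) : Jet n m → ℝ :=
  fun θ => deriv (fun t : ℝ => F (θ + t • cartanVec a θ)) 0

/-- The jet coordinate `v_i^α`. -/
def coordFun (i : Fin n) (α : Fin m) : Jet n m → ℝ := fun θ => θ.2 (i, α, 0)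

/-- The difference of the two sides of the flatness equation
`∂v_j^α/∂x_i + ∑_β v_i^β ∂v_j^α/∂v^β = ∂v_i^α/∂x_j + ∑_β v_j^β ∂v_i^α/∂v^β`. -/
noncomputable def flatEq (i j : Fin n) (α : Fin m) : Jet n m → ℝ := fun θ =>
  (θ.2 (j, α, Finsupp.single (Sum.inl i) 1)
      + ∑ β : Fin m, θ.2 (i, β, 0) * θ.2 (j, α, Finsupp.single (Sum.inr β) 1))
    - (θ.2 (i, α, Finsupp.single (Sum.inl j) 1)
      + ∑ β : Fin m, θ.2 (j, β, 0) * θ.2 (i, α, Finsupp.single (Sum.inr β) 1))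

/-- The infinitely prolonged equation of flat connections over `Ω`: the jets at which the flatness
equations and all their iterated total derivatives hold. -/
def Efc (Ω : Set (BaseIx n m → ℝ)) : Set (Jet n m) :=
  {θ | θ.1 ∈ Ω ∧ ∀ (l : List (BaseIx n m)) (i j : Fin n) (α : Fin m),
    (l.foldr totalDeriv (flatEq i j α)) θ = 0}

section Smooth

variable {Ω : Set (BaseIx n m → ℝ)}

/-- A function which is smooth in finitely many jet coordinates can be regarded as a function of
more of them. -/
theorem IsSmooth.enlarge {s t : Finset (JetIx n m)} (h : s ⊆ t)
    {G : (BaseIx n m → ℝ) × (s → ℝ) → ℝ} (hG : ContDiffOn ℝ ∞ G (Ω ×ˢ Set.univ)) :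
    ContDiffOn ℝ ∞ (fun p : (BaseIx n m → ℝ) × (t → ℝ) => G (p.1, fun k => p.2 ⟨k, h k.2⟩))
      (Ω ×ˢ Set.univ) := by
  refine hG.comp (ContDiff.contDiffOn ?_) ?_
  · fun_prop
  · rintro p ⟨hp, -⟩
    exact ⟨hp, trivial⟩

theorem isSmooth_const (c : ℝ) : IsSmooth Ω (fun _ : Jet n m => c) :=
  ⟨∅, fun _ => c, contDiffOn_const, fun _ _ => rfl⟩

theorem isSmooth_base {h : (BaseIx n m → ℝ) → ℝ} (hh : ContDiffOn ℝ ∞ h Ω) :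
    IsSmooth Ω (fun θ : Jet n m => h θ.1) :=
  ⟨∅, fun p => h p.1, hh.comp contDiffOn_fst (fun _ hp => hp.1), fun _ _ => rfl⟩

theorem isSmooth_coord (k : JetIx n m) : IsSmooth Ω (fun θ : Jet n m => θ.2 k) :=
  ⟨{k}, fun p => p.2 ⟨k, Finset.mem_singleton_self k⟩, by fun_prop, fun _ _ => rfl⟩

theorem IsSmooth.add {F F' : Jet n m → ℝ} (h : IsSmooth Ω F) (h' : IsSmooth Ω F') :
    IsSmooth Ω (F + F') := by
  classical
  obtain ⟨s, G, hG, e⟩ := h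
  obtain ⟨s', G', hG', e'⟩ := h'
  refine ⟨s ∪ s', _, (IsSmooth.enlarge Finset.subset_union_left hG).add
    (IsSmooth.enlarge Finset.subset_union_right hG'), fun θ hθ => ?_⟩
  simp [e θ hθ, e' θ hθ]

theorem IsSmooth.mul {F F' : Jet n m → ℝ} (h : IsSmooth Ω F) (h' : IsSmooth Ω F') :
    IsSmooth Ω (F * F') := by
  classical
  obtain ⟨s, G, hG, e⟩ := h
  obtain ⟨s', G', hG', e'⟩ := h'
  refine ⟨s ∪ s', _, (IsSmooth.enlarge Finset.subset_union_left hG).mul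
    (IsSmooth.enlarge Finset.subset_union_right hG'), fun θ hθ => ?_⟩
  simp [e θ hθ, e' θ hθ]

/-- Total derivatives of smooth functions are smooth. -/
theorem IsSmooth.totalDeriv (hΩ : IsOpen Ω) {F : Jet n m → ℝ} (h : IsSmooth Ω F)
    (a : BaseIx n m) : IsSmooth Ω (totalDeriv a F) := by
  classical
  obtain ⟨s, G, hG, e⟩ := h
  let sh : JetIx n m → JetIx n m := fun k => (k.1, k.2.1, k.2.2 + Finsupp.single a 1)
  let t : Finset (JetIx n m) := s ∪ s.image sh
  have h1 : s ⊆ t := Finset.subset_union_left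
  have h2 : ∀ k : s, sh k ∈ t := fun k =>
    Finset.mem_union_right _ (Finset.mem_image_of_mem sh k.2)
  have hopen : IsOpen (Ω ×ˢ (Set.univ : Set (s → ℝ))) := hΩ.prod isOpen_univ
  have hd : ContDiffOn ℝ ∞ (fderiv ℝ G) (Ω ×ˢ Set.univ) :=
    hG.fderiv_of_isOpen hopen (by simp)
  refine ⟨t, fun p => fderiv ℝ G (p.1, fun k : s => p.2 ⟨k, h1 k.2⟩)
    (Pi.single a 1, fun k : s => p.2 ⟨sh k, h2 k⟩), ?_, fun θ hθ => ?_⟩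
  · refine ContDiffOn.clm_apply (hd.comp (ContDiff.contDiffOn ?_) ?_) (ContDiff.contDiffOn ?_)
    · fun_prop
    · rintro p ⟨hp, -⟩
      exact ⟨hp, trivial⟩
    · fun_prop
  · let p : (BaseIx n m → ℝ) × (s → ℝ) := (θ.1, fun k => θ.2 k)
    let w : (BaseIx n m → ℝ) × (s → ℝ) := (Pi.single a 1, fun k => θ.2 (sh k))
    have hp : p ∈ Ω ×ˢ (Set.univ : Set (s → ℝ)) := ⟨hθ, trivial⟩
    have hdiff : DifferentiableAt ℝ G (p + (0 : ℝ) • w) := by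
      rw [zero_smul, add_zero]
      exact (hG.contDiffAt (hopen.mem_nhds hp)).differentiableAt (by simp)
    have hline : HasDerivAt (fun r : ℝ => p + r • w) w 0 := by
      simpa using ((hasDerivAt_id (0 : ℝ)).smul_const w).const_add p
    have hcomp : HasDerivAt (fun r : ℝ => G (p + r • w)) (fderiv ℝ G p w) 0 := by
      have := hdiff.hasFDerivAt.comp_hasDerivAt (0 : ℝ) hline
      rw [zero_smul, add_zero] at this
      exact this
    have hev : (fun r : ℝ => F (θ + r • cartanVec a θ)) =ᶠ[nhds 0]
        fun r : ℝ => G (p + r • w) := by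
      have hc : ContinuousAt (fun r : ℝ => θ.1 + r • (Pi.single a 1 : BaseIx n m → ℝ)) 0 := by
        fun_prop
      filter_upwards [hc.preimage_mem_nhds (hΩ.mem_nhds (by simpa using hθ))] with r hr
      exact e (θ + r • cartanVec a θ) hr
    exact (hcomp.congr_of_eventuallyEq hev).deriv

end Smooth

/-- The algebra `C^∞(𝓔_fc)`: restrictions to `𝓔_fc` of smooth functions of finite order on the
infinite jets over `Ω`. -/
def SmoothE (Ω : Set (BaseIx n m → ℝ)) : Subalgebra ℝ (Efc Ω → ℝ) where
  carrier := {g | ∃ F, IsSmooth Ω F ∧ ∀ θ : Efc Ω, g θ = F θ}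
  mul_mem' := by
    rintro g g' ⟨F, h, e⟩ ⟨F', h', e'⟩
    exact ⟨F * F', h.mul h', fun θ => by simp [e, e']⟩
  add_mem' := by
    rintro g g' ⟨F, h, e⟩ ⟨F', h', e'⟩
    exact ⟨F + F', h.add h', fun θ => by simp [e, e']⟩
  algebraMap_mem' := fun c => ⟨fun _ => c, isSmooth_const c, fun _ => rfl⟩

variable {Ω : Set (BaseIx n m → ℝ)}

/-- Restriction of a smooth function to `𝓔_fc`. -/
def restrict (F : Jet n m → ℝ) (hF : IsSmooth Ω F) : SmoothE Ω :=
  ⟨fun θ => F θ, F, hF, fun _ => rfl⟩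

/-- The function `v_i^α` on `𝓔_fc`. -/
def coord (i : Fin n) (α : Fin m) : SmoothE Ω := restrict (coordFun i α) (isSmooth_coord _)

/-- Vector fields on `𝓔_fc`: derivations of `C^∞(𝓔_fc)`. -/
abbrev VectorField (Ω : Set (BaseIx n m → ℝ)) : Type := Derivation ℝ (SmoothE Ω) (SmoothE Ω)

/-- The vector field `Y` on `𝓔_fc` lies in the Cartan distribution: at every point it is a linear
combination of the Cartan tangent vectors. -/
def InCartan (Y : VectorField Ω) : Prop :=
  ∀ θ : Efc Ω, ∃ c : BaseIx n m → ℝ, ∀ (F : Jet n m → ℝ) (hF : IsSmooth Ω F),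
    (Y (restrict F hF)).1 θ = ∑ a, c a * totalDeriv a F θ

/-- A (higher) symmetry of the equation of flat connections: a vector field on `𝓔_fc` that kills
the functions of `(x, v)` and preserves the Cartan distribution. -/
def IsSymmetry (S : VectorField Ω) : Prop :=
  (∀ (h : (BaseIx n m → ℝ) → ℝ) (hh : ContDiffOn ℝ ∞ h Ω),
      S (restrict (fun θ => h θ.1) (isSmooth_base hh)) = 0) ∧
    ∀ Y : VectorField Ω, InCartan Y → InCartan ⁅S, Y⁆

/-- The generating section `φ_i^α = S(v_i^α)` of a symmetry. -/
def generatingSection (S : VectorField Ω) (i : Fin n) (α : Fin m) : SmoothE Ω :=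
  S (coord i α)

/-- A smooth function on the jets over `Ω` that restricts to `f`. -/
noncomputable def extend (f : SmoothE Ω) : Jet n m → ℝ := Classical.choose f.2

theorem isSmooth_extend (f : SmoothE Ω) : IsSmooth Ω (extend f) := (Classical.choose_spec f.2).1

/-- The total derivative with respect to base coordinate number `a` on `C^∞(𝓔_fc)`: differentiate
a smooth extension and restrict. (The result does not depend on the extension, since the Cartan
tangent vectors are tangent to `𝓔_fc`.) -/
noncomputable def totalDerivE (hΩ : IsOpen Ω) (a : BaseIx n m) (f : SmoothE Ω) : SmoothE Ω :=
  restrict (totalDeriv a (extend f)) ((isSmooth_extend f).totalDeriv hΩ a)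

/-- `D_i = D_{x_i} + ∑_β v_i^β D_{v^β}`. -/
noncomputable def liftDeriv (hΩ : IsOpen Ω) (i : Fin n) (f : SmoothE Ω) : SmoothE Ω :=
  totalDerivE hΩ (Sum.inl i) f + ∑ β : Fin m, coord i β * totalDerivE hΩ (Sum.inr β) f

/-- `D_i(f^α) - ∑_β D_{v^β}(v_i^α) f^β`. -/
noncomputable def gaugeSection (hΩ : IsOpen Ω) (f : Fin m → SmoothE Ω) (i : Fin n) (α : Fin m) :
    SmoothE Ω :=
  liftDeriv hΩ i (f α) - ∑ β : Fin m, totalDerivE hΩ (Sum.inr β) (coord i α) * f β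

end FlatConn

/-!
Flat connections are locally the same as foliations transverse to the fibres, and the leaf through
a point `(x, v)` is the graph of a function of `x`. Let `w_{κ,τ}^α` be the derivative of order
`κ ≠ 0` in `x` of the leaf, followed by the Taylor coefficient of order `τ` with respect to the
point `v`. By flatness these numbers determine the infinite jet of the connection, and they are
arbitrary. Hence `𝓔_fc` is isomorphic to a model `Ω × ℝ^I` on which the `w_{κ,τ}^α` are free
coordinates (`exists_equiv`), and the total derivatives correspond to explicit commuting vector
fields `leafD`. One direction of the isomorphism substitutes iterated derivatives on the model for
the jet coordinates. The other one constructs the `w_{κ,τ}^α` in the quotient of the functions on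
the jets by the largest differential ideal vanishing on `𝓔_fc`, where the total derivatives commute
and the connection is flat. In particular the total derivatives are tangent to `𝓔_fc`.

A Cartan field is a combination of total derivatives whose coefficients are its values on the base
coordinates. Therefore symmetries are the derivations which kill functions of `(x, v)` and commute
with the total derivatives (`isSymmetry_iff`). Put `(∇_i f)^α = D_i f^α - ∑_β D_{v^β}(v_i^α) f^β`;
these operators commute. A generating section satisfies the linearised equation
`∇_i φ_j = ∇_j φ_i`. Conversely, a tuple `f` gives the symmetry with
`w_{κ,0}^α ↦ D^κ f^α - ∑_β f^β D_{v^β} w_{κ,0}^α` and generating section `∇_i f`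
(`exists_isLeafSymmetry`), and a symmetry is determined by its generating section.

It remains to see that the `∇_i` are injective and that `∇_i φ_j = ∇_j φ_i` forces `φ_i = ∇_i f`
(`existsUnique_leafNabla`). Both follow from the principal part of `∇_i`, which is
`∂/∂w_{κ+e_i,τ} ∘ ∇_i = ∂/∂w_{κ,τ}` for the greatest label `κ` occurring in the argument, with
respect to the lexicographic order. Injectivity is immediate. For two indices `i ≠ j` with `i`
minimal, and `∇_i Q = ∇_j P`, the mixed second derivatives of this equation show that the leading
derivatives of `P`, along the `w_{r+e_i,τ}`, are a closed family with respect to the `w_{r,τ}`.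
For `r ≠ 0` Poincaré's lemma gives `f` such that `P - ∇_i f` has a smaller greatest label. For
`r = 0`, where `w_{0,τ}` are no coordinates, the mixed derivatives determine `f` directly.
-/

namespace FlatConn

open Set Filter Topology MeasureTheory

/-! ### Integrals depending smoothly on parameters -/

theorem hasFDerivAt_integral_of_contDiffOn {P E : Type} [NormedAddCommGroup P] [NormedSpace ℝ P]
    [FiniteDimensional ℝ P] [NormedAddCommGroup E] [NormedSpace ℝ E]
    {U : Set P} (hU : IsOpen U) {H : P × ℝ → E} (hH : ContDiffOn ℝ 1 H (U ×ˢ univ))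
    {p : P} (hp : p ∈ U) :
    HasFDerivAt (fun q => ∫ t in (0 : ℝ)..1, H (q, t))
      (∫ t in (0 : ℝ)..1, (fderiv ℝ H (p, t)).comp (ContinuousLinearMap.inl ℝ P ℝ)) p := by
  have hopen : IsOpen (U ×ˢ (univ : Set ℝ)) := hU.prod isOpen_univ
  have hcont : ∀ q ∈ U, Continuous fun t : ℝ => H (q, t) := fun q hq =>
    hH.continuousOn.comp_continuous (by fun_prop) fun t => ⟨hq, trivial⟩
  have hD : ContinuousOn (fun z => (fderiv ℝ H z).comp (ContinuousLinearMap.inl ℝ P ℝ))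
      (U ×ˢ univ) :=
    (hH.continuousOn_fderiv_of_isOpen hopen le_rfl).clm_comp continuousOn_const
  have hDcont : ∀ q ∈ U, Continuous fun t : ℝ =>
      (fderiv ℝ H (q, t)).comp (ContinuousLinearMap.inl ℝ P ℝ) := fun q hq =>
    hD.comp_continuous (by fun_prop) fun t => ⟨hq, trivial⟩
  obtain ⟨K, hK, hKp, hKU⟩ := local_compact_nhds (hU.mem_nhds hp)
  obtain ⟨C, hC⟩ := (hKU.prod (isCompact_Icc (a := (0 : ℝ)) (b := 1))).exists_bound_of_continuousOn
    (hD.mono (prod_mono hKp (subset_univ _)))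
  refine intervalIntegral.hasFDerivAt_integral_of_dominated_of_fderiv_le (s := K)
    (bound := fun _ => C) (F := fun q t => H (q, t))
    (F' := fun q t => (fderiv ℝ H (q, t)).comp (ContinuousLinearMap.inl ℝ P ℝ)) hK ?_
    ((hcont p hp).intervalIntegrable _ _) (hDcont p hp).aestronglyMeasurable
    (ae_of_all _ fun t ht q hq => ?_) (by simp) (ae_of_all _ fun t _ q hq => ?_)
  · filter_upwards [hU.mem_nhds hp] with q hq using (hcont q hq).aestronglyMeasurable
  · refine hC (q, t) ⟨hq, ?_⟩
    rw [uIoc_of_le zero_le_one] at ht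
    exact ⟨ht.1.le, ht.2⟩
  · have h1 : HasFDerivAt H (fderiv ℝ H (q, t)) (q, t) :=
      ((hH.contDiffAt (hopen.mem_nhds ⟨hKp hq, trivial⟩)).differentiableAt (by simp)).hasFDerivAt
    have h2 : HasFDerivAt (fun q : P => (q, t)) (ContinuousLinearMap.inl ℝ P ℝ) q :=
      hasFDerivAt_prodMk_left q t
    exact h1.comp q h2

theorem contDiffOn_nat_integral {P : Type} [NormedAddCommGroup P] [NormedSpace ℝ P]
    [FiniteDimensional ℝ P] {U : Set P} (hU : IsOpen U) (k : ℕ) :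
    ∀ {E : Type} [NormedAddCommGroup E] [NormedSpace ℝ E] {H : P × ℝ → E},
      ContDiffOn ℝ (k + 1 : ℕ) H (U ×ˢ univ) →
        ContDiffOn ℝ k (fun q => ∫ t in (0 : ℝ)..1, H (q, t)) U := by
  induction k with
  | zero =>
    intro E _ _ H hH
    rw [Nat.cast_zero, contDiffOn_zero]
    exact fun p hp => (hasFDerivAt_integral_of_contDiffOn hU (by simpa using hH)
      hp).continuousAt.continuousWithinAt
  | succ k ih =>
    intro E _ _ H hH
    have h1 : ContDiffOn ℝ 1 H (U ×ˢ univ) := hH.of_le (by norm_cast; omega)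
    have hd : ∀ p ∈ U, HasFDerivAt (fun q => ∫ t in (0 : ℝ)..1, H (q, t)) _ p := fun p hp =>
      hasFDerivAt_integral_of_contDiffOn hU h1 hp
    have hk : ((k + 1 : ℕ) : WithTop ℕ∞) = (k : WithTop ℕ∞) + 1 := by norm_cast
    rw [hk, contDiffOn_succ_iff_fderiv_of_isOpen hU]
    refine ⟨fun p hp => (hd p hp).differentiableAt.differentiableWithinAt, by simp, ?_⟩
    have hf : ContDiffOn ℝ (k + 1 : ℕ)
        (fun z => (fderiv ℝ H z).comp (ContinuousLinearMap.inl ℝ P ℝ)) (U ×ˢ univ) :=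
      (hH.fderiv_of_isOpen (hU.prod isOpen_univ) (by norm_cast)).clm_comp contDiffOn_const
    exact (ih hf).congr fun p hp => (hd p hp).fderiv

theorem contDiffOn_integral {P E : Type} [NormedAddCommGroup P] [NormedSpace ℝ P]
    [FiniteDimensional ℝ P] [NormedAddCommGroup E] [NormedSpace ℝ E]
    {U : Set P} (hU : IsOpen U) {H : P × ℝ → E} (hH : ContDiffOn ℝ ∞ H (U ×ˢ univ)) :
    ContDiffOn ℝ ∞ (fun q => ∫ t in (0 : ℝ)..1, H (q, t)) U := by
  rw [contDiffOn_infty]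
  exact fun k => contDiffOn_nat_integral hU k (hH.of_le (by norm_cast; exact le_top))

end FlatConn

namespace FlatConn

open Set Filter Topology

/-! ### Smooth functions of finitely many fibre coordinates -/

section Cylinder

variable {ι : Type} [Fintype ι] {Ω : Set (ι → ℝ)} {I J : Type}

/-- `f` is a smooth function on `Ω × ℝ^I` which depends on finitely many of the coordinates
along `ℝ^I`. -/
def IsCyl (f : Ω × (I → ℝ) → ℝ) : Prop :=
  ∃ (s : Finset I) (G : (ι → ℝ) × (s → ℝ) → ℝ),
    ContDiffOn ℝ ∞ G (Ω ×ˢ univ) ∧ ∀ p, f p = G (p.1, fun k => p.2 k)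

theorem isCyl_coord (k : I) : IsCyl (fun p : Ω × (I → ℝ) => p.2 k) :=
  ⟨{k}, fun p => p.2 ⟨k, Finset.mem_singleton_self k⟩, by fun_prop, fun _ => rfl⟩

/-- Smooth functions of finitely many cylinder functions are cylinder functions. -/
theorem IsCyl.comp {K : Type} [Fintype K] {G : (ι → ℝ) × (K → ℝ) → ℝ}
    (hG : ContDiffOn ℝ ∞ G (Ω ×ˢ univ)) {g : K → Ω × (I → ℝ) → ℝ} (hg : ∀ k, IsCyl (g k)) :
    IsCyl fun p => G (p.1, fun k => g k p) := by
  classical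
  choose s H hH e using hg
  let t : Finset I := Finset.univ.biUnion s
  have hst : ∀ k (x : s k), (x : I) ∈ t := fun k x =>
    Finset.mem_biUnion.2 ⟨k, Finset.mem_univ k, x.2⟩
  refine ⟨t, fun q => G (q.1, fun k => H k (q.1, fun x => q.2 ⟨x, hst k x⟩)), ?_, fun p => ?_⟩
  · refine hG.comp (contDiffOn_fst.prodMk (contDiffOn_pi.2 fun k => ?_)) fun q hq => ⟨hq.1, trivial⟩
    exact (hH k).comp (ContDiff.contDiffOn (by fun_prop)) fun q hq => ⟨hq.1, trivial⟩
  · simp only [e]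

variable (Ω I) in
/-- The algebra of smooth functions on `Ω × ℝ^I` depending on finitely many of the coordinates
along `ℝ^I`. -/
def CylFun : Subalgebra ℝ (Ω × (I → ℝ) → ℝ) where
  carrier := {f | IsCyl f}
  mul_mem' := by
    intro f g hf hg
    exact IsCyl.comp (K := Bool) (G := fun q => q.2 true * q.2 false) (by fun_prop)
      (g := fun k => bif k then f else g) (by rintro (_ | _) <;> assumption)
  add_mem' := by
    intro f g hf hg
    exact IsCyl.comp (K := Bool) (G := fun q => q.2 true + q.2 false) (by fun_prop)
      (g := fun k => bif k then f else g) (by rintro (_ | _) <;> assumption)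
  algebraMap_mem' c := ⟨∅, fun _ => c, contDiffOn_const, fun _ => rfl⟩

namespace CylFun

/-- The fibre coordinate number `k`. -/
def coord (k : I) : CylFun Ω I := ⟨fun p => p.2 k, isCyl_coord k⟩

/-- A smooth function on `Ω`, regarded as a function on `Ω × ℝ^I`. -/
def base (h : (ι → ℝ) → ℝ) (hh : ContDiffOn ℝ ∞ h Ω) : CylFun Ω I :=
  ⟨fun p => h p.1, ∅, fun q => h q.1, hh.comp contDiffOn_fst fun _ hq => hq.1, fun _ => rfl⟩

theorem ext_apply {f g : CylFun Ω I} (h : ∀ p, f.1 p = g.1 p) : f = g :=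
  Subtype.ext (funext h)

theorem sum_apply {K : Type} (s : Finset K) (f : K → CylFun Ω I) (p : Ω × (I → ℝ)) :
    (∑ k ∈ s, f k).1 p = ∑ k ∈ s, (f k).1 p := by
  rw [AddSubmonoidClass.coe_finsetSum, Finset.sum_apply]

open Classical in
/-- The extension of `f` by zero to all of `ℝ^ι × ℝ^I`. -/
noncomputable def extendZero (f : CylFun Ω I) (z : (ι → ℝ) × (I → ℝ)) : ℝ :=
  if h : z.1 ∈ Ω then f.1 (⟨z.1, h⟩, z.2) else 0

theorem extendZero_apply (f : CylFun Ω I) (p : Ω × (I → ℝ)) :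
    extendZero f (p.1, p.2) = f.1 p := dif_pos p.1.2

/-- The directional derivatives of a cylinder function, computed in finitely many coordinates. -/
theorem hasLineDerivAt_of_rep (hΩ : IsOpen Ω) {f : CylFun Ω I} {F : (ι → ℝ) × (I → ℝ) → ℝ}
    (hF : ∀ p : Ω × (I → ℝ), F (p.1, p.2) = f.1 p) {s : Finset I}
    {G : (ι → ℝ) × (s → ℝ) → ℝ} (hG : ContDiffOn ℝ ∞ G (Ω ×ˢ univ))
    (e : ∀ p, f.1 p = G (p.1, fun k => p.2 k)) (p : Ω × (I → ℝ)) (y : (ι → ℝ) × (I → ℝ)) :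
    HasLineDerivAt ℝ F (fderiv ℝ G (p.1, fun k => p.2 k) (y.1, fun k => y.2 k)) (p.1, p.2) y := by
  let q : (ι → ℝ) × (s → ℝ) := (p.1, fun k => p.2 k)
  let w : (ι → ℝ) × (s → ℝ) := (y.1, fun k => y.2 k)
  have hopen : IsOpen (Ω ×ˢ (univ : Set (s → ℝ))) := hΩ.prod isOpen_univ
  have hd : HasLineDerivAt ℝ G (fderiv ℝ G q w) q w :=
    ((hG.contDiffAt (hopen.mem_nhds ⟨p.1.2, trivial⟩)).differentiableAt
      (by simp)).hasFDerivAt.hasLineDerivAt w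
  refine HasDerivAt.congr_of_eventuallyEq hd ?_
  have hc : ContinuousAt (fun r : ℝ => (p.1 : ι → ℝ) + r • y.1) 0 := by fun_prop
  filter_upwards [hc.preimage_mem_nhds (hΩ.mem_nhds (by simp))] with r hr
  exact (hF (⟨_, hr⟩, p.2 + r • y.2)).trans (e _)

theorem hasLineDerivAt (hΩ : IsOpen Ω) {f : CylFun Ω I} {F : (ι → ℝ) × (I → ℝ) → ℝ}
    (hF : ∀ p : Ω × (I → ℝ), F (p.1, p.2) = f.1 p) (p : Ω × (I → ℝ))
    (y : (ι → ℝ) × (I → ℝ)) :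
    HasLineDerivAt ℝ F (lineDeriv ℝ (extendZero f) (p.1, p.2) y) (p.1, p.2) y := by
  obtain ⟨s, G, hG, e⟩ := f.2
  rw [(hasLineDerivAt_of_rep hΩ (extendZero_apply f) hG e p y).lineDeriv]
  exact hasLineDerivAt_of_rep hΩ hF hG e p y

/-- The derivation of the algebra of cylinder functions given by the vector field
`∑ a, b a ∂_a + ∑ k, u k ∂_k`, with finitely many base directions `a` and arbitrarily many fibre
directions `k`. -/
noncomputable def vecField (hΩ : IsOpen Ω) (b : ι → CylFun Ω I) (u : I → CylFun Ω I) :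
    Derivation ℝ (CylFun Ω I) (CylFun Ω I) :=
  Derivation.mk'
    { toFun := fun f => ⟨fun p => lineDeriv ℝ (extendZero f) (p.1, p.2)
          (fun a => (b a).1 p, fun k => (u k).1 p), by
        obtain ⟨s, G, hG, e⟩ := f.2
        have h : (fun p : Ω × (I → ℝ) => lineDeriv ℝ (extendZero f) (p.1, p.2)
            (fun a => (b a).1 p, fun k => (u k).1 p)) = fun p => fderiv ℝ G
              (p.1, fun k => p.2 k) (fun a => (b a).1 p, fun k => (u k).1 p) :=
          funext fun p => (hasLineDerivAt_of_rep hΩ (extendZero_apply f) hG e p _).lineDeriv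
        rw [h]
        have hd : ContDiffOn ℝ ∞ (fderiv ℝ G) (Ω ×ˢ univ) :=
          hG.fderiv_of_isOpen (hΩ.prod isOpen_univ) (by simp)
        refine IsCyl.comp (I := I) (K := s ⊕ (ι ⊕ s)) (G := fun q => fderiv ℝ G
          (q.1, fun k => q.2 (.inl k)) (fun a => q.2 (.inr (.inl a)), fun k => q.2 (.inr (.inr k))))
          ?_ (g := Sum.elim (fun k p => p.2 k) (Sum.elim (fun a => (b a).1) fun k : s => (u k).1)) ?_
        · refine ContDiffOn.clm_apply (hd.comp (ContDiff.contDiffOn (by fun_prop)) ?_)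
            (ContDiff.contDiffOn (by fun_prop))
          exact fun q hq => ⟨hq.1, trivial⟩
        · rintro (k | a | k)
          exacts [isCyl_coord _, (b a).2, (u k).2]⟩
      map_add' := fun f g => ext_apply fun p => by
        refine HasLineDerivAt.lineDeriv ?_
        have := (hasLineDerivAt hΩ (extendZero_apply f) p
          (fun a => (b a).1 p, fun k => (u k).1 p)).add (hasLineDerivAt hΩ (extendZero_apply g) p
          (fun a => (b a).1 p, fun k => (u k).1 p))
        refine HasDerivAt.congr_of_eventuallyEq this (Eventually.of_forall fun r => ?_)
        simp only [extendZero, Pi.add_apply]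
        split_ifs <;> simp
      map_smul' := fun c f => ext_apply fun p => by
        refine HasLineDerivAt.lineDeriv ?_
        have := HasDerivAt.const_smul c (hasLineDerivAt hΩ (extendZero_apply f) p
          (fun a => (b a).1 p, fun k => (u k).1 p))
        refine HasDerivAt.congr_of_eventuallyEq this (Eventually.of_forall fun r => ?_)
        simp only [extendZero, Pi.smul_apply]
        split_ifs <;> simp }
    fun f g => ext_apply fun p => by
      refine HasLineDerivAt.lineDeriv ?_
      have := HasDerivAt.mul (hasLineDerivAt hΩ (extendZero_apply f) p
        (fun a => (b a).1 p, fun k => (u k).1 p)) (hasLineDerivAt hΩ (extendZero_apply g) p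
        (fun a => (b a).1 p, fun k => (u k).1 p))
      rw [zero_smul, add_zero, extendZero_apply, extendZero_apply] at this
      refine (HasDerivAt.congr_of_eventuallyEq this
        (Eventually.of_forall fun r => ?_)).congr_deriv ?_
      · simp only [extendZero, Pi.mul_apply]
        split_ifs <;> simp
      · exact (add_comm _ _).trans (congrArg₂ _ rfl (mul_comm _ _))

theorem vecField_apply (hΩ : IsOpen Ω) (b : ι → CylFun Ω I) (u : I → CylFun Ω I)
    {f : CylFun Ω I} {F : (ι → ℝ) × (I → ℝ) → ℝ} (hF : ∀ p : Ω × (I → ℝ), F (p.1, p.2) = f.1 p)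
    (p : Ω × (I → ℝ)) :
    (vecField hΩ b u f).1 p =
      lineDeriv ℝ F (p.1, p.2) (fun a => (b a).1 p, fun k => (u k).1 p) :=
  (hasLineDerivAt hΩ hF p _).lineDeriv.symm

theorem vecField_apply_of_rep (hΩ : IsOpen Ω) (b : ι → CylFun Ω I) (u : I → CylFun Ω I)
    {f : CylFun Ω I} {s : Finset I}
    {G : (ι → ℝ) × (s → ℝ) → ℝ} (hG : ContDiffOn ℝ ∞ G (Ω ×ˢ univ))
    (e : ∀ p, f.1 p = G (p.1, fun k => p.2 k)) (p : Ω × (I → ℝ)) :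
    (vecField hΩ b u f).1 p =
      fderiv ℝ G (p.1, fun k => p.2 k) (fun a => (b a).1 p, fun k => (u k).1 p) :=
  (hasLineDerivAt_of_rep hΩ (extendZero_apply f) hG e p _).lineDeriv

@[simp]
theorem vecField_coord (hΩ : IsOpen Ω) (b : ι → CylFun Ω I) (u : I → CylFun Ω I) (k : I) :
    vecField hΩ b u (coord k) = u k := ext_apply fun p => by
  rw [vecField_apply hΩ b u (F := fun z => z.2 k) (fun _ => rfl)]
  refine HasLineDerivAt.lineDeriv ?_
  have : HasDerivAt (fun r : ℝ => p.2 k + r * (u k).1 p) ((u k).1 p) 0 := by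
    simpa using ((hasDerivAt_id (0 : ℝ)).mul_const ((u k).1 p)).const_add (p.2 k)
  exact this

theorem vecField_base (hΩ : IsOpen Ω) (b : ι → CylFun Ω I) (u : I → CylFun Ω I)
    (h : (ι → ℝ) → ℝ) (hh : ContDiffOn ℝ ∞ h Ω) (p : Ω × (I → ℝ)) :
    (vecField hΩ b u (base h hh)).1 p = fderiv ℝ h p.1 fun a => (b a).1 p := by
  rw [vecField_apply hΩ b u (F := fun z => h z.1) (fun _ => rfl)]
  exact HasLineDerivAt.lineDeriv (((hh.contDiffAt (hΩ.mem_nhds p.1.2)).differentiableAt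
      (by simp)).hasFDerivAt.hasLineDerivAt fun a => (b a).1 p)

open Classical in
/-- The partial derivative along the fibre coordinate number `k`. -/
noncomputable def fibreDeriv (hΩ : IsOpen Ω) (k : I) : Derivation ℝ (CylFun Ω I) (CylFun Ω I) :=
  vecField hΩ 0 (Pi.single k 1)

open Classical in
/-- The partial derivative along the base coordinate number `a`. -/
noncomputable def baseDeriv (hΩ : IsOpen Ω) (a : ι) : Derivation ℝ (CylFun Ω I) (CylFun Ω I) :=
  vecField hΩ (Pi.single a 1) 0

open Classical in
theorem fibreDeriv_coord (hΩ : IsOpen Ω) (k l : I) :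
    fibreDeriv hΩ k (coord l : CylFun Ω I) = if l = k then 1 else 0 := by
  rw [fibreDeriv, vecField_coord, Pi.single_apply]

@[simp]
theorem fibreDeriv_base (hΩ : IsOpen Ω) (k : I) (h : (ι → ℝ) → ℝ) (hh : ContDiffOn ℝ ∞ h Ω) :
    fibreDeriv hΩ k (base h hh : CylFun Ω I) = 0 := ext_apply fun p => by
  rw [fibreDeriv, vecField_base]
  exact map_zero _

/-- A base derivative of a function on `Ω` is a function on `Ω`. -/
theorem baseDeriv_base [DecidableEq ι] (hΩ : IsOpen Ω) (a : ι) (h : (ι → ℝ) → ℝ)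
    (hh : ContDiffOn ℝ ∞ h Ω) :
    baseDeriv hΩ a (base h hh : CylFun Ω I) = base (fun x => fderiv ℝ h x (Pi.single a 1))
      ((hh.fderiv_of_isOpen hΩ (by simp)).clm_apply contDiffOn_const) := ext_apply fun p => by
  rw [baseDeriv, vecField_base]
  change fderiv ℝ h p.1 _ = fderiv ℝ h p.1 _
  congr 1
  ext c
  rcases eq_or_ne c a with rfl | hc
  · simp
  · simp [hc]

/-! ### The chain rule for derivations -/

/-- **Hadamard's lemma**, along the fibres of `Ω × ℝ^I → Ω`: a tangent vector which kills the
functions on the base is the combination of the fibre derivatives given by its values on the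
fibre coordinates. The finite set of coordinates depends on the function only. -/
theorem exists_finset_chain (hΩ : IsOpen Ω) (f : CylFun Ω I) :
    ∃ s : Finset I, (∀ k ∉ s, fibreDeriv hΩ k f = 0) ∧
      ∀ (p : Ω × (I → ℝ)) (L : CylFun Ω I →ₗ[ℝ] ℝ),
        (∀ g g', L (g * g') = g.1 p * L g' + g'.1 p * L g) → (∀ h hh, L (base h hh) = 0) →
        L f = ∑ k ∈ s, L (coord k) * (fibreDeriv hΩ k f).1 p := by
  classical
  obtain ⟨s, G, hG, e⟩ := f.2
  refine ⟨s, fun k hk => ext_apply fun p => ?_, fun p L hL hL0 => ?_⟩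
  · rw [fibreDeriv, vecField_apply_of_rep hΩ _ _ hG e]
    have : ((fun a => ((0 : ι → CylFun Ω I) a).1 p,
        fun j : s => ((Pi.single k 1 : I → CylFun Ω I) j).1 p) : (ι → ℝ) × (s → ℝ)) = 0 := by
      refine Prod.ext rfl (funext fun j => ?_)
      have hj : (j : I) ≠ k := fun h => hk (h ▸ j.2)
      simp [hj]
    rw [this, map_zero]
    rfl
  · let u₀ : s → ℝ := fun k => p.2 k
    have hopen : IsOpen (Ω ×ˢ (univ : Set (s → ℝ))) := hΩ.prod isOpen_univ
    let γ : ((ι → ℝ) × (s → ℝ)) × ℝ → (ι → ℝ) × (s → ℝ) :=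
      fun z => (z.1.1, u₀ + z.2 • (z.1.2 - u₀))
    have hd : ContDiffOn ℝ ∞ (fderiv ℝ G) (Ω ×ˢ univ) := hG.fderiv_of_isOpen hopen (by simp)
    have hγ : ContDiffOn ℝ ∞ (fun z => fderiv ℝ G (γ z)) ((Ω ×ˢ univ) ×ˢ univ) :=
      hd.comp (ContDiff.contDiffOn (by fun_prop)) fun z hz => ⟨hz.1.1, trivial⟩
    have hγk : ∀ k : s, ContDiffOn ℝ ∞ (fun z => fderiv ℝ G (γ z) (0, Pi.single k 1))
        ((Ω ×ˢ univ) ×ˢ univ) := fun k => hγ.clm_apply contDiffOn_const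
    let g : s → CylFun Ω I := fun k =>
      ⟨fun q => ∫ t in (0 : ℝ)..1, fderiv ℝ G (γ ((q.1, fun j => q.2 j), t)) (0, Pi.single k 1),
        s, fun z => ∫ t in (0 : ℝ)..1, fderiv ℝ G (γ (z, t)) (0, Pi.single k 1),
        contDiffOn_integral hopen (hγk k), fun _ => rfl⟩
    have hbase : ContDiffOn ℝ ∞ (fun b => G (b, u₀)) Ω :=
      hG.comp (ContDiff.contDiffOn (by fun_prop)) fun b hb => ⟨hb, trivial⟩
    have hf : f = base _ hbase + ∑ k : s, (coord (k : I) - algebraMap ℝ _ (p.2 k)) * g k := by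
      refine ext_apply fun q => ?_
      change _ = G (q.1, u₀) + (∑ k : s, (coord (k : I) - algebraMap ℝ _ (p.2 k)) * g k).1 q
      rw [sum_apply]
      change _ = G (q.1, u₀) + ∑ k : s, (q.2 k - p.2 k) * ∫ t in (0 : ℝ)..1, _
      let w : s → ℝ := fun j => q.2 j
      have hline : ∀ t : ℝ, HasDerivAt (fun t : ℝ => G (γ ((q.1, w), t)))
          (fderiv ℝ G (γ ((q.1, w), t)) (0, w - u₀)) t := fun t => by
        have h1 : HasFDerivAt G (fderiv ℝ G (γ ((q.1, w), t))) (γ ((q.1, w), t)) :=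
          ((hG.contDiffAt (hopen.mem_nhds ⟨q.1.2, trivial⟩)).differentiableAt (by simp)).hasFDerivAt
        have h2 : HasDerivAt (fun t : ℝ => γ ((q.1, w), t)) (0, w - u₀) t := by
          refine (hasDerivAt_const t _).prodMk ?_
          simpa using ((hasDerivAt_id t).smul_const (w - u₀)).const_add u₀
        exact h1.comp_hasDerivAt t h2
      have hc : ∀ v, Continuous fun t : ℝ => fderiv ℝ G (γ ((q.1, w), t)) v := fun v =>
        (hγ.continuousOn.clm_apply continuousOn_const).comp_continuous
          (f := fun t : ℝ => (((q.1 : ι → ℝ), w), t)) (by fun_prop)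
          fun t => ⟨⟨q.1.2, trivial⟩, trivial⟩
      have hint := intervalIntegral.integral_eq_sub_of_hasDerivAt (a := 0) (b := 1)
        (fun t _ => hline t) ((hc _).intervalIntegrable _ _)
      have h1 : γ ((q.1, w), 1) = ((q.1 : ι → ℝ), w) := by simp [γ]
      have h0 : γ ((q.1, w), 0) = ((q.1 : ι → ℝ), u₀) := by simp [γ]
      rw [h1, h0] at hint
      have hdec : ((0, w - u₀) : (ι → ℝ) × (s → ℝ)) =
          ∑ k : s, (q.2 k - p.2 k) • (0, Pi.single k 1) := by
        refine Prod.ext ?_ ?_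
        · simp [Prod.fst_sum]
        · rw [Prod.snd_sum]
          ext j
          simp [Finset.sum_apply, Pi.single_apply, w, u₀]
      rw [e q, show G (q.1, fun k : s => q.2 k) = G (q.1, u₀) + (G (q.1, w) - G (q.1, u₀)) by
        simp [w], ← hint]
      congr 1
      simp_rw [hdec, map_sum, map_smul, smul_eq_mul]
      refine (intervalIntegral.integral_finsetSum
        fun k _ => (continuous_const.mul (hc _)).intervalIntegrable _ _).trans ?_
      exact Finset.sum_congr rfl fun k _ => intervalIntegral.integral_const_mul _ _
    have hconst : ∀ c : ℝ, L (algebraMap ℝ _ c) = 0 := fun c =>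
      hL0 (fun _ => c) contDiffOn_const
    have hg : ∀ k : s, (g k).1 p = (fibreDeriv hΩ (k : I) f).1 p := fun k => by
      rw [fibreDeriv, vecField_apply_of_rep hΩ _ _ hG e]
      change (∫ t in (0 : ℝ)..1, fderiv ℝ G (γ ((p.1, u₀), t)) (0, Pi.single k 1)) = _
      have hγ0 : ∀ t, γ ((p.1, u₀), t) = ((p.1 : ι → ℝ), u₀) := fun t => by simp [γ]
      simp_rw [hγ0]
      rw [intervalIntegral.integral_const, sub_zero, one_smul]
      congr 1
      refine Prod.ext rfl (funext fun j => ?_)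
      rcases eq_or_ne j k with rfl | hj
      · simp
      · have : (j : I) ≠ k := fun h => hj (Subtype.ext h)
        simp [hj, this]
    have hterm : ∀ k : s, L ((coord (k : I) - algebraMap ℝ _ (p.2 k)) * g k) =
        L (coord (k : I)) * (fibreDeriv hΩ (k : I) f).1 p := fun k => by
      rw [hL, map_sub, hconst, sub_zero, hg, mul_comm (L _)]
      have : ((coord (k : I) - algebraMap ℝ (CylFun Ω I) (p.2 k)) : CylFun Ω I).1 p = 0 :=
        sub_self (p.2 k)
      rw [this, zero_mul, zero_add]
    conv_lhs => rw [hf]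
    rw [map_add, hL0, zero_add, map_sum, Finset.sum_congr rfl fun k _ => hterm k]
    exact Finset.sum_coe_sort s fun k => L (coord k) * (fibreDeriv hΩ k f).1 p

end CylFun

end Cylinder

end FlatConn

namespace FlatConn

open Set Filter Topology

namespace CylFun

variable {ι : Type} [Fintype ι] {Ω : Set (ι → ℝ)} {I J : Type}

/-- The chain rule for derivations which kill the functions on the base. -/
theorem exists_finset_derivation (hΩ : IsOpen Ω) (f : CylFun Ω I) :
    ∃ s : Finset I, (∀ k ∉ s, fibreDeriv hΩ k f = 0) ∧
      ∀ Z : Derivation ℝ (CylFun Ω I) (CylFun Ω I), (∀ h hh, Z (base h hh) = 0) →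
        Z f = ∑ k ∈ s, Z (coord k) * fibreDeriv hΩ k f := by
  obtain ⟨s, hs, h⟩ := exists_finset_chain hΩ f
  refine ⟨s, hs, fun Z hZ => ext_apply fun p => ?_⟩
  rw [sum_apply]
  refine h p ⟨⟨fun g => (Z g).1 p, fun g g' => by simp⟩, fun c g => by simp⟩ ?_ fun h hh => ?_
  · intro g g'
    change (Z (g * g')).1 p = _
    rw [Derivation.leibniz]
    rfl
  · change (Z (base h hh)).1 p = 0
    rw [hZ]
    rfl

theorem derivation_eq_zero (hΩ : IsOpen Ω) {Z : Derivation ℝ (CylFun Ω I) (CylFun Ω I)}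
    (h0 : ∀ h hh, Z (base h hh) = 0) (h1 : ∀ k, Z (coord k) = 0) : Z = 0 := by
  ext1 f
  obtain ⟨s, -, h⟩ := exists_finset_derivation hΩ f
  rw [h Z h0]
  simp [h1]

/-- The substitution of cylinder functions for the fibre coordinates. -/
def subst (g : I → CylFun Ω J) : CylFun Ω I →ₐ[ℝ] CylFun Ω J where
  toFun f := ⟨fun p => f.1 (p.1, fun k => (g k).1 p), by
    obtain ⟨s, G, hG, e⟩ := f.2
    simp only [e]
    exact IsCyl.comp hG fun k : s => (g k).2⟩
  map_one' := rfl
  map_mul' _ _ := rfl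
  map_zero' := rfl
  map_add' _ _ := rfl
  commutes' _ := rfl

theorem subst_apply (g : I → CylFun Ω J) (f : CylFun Ω I) (p : Ω × (J → ℝ)) :
    (subst g f).1 p = f.1 (p.1, fun k => (g k).1 p) := rfl

@[simp]
theorem subst_coord (g : I → CylFun Ω J) (k : I) : subst g (coord k) = g k := rfl

@[simp]
theorem subst_base (g : I → CylFun Ω J) (h : (ι → ℝ) → ℝ) (hh : ContDiffOn ℝ ∞ h Ω) :
    subst g (base h hh) = base h hh := rfl

/-- The chain rule for the failure of a substitution to intertwine two derivations. -/
theorem exists_finset_subst (hΩ : IsOpen Ω) (g : I → CylFun Ω J)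
    (D : Derivation ℝ (CylFun Ω I) (CylFun Ω I)) (D' : Derivation ℝ (CylFun Ω J) (CylFun Ω J))
    (h0 : ∀ h hh, D' (base h hh) = subst g (D (base h hh))) (f : CylFun Ω I) :
    ∃ s : Finset I, D' (subst g f) - subst g (D f) =
      ∑ k ∈ s, (D' (g k) - subst g (D (coord k))) * subst g (fibreDeriv hΩ k f) := by
  obtain ⟨s, -, h⟩ := exists_finset_chain hΩ f
  refine ⟨s, ext_apply fun p => ?_⟩
  rw [sum_apply]
  refine h (p.1, fun k => (g k).1 p)
    ⟨⟨fun f => (D' (subst g f) - subst g (D f)).1 p, fun f f' => ?_⟩, fun c f => ?_⟩ ?_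
    fun h hh => ?_
  · rw [map_add, map_add, map_add, map_add, add_sub_add_comm]
    rfl
  · change (D' (subst g (c • f)) - subst g (D (c • f))).1 p =
      c • (D' (subst g f) - subst g (D f)).1 p
    rw [map_smul, D'.map_smul, D.map_smul, map_smul, ← smul_sub]
    rfl
  · intro f f'
    change (D' (subst g (f * f')) - subst g (D (f * f'))).1 p =
      (subst g f).1 p * (D' (subst g f') - subst g (D f')).1 p +
        (subst g f').1 p * (D' (subst g f) - subst g (D f)).1 p
    have : D' (subst g (f * f')) - subst g (D (f * f')) =
        subst g f * (D' (subst g f') - subst g (D f')) +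
          subst g f' * (D' (subst g f) - subst g (D f)) := by
      simp only [map_mul, Derivation.leibniz, smul_eq_mul, map_add]
      ring
    rw [this]
    rfl
  · change (D' (subst g (base h hh)) - subst g (D (base h hh))).1 p = 0
    rw [subst_base, h0, sub_self]
    rfl

/-! ### Primitives along fibre coordinates -/

open Classical in
theorem hasDerivAt_update (hΩ : IsOpen Ω) (f : CylFun Ω I) (k : I) (b : Ω) (u : I → ℝ) (x : ℝ) :
    HasDerivAt (fun r => f.1 (b, Function.update u k r))
      ((fibreDeriv hΩ k f).1 (b, Function.update u k x)) x := by
  have h := hasLineDerivAt hΩ (extendZero_apply f) (b, Function.update u k x)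
    (fun a => ((0 : ι → CylFun Ω I) a).1 (b, Function.update u k x),
      fun j => ((Pi.single k 1 : I → CylFun Ω I) j).1 (b, Function.update u k x))
  have h' := HasDerivAt.comp_sub_const (f := fun t => extendZero f _) x x (by rw [sub_self]; exact h)
  refine h'.congr_of_eventuallyEq (Eventually.of_forall fun r => ?_)
  refine (extendZero_apply f (b, Function.update u k r)).symm.trans
    (congrArg (extendZero f) (Prod.ext ?_ (funext fun j => ?_)))
  · ext a
    change _ = (b : ι → ℝ) a + (r - x) * 0
    simp
  · change Function.update u k r j = Function.update u k x j +
      (r - x) * ((Pi.single k 1 : I → CylFun Ω I) j).1 (b, Function.update u k x)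
    rcases eq_or_ne j k with rfl | hj
    · rw [Function.update_self, Function.update_self, Pi.single_eq_same]
      change r = x + (r - x) * 1
      ring
    · rw [Function.update_of_ne hj, Function.update_of_ne hj, Pi.single_eq_of_ne hj]
      change u j = u j + (r - x) * 0
      ring

open Classical in
theorem fibreDeriv_eq_zero_iff (hΩ : IsOpen Ω) (f : CylFun Ω I) (k : I) :
    fibreDeriv hΩ k f = 0 ↔
      ∀ (b : Ω) (u : I → ℝ) (x : ℝ), f.1 (b, Function.update u k x) = f.1 (b, u) := by
  refine ⟨fun h b u x => ?_, fun h => ext_apply fun p => ?_⟩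
  · have hd : ∀ r, HasDerivAt (fun r => f.1 (b, Function.update u k r)) 0 r := fun r => by
      have := hasDerivAt_update hΩ f k b u r
      rw [h] at this
      exact this
    have := is_const_of_deriv_eq_zero (fun r => (hd r).differentiableAt) (fun r => (hd r).deriv)
      x (u k)
    rwa [Function.update_eq_self] at this
  · have h1 := hasDerivAt_update hΩ f k p.1 p.2 (p.2 k)
    rw [Function.update_eq_self] at h1
    have h2 : HasDerivAt (fun r => f.1 (p.1, Function.update p.2 k r)) 0 (p.2 k) := by
      simp only [h]
      exact hasDerivAt_const _ _
    exact h1.unique h2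

theorem exists_primitive (hΩ : IsOpen Ω) (k : I) (f : CylFun Ω I) :
    ∃ F : CylFun Ω I, fibreDeriv hΩ k F = f ∧
      ∀ l, l ≠ k → fibreDeriv hΩ l f = 0 → fibreDeriv hΩ l F = 0 := by
  classical
  obtain ⟨s, G, hG, e⟩ := f.2
  have hcyl : IsCyl fun p : Ω × (I → ℝ) =>
      p.2 k * ∫ t in (0 : ℝ)..1, f.1 (p.1, Function.update p.2 k (t * p.2 k)) := by
    let up : (ι → ℝ) × (Option s → ℝ) → ℝ → s → ℝ := fun z t j =>
      if (j : I) = k then t * z.2 none else z.2 (some j)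
    have hup : ContDiff ℝ ∞ fun z : ((ι → ℝ) × (Option s → ℝ)) × ℝ => up z.1 z.2 := by
      refine contDiff_pi.2 fun j => ?_
      by_cases hj : (j : I) = k
      · simp only [up, hj, if_true]
        fun_prop
      · simp only [up, hj, if_false]
        fun_prop
    have h1 : ContDiffOn ℝ ∞ (fun z : (ι → ℝ) × (Option s → ℝ) =>
        z.2 none * ∫ t in (0 : ℝ)..1, G (z.1, up z t)) (Ω ×ˢ univ) := by
      refine ContDiffOn.mul (ContDiff.contDiffOn (by fun_prop)) (contDiffOn_integral
        (H := fun z => G (z.1.1, up z.1 z.2)) (hΩ.prod isOpen_univ) (hG.comp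
          (ContDiff.contDiffOn ((contDiff_fst.fst).prodMk hup)) fun z hz => ⟨hz.1.1, trivial⟩))
    have h2 := IsCyl.comp (I := I) h1
      (g := fun o => o.elim (fun p => p.2 k) fun j p => p.2 (j : I))
      (by rintro (_ | j) <;> exact isCyl_coord _)
    refine (congrArg IsCyl (funext fun p => ?_)).mp h2
    simp only [e]
    congr 2
    ext t
    congr 2
    ext j
    by_cases hj : (j : I) = k
    · simp [up, hj]
    · simp [up, hj]
  refine ⟨⟨_, hcyl⟩, ext_apply fun p => ?_, fun l hl hf => ?_⟩
  · have hcont : Continuous fun r => f.1 (p.1, Function.update p.2 k r) :=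
      continuous_iff_continuousAt.2 fun r => (hasDerivAt_update hΩ f k p.1 p.2 r).continuousAt
    have hF : ∀ r, (⟨_, hcyl⟩ : CylFun Ω I).1 (p.1, Function.update p.2 k r) =
        ∫ y in (0 : ℝ)..r, f.1 (p.1, Function.update p.2 k y) := fun r => by
      change Function.update p.2 k r k * ∫ t in (0 : ℝ)..1, f.1 (p.1, Function.update
        (Function.update p.2 k r) k (t * Function.update p.2 k r k)) = _
      simp only [Function.update_self, Function.update_idem]
      have := intervalIntegral.mul_integral_comp_mul_right (a := 0) (b := 1)
        (f := fun y => f.1 (p.1, Function.update p.2 k y)) r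
      simpa using this
    have h1 := hasDerivAt_update hΩ (⟨_, hcyl⟩ : CylFun Ω I) k p.1 p.2 (p.2 k)
    have h2 := intervalIntegral.integral_hasDerivAt_right (hcont.intervalIntegrable 0 (p.2 k))
      (hcont.stronglyMeasurableAtFilter _ _) hcont.continuousAt
    have h3 := h1.unique (h2.congr_of_eventuallyEq (Eventually.of_forall hF))
    rwa [Function.update_eq_self] at h3
  · rw [fibreDeriv_eq_zero_iff] at hf ⊢
    intro b u x
    change Function.update u l x k * (∫ t in (0 : ℝ)..1, f.1 (b, Function.update
      (Function.update u l x) k (t * Function.update u l x k))) = u k * ∫ t in (0 : ℝ)..1, _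
    simp only [Function.update_of_ne hl.symm, Function.update_comm hl x _ u, hf]

theorem derivation_ite_one_zero (Z : Derivation ℝ (CylFun Ω I) (CylFun Ω I)) (c : Prop)
    [Decidable c] : Z (if c then 1 else 0) = 0 := by
  split_ifs
  exacts [Z.map_one_eq_zero, map_zero Z]

theorem fibreDeriv_comm (hΩ : IsOpen Ω) (k l : I) (f : CylFun Ω I) :
    fibreDeriv hΩ k (fibreDeriv hΩ l f) = fibreDeriv hΩ l (fibreDeriv hΩ k f) := by
  classical
  have : ⁅fibreDeriv hΩ k, fibreDeriv hΩ l⁆ = (0 : Derivation ℝ (CylFun Ω I) (CylFun Ω I)) :=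
    derivation_eq_zero hΩ (fun h hh => by
      rw [Derivation.commutator_apply, fibreDeriv_base, fibreDeriv_base, map_zero, map_zero,
        sub_self]) fun j => by
      simp only [Derivation.commutator_apply, fibreDeriv_coord, derivation_ite_one_zero, sub_self]
  have := congrArg (fun Z : Derivation ℝ (CylFun Ω I) (CylFun Ω I) => Z f) this
  exact sub_eq_zero.1 ((Derivation.commutator_apply f).symm.trans this)

open Classical in
/-- The vector field `∂_a + ∑ k, u k ∂_k`, where `a` is the number of a base coordinate. -/
noncomputable def liftField (hΩ : IsOpen Ω) (a : ι) (u : I → CylFun Ω I) :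
    Derivation ℝ (CylFun Ω I) (CylFun Ω I) := vecField hΩ (Pi.single a 1) u

@[simp]
theorem liftField_coord (hΩ : IsOpen Ω) (a : ι) (u : I → CylFun Ω I) (k : I) :
    liftField hΩ a u (coord k) = u k := vecField_coord _ _ _ _

theorem liftField_base (hΩ : IsOpen Ω) (a : ι) (u : I → CylFun Ω I) (h : (ι → ℝ) → ℝ)
    (hh : ContDiffOn ℝ ∞ h Ω) :
    liftField hΩ a u (base h hh) = baseDeriv hΩ a (base h hh) :=
  ext_apply fun p => by rw [baseDeriv, liftField, vecField_base, vecField_base]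

theorem baseDeriv_comm_base (hΩ : IsOpen Ω) (a c : ι) (h : (ι → ℝ) → ℝ)
    (hh : ContDiffOn ℝ ∞ h Ω) :
    baseDeriv hΩ a (baseDeriv hΩ c (base h hh : CylFun Ω I)) =
      baseDeriv hΩ c (baseDeriv hΩ a (base h hh)) := by
  classical
  simp only [baseDeriv_base]
  refine ext_apply fun p => ?_
  have hc := hh.contDiffAt (hΩ.mem_nhds p.1.2)
  have hd : DifferentiableAt ℝ (fderiv ℝ h) p.1 :=
    (hc.fderiv_right (m := 1) (by norm_cast)).differentiableAt (by simp)
  have hs := hc.isSymmSndFDerivAt (by simp [minSmoothness_of_isRCLikeNormedField]; norm_cast)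
  have key : ∀ v w, fderiv ℝ (fun x => fderiv ℝ h x v) p.1 w = fderiv ℝ (fderiv ℝ h) p.1 w v :=
    fun v w => by
      rw [fderiv_clm_apply hd (differentiableAt_const v)]
      simp
  change fderiv ℝ (fun x => fderiv ℝ h x _) p.1 _ = fderiv ℝ (fun x => fderiv ℝ h x _) p.1 _
  rw [key, key]
  exact hs _ _

/-- Two vector fields which are lifts of coordinate vector fields on the base commute as soon as
their commutator kills the fibre coordinates. -/
theorem liftField_comm (hΩ : IsOpen Ω) (a c : ι) (u u' : I → CylFun Ω I)
    (hu : ∀ k, liftField hΩ a u (u' k) = liftField hΩ c u' (u k)) (f : CylFun Ω I) :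
    liftField hΩ a u (liftField hΩ c u' f) = liftField hΩ c u' (liftField hΩ a u f) := by
  classical
  have : ⁅liftField hΩ a u, liftField hΩ c u'⁆ = 0 :=
    derivation_eq_zero hΩ (fun h hh => by
      rw [Derivation.commutator_apply, liftField_base, liftField_base, baseDeriv_base,
        baseDeriv_base, liftField_base, liftField_base, ← baseDeriv_base hΩ c h hh,
        ← baseDeriv_base hΩ a h hh, baseDeriv_comm_base, sub_self])
      fun k => by rw [Derivation.commutator_apply, liftField_coord, liftField_coord, hu, sub_self]
  have := congrArg (fun Z : Derivation ℝ (CylFun Ω I) (CylFun Ω I) => Z f) this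
  exact sub_eq_zero.1 ((Derivation.commutator_apply f).symm.trans this)

/-- **Poincaré's lemma** for finitely many fibre coordinates. -/
theorem exists_potential (hΩ : IsOpen Ω) (s : Finset I) (A : I → CylFun Ω I)
    (hA : ∀ k ∈ s, ∀ l ∈ s, fibreDeriv hΩ k (A l) = fibreDeriv hΩ l (A k)) :
    ∃ F : CylFun Ω I, (∀ k ∈ s, fibreDeriv hΩ k F = A k) ∧
      ∀ l ∉ s, (∀ k ∈ s, fibreDeriv hΩ l (A k) = 0) → fibreDeriv hΩ l F = 0 := by
  classical
  induction s using Finset.induction_on with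
  | empty => exact ⟨0, fun k hk => absurd hk (Finset.notMem_empty k), fun l _ _ => map_zero _⟩
  | insert k s hk ih =>
    obtain ⟨F, hF, hF'⟩ := ih fun k hk l hl =>
      hA k (Finset.mem_insert_of_mem hk) l (Finset.mem_insert_of_mem hl)
    obtain ⟨H, hH, hH'⟩ := exists_primitive hΩ k (A k - fibreDeriv hΩ k F)
    refine ⟨F + H, fun l hl => ?_, fun l hl hl' => ?_⟩
    · rw [map_add]
      rcases Finset.mem_insert.1 hl with rfl | hls
      · rw [hH, add_sub_cancel]
      · rw [hF l hls, hH' l (fun h => hk (h ▸ hls)), add_zero]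
        rw [map_sub, fibreDeriv_comm hΩ l k F, hF l hls,
          hA l hl k (Finset.mem_insert_self k s), sub_self]
    · have hls : l ∉ s := fun h => hl (Finset.mem_insert_of_mem h)
      have h1 := hF' l hls fun j hj => hl' j (Finset.mem_insert_of_mem hj)
      rw [map_add, h1, zero_add]
      refine hH' l (fun h => hl (h ▸ Finset.mem_insert_self k s)) ?_
      rw [map_sub, fibreDeriv_comm hΩ l k F, h1, map_zero, sub_zero,
        hl' k (Finset.mem_insert_self k s)]

end CylFun

end FlatConn

namespace FlatConn

open Finset.HasAntidiagonal (antidiagonal mem_antidiagonal)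

/-! ### Taylor coefficients with respect to commuting derivations -/

theorem multiIx_induction {ι : Type} {p : (ι →₀ ℕ) → Prop} (h0 : p 0)
    (hadd : ∀ σ b, p σ → p (σ + Finsupp.single b 1)) (σ : ι →₀ ℕ) : p σ := by
  have key : ∀ τ : ι →₀ ℕ, ∀ σ, p σ → p (σ + τ) := by
    intro τ
    induction τ using Finsupp.induction_linear with
    | zero => exact fun σ h => by rwa [add_zero]
    | add f g hf hg => exact fun σ h => by rw [← add_assoc]; exact hg _ (hf σ h)
    | single a k =>
      induction k with
      | zero => exact fun σ h => by rwa [Finsupp.single_zero, add_zero]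
      | succ k ih =>
        exact fun σ h => by rw [Finsupp.single_add, ← add_assoc]; exact hadd _ _ (ih σ h)
  simpa using key σ 0 h0

section Families

variable {ι : Type} {B : Type} [CommRing B] [Algebra ℝ B] (D : ι → Derivation ℝ B B)

/-- `a σ` is the iterated derivative `D^σ (a 0)`. -/
def IsJetFamily (a : (ι →₀ ℕ) → B) : Prop :=
  ∀ b σ, D b (a σ) = a (σ + Finsupp.single b 1)

/-- `a σ` is the Taylor coefficient `D^σ (a 0) / σ!`. -/
def IsTaylor (a : (ι →₀ ℕ) → B) : Prop :=
  ∀ b σ, D b (a σ) = ((σ b : ℝ) + 1) • a (σ + Finsupp.single b 1)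

variable {D}

theorem exists_isJetFamily [Fintype ι] (hD : ∀ b c f, D b (D c f) = D c (D b f)) (f : B) :
    ∃ a, IsJetFamily D a ∧ a 0 = f := by
  classical
  let E : ι → Module.End ℝ B := fun b => (D b : B →ₗ[ℝ] B)
  have hE : ∀ b c, Commute (E b) (E c) := fun b c => LinearMap.ext fun f => hD b c f
  let H := MonoidHom.noncommPiCoprod (fun b => powersHom (Module.End ℝ B) (E b))
    (fun b c _ x y => ((hE b c).pow_pow _ _))
  refine ⟨fun σ => H (fun b => Multiplicative.ofAdd (σ b)) f, fun b σ => ?_, ?_⟩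
  · have h1 : E b = H (Pi.mulSingle b (Multiplicative.ofAdd 1)) :=
      ((MonoidHom.noncommPiCoprod_mulSingle _ _ _).trans (by simp)).symm
    have h2 : (Pi.mulSingle b (Multiplicative.ofAdd 1) * fun c => Multiplicative.ofAdd (σ c)) =
        fun c => Multiplicative.ofAdd ((σ + Finsupp.single b 1 : ι →₀ ℕ) c) := by
      ext c
      rcases eq_or_ne c b with rfl | hc
      · simp [add_comm]
      · simp [hc]
    change E b (H _ f) = H (fun c => Multiplicative.ofAdd ((σ + Finsupp.single b 1 : ι →₀ ℕ) c)) f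
    rw [← h2, map_mul, ← h1]
    rfl
  · have : (fun b => Multiplicative.ofAdd ((0 : ι →₀ ℕ) b)) = 1 := rfl
    simp only [this, map_one]
    rfl

theorem exists_isTaylor [Fintype ι] (hD : ∀ b c f, D b (D c f) = D c (D b f)) (f : B) :
    ∃ a, IsTaylor D a ∧ a 0 = f := by
  classical
  obtain ⟨a, ha, h0⟩ := exists_isJetFamily hD f
  refine ⟨fun σ => (∏ c, ((σ c).factorial : ℝ))⁻¹ • a σ, fun b σ => ?_, by simp [h0]⟩
  have hprod : ∏ c, (((σ + Finsupp.single b 1 : ι →₀ ℕ) c).factorial : ℝ) =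
      ((σ b : ℝ) + 1) * ∏ c, ((σ c).factorial : ℝ) := by
    rw [← Finset.mul_prod_erase _ _ (Finset.mem_univ b),
      ← Finset.mul_prod_erase _ (fun c => ((σ c).factorial : ℝ)) (Finset.mem_univ b), ← mul_assoc]
    congr 1
    · simp [Nat.factorial_succ]
    · refine Finset.prod_congr rfl fun c hc => ?_
      simp [Finset.ne_of_mem_erase hc]
  have hne : (σ b : ℝ) + 1 ≠ 0 := by positivity
  beta_reduce
  rw [(D b).map_smul, ha b σ, hprod, smul_smul, mul_inv, ← mul_assoc, mul_inv_cancel₀ hne, one_mul]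

theorem IsJetFamily.ext {a a' : (ι →₀ ℕ) → B} (h : IsJetFamily D a) (h' : IsJetFamily D a')
    (h0 : a 0 = a' 0) (σ : ι →₀ ℕ) : a σ = a' σ := by
  induction σ using multiIx_induction with
  | h0 => exact h0
  | hadd σ b ih => rw [← h, ← h', ih]

theorem IsTaylor.ext {a a' : (ι →₀ ℕ) → B} (h : IsTaylor D a) (h' : IsTaylor D a')
    (h0 : a 0 = a' 0) (σ : ι →₀ ℕ) : a σ = a' σ := by
  induction σ using multiIx_induction with
  | h0 => exact h0
  | hadd σ b ih =>
    have hne : (σ b : ℝ) + 1 ≠ 0 := by positivity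
    have h1 := congrArg (D b) ih
    rw [h, h'] at h1
    rw [← inv_smul_smul₀ hne (a _), h1, inv_smul_smul₀ hne]

/-- An `ℝ`-linear map intertwining two families of derivations maps Taylor coefficients to
Taylor coefficients. -/
theorem IsTaylor.map {C : Type} [CommRing C] [Algebra ℝ C] {D' : ι → Derivation ℝ C C}
    {a : (ι →₀ ℕ) → B} (h : IsTaylor D a) (L : B →ₗ[ℝ] C) (hL : ∀ b f, D' b (L f) = L (D b f)) :
    IsTaylor D' fun σ => L (a σ) := fun b σ => by rw [hL, h, map_smul]

theorem isTaylor_zero : IsTaylor D fun _ => 0 := fun b σ => by rw [map_zero, smul_zero]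

theorem IsTaylor.sub {a a' : (ι →₀ ℕ) → B} (h : IsTaylor D a) (h' : IsTaylor D a') :
    IsTaylor D fun σ => a σ - a' σ := fun b σ => by rw [map_sub, h, h', smul_sub]

theorem IsTaylor.sum {K : Type} (s : Finset K) {a : K → (ι →₀ ℕ) → B}
    (h : ∀ k, IsTaylor D (a k)) : IsTaylor D fun σ => ∑ k ∈ s, a k σ := fun b σ => by
  rw [map_sum, Finset.smul_sum]
  exact Finset.sum_congr rfl fun k _ => h k b σ

theorem sum_antidiagonal_fst [DecidableEq ι] (τ : ι →₀ ℕ) (b : ι)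
    (F : (ι →₀ ℕ) → (ι →₀ ℕ) → B) :
    ∑ x ∈ antidiagonal τ, ((x.1 b : ℝ) + 1) • F (x.1 + Finsupp.single b 1) x.2 =
      ∑ x ∈ antidiagonal (τ + Finsupp.single b 1 : ι →₀ ℕ), (x.1 b : ℝ) • F x.1 x.2 := by
  refine Finset.sum_of_injOn (fun x => (x.1 + Finsupp.single b 1, x.2)) ?_ ?_ ?_ ?_
  · intro x _ y _ h
    simpa [Prod.ext_iff] using h
  · intro x hx
    simp only [Finset.mem_coe, mem_antidiagonal] at hx ⊢
    rw [← hx]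
    abel
  · intro x hx hx'
    have h0 : x.1 b = 0 := by
      by_contra h
      refine hx' ⟨(x.1 - Finsupp.single b 1, x.2), ?_, ?_⟩
      · have hle : Finsupp.single b 1 ≤ x.1 := by
          rw [Finsupp.single_le_iff]
          omega
        rw [mem_antidiagonal] at hx
        rw [Finset.mem_coe, mem_antidiagonal]
        refine add_right_cancel (b := Finsupp.single b 1) ?_
        rw [← hx, add_right_comm, tsub_add_cancel_of_le hle]
      · have hle : Finsupp.single b 1 ≤ x.1 := by
          rw [Finsupp.single_le_iff]
          omega
        simp [tsub_add_cancel_of_le hle]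
    rw [h0, Nat.cast_zero, zero_smul]
  · intro x _
    simp

theorem sum_antidiagonal_snd [DecidableEq ι] (τ : ι →₀ ℕ) (b : ι)
    (F : (ι →₀ ℕ) → (ι →₀ ℕ) → B) :
    ∑ x ∈ antidiagonal τ, ((x.2 b : ℝ) + 1) • F x.1 (x.2 + Finsupp.single b 1) =
      ∑ x ∈ antidiagonal (τ + Finsupp.single b 1 : ι →₀ ℕ), (x.2 b : ℝ) • F x.1 x.2 := by
  have h := sum_antidiagonal_fst τ b fun x y => F y x
  rw [← Finset.sum_equiv (Equiv.prodComm _ _) (s := antidiagonal τ)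
      (t := antidiagonal τ) (by simp [add_comm]) (fun x _ => rfl),
    ← Finset.sum_equiv (Equiv.prodComm _ _) (s := antidiagonal (τ + Finsupp.single b 1 : ι →₀ ℕ))
      (t := antidiagonal (τ + Finsupp.single b 1 : ι →₀ ℕ)) (by simp [add_comm]) (fun x _ => rfl)] at h
  exact h

/-- The Leibniz rule for Taylor coefficients. -/
theorem IsTaylor.conv [DecidableEq ι] {a a' : (ι →₀ ℕ) → B} (h : IsTaylor D a)
    (h' : IsTaylor D a') : IsTaylor D fun τ => ∑ x ∈ antidiagonal τ, a x.1 * a' x.2 := by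
  intro b τ
  have h1 := sum_antidiagonal_fst τ b fun x y => a x * a' y
  have h2 := sum_antidiagonal_snd τ b fun x y => a x * a' y
  calc D b (∑ x ∈ antidiagonal τ, a x.1 * a' x.2)
      = ∑ x ∈ antidiagonal τ, (((x.1 b : ℝ) + 1) • (a (x.1 + Finsupp.single b 1) * a' x.2) +
          ((x.2 b : ℝ) + 1) • (a x.1 * a' (x.2 + Finsupp.single b 1))) := by
        rw [map_sum]
        refine Finset.sum_congr rfl fun x _ => ?_
        rw [Derivation.leibniz, h, h', smul_eq_mul, smul_eq_mul, mul_smul_comm, mul_smul_comm,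
          mul_comm (a' _), add_comm]
    _ = _ := by
        rw [Finset.sum_add_distrib, h1, h2, ← Finset.sum_add_distrib, Finset.smul_sum]
        refine Finset.sum_congr rfl fun x hx => ?_
        rw [← add_smul]
        congr 1
        have := DFunLike.congr_fun (mem_antidiagonal.1 hx) b
        simp only [Finsupp.add_apply, Finsupp.single_eq_same] at this
        exact_mod_cast this

end Families

section Lift

variable {n m : ℕ} {B : Type} [CommRing B] [Algebra ℝ B]
  (D : BaseIx n m → Derivation ℝ B B) (p : Fin n → Fin m → B)

/-- The horizontal lift `D_i = D_{x_i} + ∑_β p_i^β D_{v^β}` for derivations `D` and connection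
coefficients `p` in an arbitrary algebra. -/
def horLift (i : Fin n) : Derivation ℝ B B := D (.inl i) + ∑ β, p i β • D (.inr β)

theorem derivation_sum_apply {K : Type} (s : Finset K) (Z : K → Derivation ℝ B B) (f : B) :
    (∑ k ∈ s, Z k) f = ∑ k ∈ s, Z k f :=
  (congrFun (map_sum Derivation.coeFnAddMonoidHom Z s) f).trans (Finset.sum_apply _ _ _)

theorem horLift_apply (i : Fin n) (f : B) :
    horLift D p i f = D (.inl i) f + ∑ β, p i β * D (.inr β) f := by
  rw [horLift, Derivation.add_apply, derivation_sum_apply]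
  rfl

variable {D p}

/-- For a connection without curvature, the commutators of the horizontal lifts are those of the
derivations `D_{x_i}`. -/
theorem horLift_sub_horLift (hvv : ∀ β γ f, D (.inr β) (D (.inr γ) f) = D (.inr γ) (D (.inr β) f))
    (hvx : ∀ β i f, D (.inr β) (D (.inl i) f) = D (.inl i) (D (.inr β) f)) {i j : Fin n}
    (hp : ∀ α, horLift D p i (p j α) = horLift D p j (p i α)) (f : B) :
    horLift D p i (horLift D p j f) - horLift D p j (horLift D p i f) =
      D (.inl i) (D (.inl j) f) - D (.inl j) (D (.inl i) f) := by
  have key : ∀ i j, horLift D p i (horLift D p j f) = D (.inl i) (D (.inl j) f) +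
      (∑ β, (p i β * D (.inl j) (D (.inr β) f) + p j β * D (.inl i) (D (.inr β) f)) +
      ∑ β, horLift D p i (p j β) * D (.inr β) f +
      ∑ β, ∑ γ, p i γ * p j β * D (.inr γ) (D (.inr β) f)) := by
    intro i j
    rw [horLift_apply D p j, map_add, map_sum, horLift_apply D p i (D (.inl j) f)]
    have : ∀ β, horLift D p i (p j β * D (.inr β) f) = p j β * D (.inl i) (D (.inr β) f) +
        ∑ γ, p i γ * p j β * D (.inr γ) (D (.inr β) f) +
          horLift D p i (p j β) * D (.inr β) f := by
      intro β
      rw [Derivation.leibniz, smul_eq_mul, smul_eq_mul, horLift_apply D p i (D (.inr β) f),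
        mul_add, Finset.mul_sum, mul_comm (D _ f)]
      congr 2
      exact Finset.sum_congr rfl fun γ _ => by ring
    simp_rw [this, Finset.sum_add_distrib, hvx]
    abel
  have h1 : ∑ β, ∑ γ, p i γ * p j β * D (.inr γ) (D (.inr β) f) =
      ∑ β, ∑ γ, p j γ * p i β * D (.inr γ) (D (.inr β) f) := by
    rw [Finset.sum_comm]
    refine Finset.sum_congr rfl fun β _ => Finset.sum_congr rfl fun γ _ => ?_
    rw [hvv β, mul_comm (p i β)]
  have h2 : ∑ β, (p i β * D (.inl j) (D (.inr β) f) + p j β * D (.inl i) (D (.inr β) f)) =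
      ∑ β, (p j β * D (.inl i) (D (.inr β) f) + p i β * D (.inl j) (D (.inr β) f)) :=
    Finset.sum_congr rfl fun β _ => add_comm _ _
  rw [key i j, key j i, h1, h2]
  simp_rw [hp]
  exact add_sub_add_right_eq_sub _ _ _

/-- Horizontal lifts of a flat connection commute. -/
theorem horLift_comm (hD : ∀ a b f, D a (D b f) = D b (D a f))
    (hp : ∀ i j α, horLift D p i (p j α) = horLift D p j (p i α)) (i j : Fin n) (f : B) :
    horLift D p i (horLift D p j f) = horLift D p j (horLift D p i f) := by
  rw [← sub_eq_zero, horLift_sub_horLift (fun _ _ _ => hD _ _ _) (fun _ _ _ => hD _ _ _) (hp i j),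
    hD (.inl i), sub_self]

/-- In the presence of functions `v^α` which are coordinates along the fibres, a flat connection
determines its Taylor coefficients `w_{κ,τ}^α = D_v^τ D^κ v^α / τ!`, where `D^κ` is an iterated
horizontal lift. -/
theorem exists_taylor_of_flat (hD : ∀ a b f, D a (D b f) = D b (D a f))
    (hp : ∀ i j α, horLift D p i (p j α) = horLift D p j (p i α))
    {v : Fin m → B} (hx : ∀ i α, D (.inl i) (v α) = 0)
    (hv : ∀ β α, D (.inr β) (v α) = if β = α then 1 else 0) :
    ∃ w : (Fin n →₀ ℕ) → Fin m → (Fin m →₀ ℕ) → B,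
      (∀ κ α, IsTaylor (fun β => D (.inr β)) (w κ α)) ∧
      (∀ i κ α, horLift D p i (w κ α 0) = w (κ + Finsupp.single i 1) α 0) ∧
      ∀ i α, w (Finsupp.single i 1) α 0 = p i α := by
  choose u hu hu0 using fun α => exists_isJetFamily (horLift_comm hD hp) (v α)
  choose w hw hw0 using fun κ α =>
    exists_isTaylor (D := fun β => D (.inr β)) (fun b c f => hD _ _ f) (u α κ)
  refine ⟨w, hw, fun i κ α => ?_, fun i α => ?_⟩
  · rw [hw0, hw0, hu]
  · have h := hu α i 0
    rw [zero_add, hu0] at h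
    rw [hw0, ← h, horLift_apply, hx, zero_add]
    simp [hv]

theorem horLift_taylor (hD : ∀ a b f, D a (D b f) = D b (D a f))
    {w : (Fin n →₀ ℕ) → Fin m → (Fin m →₀ ℕ) → B}
    (hw : ∀ κ α, IsTaylor (fun β => D (.inr β)) (w κ α))
    (hp : ∀ i α, w (Finsupp.single i 1) α 0 = p i α) (i : Fin n) (κ : Fin n →₀ ℕ) (α : Fin m)
    (hκ : horLift D p i (w κ α 0) = w (κ + Finsupp.single i 1) α 0) (τ : Fin m →₀ ℕ) :
    D (.inl i) (w κ α τ) = w (κ + Finsupp.single i 1) α τ -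
      ∑ γ, ∑ x ∈ antidiagonal τ, w (Finsupp.single i 1) γ x.1 *
        (((x.2 γ : ℝ) + 1) • w κ α (x.2 + Finsupp.single γ 1)) := by
  refine IsTaylor.ext (D := fun β => D (.inr β))
    ((hw κ α).map (D (.inl i) : B →ₗ[ℝ] B) fun b f => hD _ _ f)
    ((hw _ α).sub (IsTaylor.sum _ fun γ => (hw _ γ).conv
      (a' := fun σ => ((σ γ : ℝ) + 1) • w κ α (σ + Finsupp.single γ 1)) ?_)) ?_ τ
  · have h := (hw κ α).map (D' := fun β => D (.inr β)) (D (.inr γ) : B →ₗ[ℝ] B)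
      fun b f => hD _ _ f
    have e : (fun σ => ((σ γ : ℝ) + 1) • w κ α (σ + Finsupp.single γ 1)) =
        fun σ => (D (.inr γ) : B →ₗ[ℝ] B) (w κ α σ) := funext fun σ => (hw κ α γ σ).symm
    rw [e]
    exact h
  · rw [← hκ, horLift_apply]
    have h : ∀ γ, D (.inr γ) (w κ α 0) = w κ α (Finsupp.single γ 1) := fun γ => by
      simpa using hw κ α γ 0
    simp [h, hp]

end Lift

end FlatConn

namespace FlatConn

open Finset.HasAntidiagonal (antidiagonal mem_antidiagonal)
open CylFun

/-! ### The model of the equation of flat connections -/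

section Model

variable {n m : ℕ} {Ω : Set (BaseIx n m → ℝ)}

/-- Labels `(κ, α, τ)` of the internal coordinates of the equation of flat connections. The
coordinate with this label is the Taylor coefficient, with respect to the initial point along the
fibre and with label `τ`, of the derivative of order `κ ≠ 0` of the component number `α` of the
leaves of the horizontal foliation. -/
abbrev LeafIx (n m : ℕ) : Type := {κ : Fin n →₀ ℕ // κ ≠ 0} × Fin m × (Fin m →₀ ℕ)

variable (Ω) in
/-- Smooth functions on the model of the equation of flat connections. -/
abbrev LeafFun : Type := CylFun Ω (LeafIx n m)

/-- The coordinate `w_{κ,τ}^α` of the model. By convention it vanishes for `κ = 0`. -/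
noncomputable def leafCoord (κ : Fin n →₀ ℕ) (α : Fin m) (τ : Fin m →₀ ℕ) : LeafFun Ω :=
  if h : κ ≠ 0 then CylFun.coord (⟨κ, h⟩, α, τ) else 0

theorem leafCoord_of_ne {κ : Fin n →₀ ℕ} (h : κ ≠ 0) (α : Fin m) (τ : Fin m →₀ ℕ) :
    (leafCoord κ α τ : LeafFun Ω) = CylFun.coord (⟨κ, h⟩, α, τ) := dif_pos h

/-- The value of the total derivative `D_{x_i}` on the coordinate `w_{κ,τ}^α`. -/
noncomputable def leafDx (i : Fin n) (κ : Fin n →₀ ℕ) (α : Fin m) (τ : Fin m →₀ ℕ) : LeafFun Ω :=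
  leafCoord (κ + Finsupp.single i 1) α τ -
    ∑ γ, ∑ x ∈ antidiagonal τ, leafCoord (Finsupp.single i 1) γ x.1 *
      (((x.2 γ : ℝ) + 1) • leafCoord κ α (x.2 + Finsupp.single γ 1))

/-- The total derivatives on the model. -/
noncomputable def leafD (hΩ : IsOpen Ω) : BaseIx n m → Derivation ℝ (LeafFun Ω) (LeafFun Ω)
  | .inl i => liftField hΩ (.inl i) fun k => leafDx i k.1 k.2.1 k.2.2
  | .inr β => liftField hΩ (.inr β) fun k =>
      ((k.2.2 β : ℝ) + 1) • leafCoord k.1 k.2.1 (k.2.2 + Finsupp.single β 1)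

/-- The coefficients `v_i^α` of the connection on the model. -/
noncomputable def leafConn (i : Fin n) (α : Fin m) : LeafFun Ω :=
  leafCoord (Finsupp.single i 1) α 0

/-- The horizontal lifts `D_i` on the model. -/
noncomputable def leafLift (hΩ : IsOpen Ω) (i : Fin n) : Derivation ℝ (LeafFun Ω) (LeafFun Ω) :=
  horLift (leafD hΩ) leafConn i

theorem single_one_ne_zero {ι : Type} (i : ι) : Finsupp.single i (1 : ℕ) ≠ 0 := by simp

theorem add_single_ne_zero {ι : Type} (κ : ι →₀ ℕ) (i : ι) : κ + Finsupp.single i 1 ≠ 0 := by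
  intro h
  have := DFunLike.congr_fun h i
  simp at this

theorem isTaylor_leafCoord (hΩ : IsOpen Ω) (κ : Fin n →₀ ℕ) (α : Fin m) :
    IsTaylor (B := LeafFun Ω) (fun β => leafD hΩ (.inr β)) (leafCoord κ α) := by
  intro β τ
  by_cases h : κ ≠ 0
  · rw [leafCoord_of_ne h]
    exact liftField_coord _ _ _ _
  · simp only [leafCoord, dif_neg h, map_zero, smul_zero]

theorem leafD_inl_leafCoord (hΩ : IsOpen Ω) (i : Fin n) {κ : Fin n →₀ ℕ} (h : κ ≠ 0) (α : Fin m)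
    (τ : Fin m →₀ ℕ) : leafD hΩ (.inl i) (leafCoord κ α τ) = leafDx i κ α τ := by
  rw [leafCoord_of_ne h]
  exact liftField_coord _ _ _ _

theorem leafD_base (hΩ : IsOpen Ω) (a : BaseIx n m) (h : (BaseIx n m → ℝ) → ℝ)
    (hh : ContDiffOn ℝ ∞ h Ω) : leafD hΩ a (base h hh) = baseDeriv hΩ a (base h hh) := by
  cases a <;> exact liftField_base _ _ _ _ _

theorem isTaylor_shift_leafCoord (hΩ : IsOpen Ω) (κ : Fin n →₀ ℕ) (α γ : Fin m) :
    IsTaylor (B := LeafFun Ω) (fun β => leafD hΩ (.inr β)) fun σ =>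
      ((σ γ : ℝ) + 1) • (leafCoord κ α (σ + Finsupp.single γ 1) : LeafFun Ω) := by
  intro β σ
  have h := isTaylor_leafCoord hΩ κ α
  have hβ := h β (σ + Finsupp.single γ 1)
  rw [(leafD hΩ (.inr β)).map_smul, hβ, smul_smul, smul_smul, add_right_comm σ]
  congr 1
  rcases eq_or_ne β γ with rfl | hβγ
  · simp
  · simp [hβγ, hβγ.symm]
    ring

theorem leafD_inr_comm (hΩ : IsOpen Ω) (β γ : Fin m) (f : LeafFun Ω) :
    leafD hΩ (.inr β) (leafD hΩ (.inr γ) f) = leafD hΩ (.inr γ) (leafD hΩ (.inr β) f) := by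
  refine liftField_comm hΩ _ _ _ _ (fun k => ?_) f
  change leafD hΩ (.inr β) (((k.2.2 γ : ℝ) + 1) • leafCoord k.1 k.2.1 (k.2.2 + _)) =
    leafD hΩ (.inr γ) (((k.2.2 β : ℝ) + 1) • leafCoord k.1 k.2.1 (k.2.2 + _))
  rw [isTaylor_shift_leafCoord, Derivation.map_smul, isTaylor_leafCoord hΩ, smul_smul]

theorem isTaylor_leafDx (hΩ : IsOpen Ω) (i : Fin n) (κ : Fin n →₀ ℕ) (α : Fin m) :
    IsTaylor (B := LeafFun Ω) (fun β => leafD hΩ (.inr β)) (leafDx i κ α) :=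
  have h := fun γ => (isTaylor_leafCoord hΩ (Finsupp.single i 1) γ).conv
    (isTaylor_shift_leafCoord hΩ κ α γ)
  (isTaylor_leafCoord hΩ (κ + Finsupp.single i 1) α).sub (IsTaylor.sum Finset.univ h)

theorem leafD_inr_inl_comm (hΩ : IsOpen Ω) (β : Fin m) (i : Fin n) (f : LeafFun Ω) :
    leafD hΩ (.inr β) (leafD hΩ (.inl i) f) = leafD hΩ (.inl i) (leafD hΩ (.inr β) f) := by
  refine liftField_comm hΩ _ _ _ _ (fun k => ?_) f
  change leafD hΩ (.inr β) (leafDx i k.1 k.2.1 k.2.2) =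
    leafD hΩ (.inl i) (((k.2.2 β : ℝ) + 1) • leafCoord k.1 k.2.1 (k.2.2 + _))
  rw [isTaylor_leafDx, Derivation.map_smul, leafD_inl_leafCoord hΩ i k.1.2]

theorem leafLift_leafCoord (hΩ : IsOpen Ω) (i : Fin n) {κ : Fin n →₀ ℕ} (h : κ ≠ 0) (α : Fin m) :
    leafLift hΩ i (leafCoord κ α 0) = leafCoord (κ + Finsupp.single i 1) α 0 := by
  rw [leafLift, horLift_apply, leafD_inl_leafCoord hΩ i h, leafDx]
  have h : ∀ γ, leafD hΩ (.inr γ) (leafCoord κ α 0) = leafCoord κ α (Finsupp.single γ 1) :=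
    fun γ => by simpa using isTaylor_leafCoord hΩ κ α γ 0
  simp [h, leafConn]

theorem leafLift_leafConn (hΩ : IsOpen Ω) (i j : Fin n) (α : Fin m) :
    leafLift hΩ i (leafConn j α) = leafLift hΩ j (leafConn i α) := by
  rw [leafConn, leafConn, leafLift_leafCoord hΩ i (single_one_ne_zero j),
    leafLift_leafCoord hΩ j (single_one_ne_zero i), add_comm]

theorem leafD_inl_comm (hΩ : IsOpen Ω) (i j : Fin n) (f : LeafFun Ω) :
    leafD hΩ (.inl i) (leafD hΩ (.inl j) f) = leafD hΩ (.inl j) (leafD hΩ (.inl i) f) := by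
  refine liftField_comm hΩ _ _ _ _ (fun k => ?_) f
  change leafD hΩ (.inl i) (leafDx j k.1 k.2.1 k.2.2) = leafD hΩ (.inl j) (leafDx i k.1 k.2.1 k.2.2)
  refine IsTaylor.ext (B := LeafFun Ω) (D := fun β => leafD hΩ (.inr β))
    ((isTaylor_leafDx hΩ j k.1 k.2.1).map (leafD hΩ (.inl i) : LeafFun Ω →ₗ[ℝ] LeafFun Ω)
      fun b f => leafD_inr_inl_comm hΩ b i f)
    ((isTaylor_leafDx hΩ i k.1 k.2.1).map (leafD hΩ (.inl j) : LeafFun Ω →ₗ[ℝ] LeafFun Ω)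
      fun b f => leafD_inr_inl_comm hΩ b j f) ?_ k.2.2
  have h := horLift_sub_horLift (leafD_inr_comm hΩ) (leafD_inr_inl_comm hΩ)
    (leafLift_leafConn hΩ i j) (leafCoord k.1 k.2.1 0)
  change leafLift hΩ i (leafLift hΩ j _) - leafLift hΩ j (leafLift hΩ i _) = _ at h
  rw [leafLift_leafCoord hΩ i k.1.2, leafLift_leafCoord hΩ j k.1.2,
    leafLift_leafCoord hΩ _ (add_single_ne_zero _ _),
    leafLift_leafCoord hΩ _ (add_single_ne_zero _ _), add_right_comm, sub_self,
    leafD_inl_leafCoord hΩ i k.1.2, leafD_inl_leafCoord hΩ j k.1.2] at h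
  exact (sub_eq_zero.1 h.symm)

/-- The total derivatives on the model commute. -/
theorem leafD_comm (hΩ : IsOpen Ω) (a b : BaseIx n m) (f : LeafFun Ω) :
    leafD hΩ a (leafD hΩ b f) = leafD hΩ b (leafD hΩ a f) := by
  rcases a with i | β <;> rcases b with j | γ
  exacts [leafD_inl_comm hΩ i j f, (leafD_inr_inl_comm hΩ γ i f).symm, leafD_inr_inl_comm hΩ β j f,
    leafD_inr_comm hΩ β γ f]

theorem leafLift_comm (hΩ : IsOpen Ω) (i j : Fin n) (f : LeafFun Ω) :
    leafLift hΩ i (leafLift hΩ j f) = leafLift hΩ j (leafLift hΩ i f) :=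
  horLift_comm (leafD_comm hΩ) (leafLift_leafConn hΩ) i j f

end Model

/-! ### Jets and their total derivatives -/

section Jets

variable {n m : ℕ} {Ω : Set (BaseIx n m → ℝ)}

variable (Ω) in
/-- Smooth functions on the infinite jets over `Ω`. -/
abbrev JetFun : Type := CylFun Ω (JetIx n m)

/-- The total derivatives on the infinite jets. -/
noncomputable def jetD (hΩ : IsOpen Ω) (a : BaseIx n m) : Derivation ℝ (JetFun Ω) (JetFun Ω) :=
  liftField hΩ a fun k => CylFun.coord (k.1, k.2.1, k.2.2 + Finsupp.single a 1)

theorem jetD_coord (hΩ : IsOpen Ω) (a : BaseIx n m) (k : JetIx n m) :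
    jetD hΩ a (CylFun.coord k) = CylFun.coord (k.1, k.2.1, k.2.2 + Finsupp.single a 1) :=
  liftField_coord _ _ _ _

theorem jetD_base (hΩ : IsOpen Ω) (a : BaseIx n m) (h : (BaseIx n m → ℝ) → ℝ)
    (hh : ContDiffOn ℝ ∞ h Ω) : jetD hΩ a (base h hh) = baseDeriv hΩ a (base h hh) :=
  liftField_base _ _ _ _ _

theorem jetD_comm (hΩ : IsOpen Ω) (a b : BaseIx n m) (f : JetFun Ω) :
    jetD hΩ a (jetD hΩ b f) = jetD hΩ b (jetD hΩ a f) := by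
  refine liftField_comm hΩ _ _ _ _ (fun k => ?_) f
  change jetD hΩ a (CylFun.coord _) = jetD hΩ b (CylFun.coord _)
  rw [jetD_coord, jetD_coord, add_right_comm]

/-- The coefficients `v_i^α` of the connection on the infinite jets. -/
def jetConn (i : Fin n) (α : Fin m) : JetFun Ω := CylFun.coord (i, α, 0)

/-- The horizontal lifts `D_i` on the infinite jets. -/
noncomputable def jetLift (hΩ : IsOpen Ω) (i : Fin n) : Derivation ℝ (JetFun Ω) (JetFun Ω) :=
  horLift (B := JetFun Ω) (jetD hΩ) jetConn i

/-- The flatness equations, as functions on the infinite jets. -/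
noncomputable def flatFun (hΩ : IsOpen Ω) (i j : Fin n) (α : Fin m) : JetFun Ω :=
  jetLift hΩ i (jetConn j α) - jetLift hΩ j (jetConn i α)

/-- A smooth function on the infinite jets in the sense of `IsSmooth`, as an element of the algebra
of cylinder functions. -/
def toJetFun (F : Jet n m → ℝ) (hF : IsSmooth Ω F) : JetFun Ω :=
  ⟨fun p => F (p.1, p.2), by
    obtain ⟨s, G, hG, e⟩ := hF
    exact ⟨s, G, hG, fun p => e (p.1, p.2) p.1.2⟩⟩

theorem isSmooth_extendZero (f : JetFun Ω) : IsSmooth Ω (extendZero f) := by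
  obtain ⟨s, G, hG, e⟩ := f.2
  exact ⟨s, G, hG, fun θ hθ => (extendZero_apply f (⟨θ.1, hθ⟩, θ.2)).trans (e _)⟩

theorem totalDeriv_eq_jetD (hΩ : IsOpen Ω) (a : BaseIx n m) {F : Jet n m → ℝ} {f : JetFun Ω}
    (hF : ∀ p : Ω × (JetIx n m → ℝ), F (p.1, p.2) = f.1 p) (p : Ω × (JetIx n m → ℝ)) :
    totalDeriv a F (p.1, p.2) = (jetD hΩ a f).1 p := by
  classical
  rw [jetD, liftField, vecField_apply hΩ _ _ hF]
  refine congrArg (lineDeriv ℝ F _) (Prod.ext (funext fun b => ?_) rfl)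
  dsimp only [cartanVec]
  rcases eq_or_ne b a with rfl | hb
  · simp only [Pi.single_eq_same]
    rfl
  · have h0 : ∀ inst : DecidableEq (BaseIx n m),
        ((@Pi.single _ (fun _ => JetFun Ω) _ inst a 1 : BaseIx n m → JetFun Ω) b).1 p = 0 :=
      fun inst => by
        rw [Pi.single_eq_of_ne hb]
        rfl
    rw [Pi.single_eq_of_ne hb]
    exact (h0 _).symm

theorem foldr_totalDeriv_eq (hΩ : IsOpen Ω) (l : List (BaseIx n m)) {F : Jet n m → ℝ}
    {f : JetFun Ω} (hF : ∀ p : Ω × (JetIx n m → ℝ), F (p.1, p.2) = f.1 p)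
    (p : Ω × (JetIx n m → ℝ)) :
    (l.foldr totalDeriv F) (p.1, p.2) = (l.foldr (fun a => jetD hΩ a) f).1 p := by
  induction l generalizing p with
  | nil => exact hF p
  | cons a l ih => exact totalDeriv_eq_jetD hΩ a ih p

theorem flatEq_eq_flatFun (hΩ : IsOpen Ω) (i j : Fin n) (α : Fin m)
    (p : Ω × (JetIx n m → ℝ)) : flatEq i j α (p.1, p.2) = (flatFun hΩ i j α).1 p := by
  have key : ∀ i j, (jetLift hΩ i (jetConn j α) : JetFun Ω).1 p =
      p.2 (j, α, Finsupp.single (Sum.inl i) 1) +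
        ∑ β : Fin m, p.2 (i, β, 0) * p.2 (j, α, Finsupp.single (Sum.inr β) 1) := by
    intro i j
    rw [jetLift, horLift_apply]
    simp only [jetConn, jetD_coord, zero_add]
    change _ + (∑ β : Fin m, CylFun.coord (i, β, 0) *
      CylFun.coord (j, α, Finsupp.single (Sum.inr β) 1) : JetFun Ω).1 p = _
    rw [CylFun.sum_apply]
    rfl
  change _ = (jetLift hΩ i (jetConn j α) : JetFun Ω).1 p -
    (jetLift hΩ j (jetConn i α) : JetFun Ω).1 p
  rw [key, key]
  rfl

/-- Total derivatives only depend on the restriction to `Ω`, so membership in the prolonged equation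
can be tested with cylinder functions. -/
theorem mem_Efc_iff (hΩ : IsOpen Ω) (p : Ω × (JetIx n m → ℝ)) :
    ((p.1 : BaseIx n m → ℝ), p.2) ∈ Efc Ω ↔
      ∀ l i j α, (List.foldr (fun a => jetD hΩ a) (flatFun hΩ i j α) l).1 p = 0 := by
  constructor
  · rintro ⟨-, h⟩ l i j α
    rw [← foldr_totalDeriv_eq hΩ l (flatEq_eq_flatFun hΩ i j α)]
    exact h l i j α
  · refine fun h => ⟨p.1.2, fun l i j α => ?_⟩
    rw [foldr_totalDeriv_eq hΩ l (flatEq_eq_flatFun hΩ i j α)]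
    exact h l i j α

/-! ### The differential ideal of the equation -/

/-- A point of the prolonged equation, with its base point regarded as a point of `Ω`. -/
def efcPoint (θ : Efc Ω) : Ω × (JetIx n m → ℝ) := (⟨θ.1.1, θ.2.1⟩, θ.1.2)

theorem foldr_derivation_add {ι B : Type} [CommRing B] [Algebra ℝ B] (D : ι → Derivation ℝ B B)
    (l : List ι) (f g : B) : l.foldr (fun a => D a) (f + g) =
      l.foldr (fun a => D a) f + l.foldr (fun a => D a) g := by
  induction l with
  | nil => rfl
  | cons a l ih => rw [List.foldr_cons, ih, map_add]; rfl

theorem foldr_derivation_zero {ι B : Type} [CommRing B] [Algebra ℝ B] (D : ι → Derivation ℝ B B)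
    (l : List ι) : l.foldr (fun a => D a) (0 : B) = 0 := by
  induction l with
  | nil => rfl
  | cons a l ih => rw [List.foldr_cons, ih, map_zero]

/-- The largest ideal of functions vanishing on the prolonged equation which is stable under the
total derivatives. -/
noncomputable def flatIdeal (hΩ : IsOpen Ω) : Ideal (JetFun Ω) where
  carrier := {f | ∀ (l : List (BaseIx n m)) (θ : Efc Ω),
    (l.foldr (fun a => jetD hΩ a) f).1 (efcPoint θ) = 0}
  zero_mem' := fun l θ => by rw [foldr_derivation_zero]; rfl
  add_mem' := fun {f g} hf hg l θ => by
    rw [foldr_derivation_add]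
    exact (congrArg₂ (· + ·) (hf l θ) (hg l θ)).trans (add_zero 0)
  smul_mem' := fun g f hf l => by
    induction l using List.reverseRecOn generalizing g f with
    | nil => exact fun θ => (congrArg (g.1 (efcPoint θ) * ·) (hf [] θ)).trans (mul_zero _)
    | append_singleton l a ih =>
      intro θ
      have hf' : ∀ (l : List (BaseIx n m)) (θ : Efc Ω),
          (l.foldr (fun a => jetD hΩ a) (jetD hΩ a f)).1 (efcPoint θ) = 0 := fun l θ => by
        have := hf (l ++ [a]) θ
        rwa [List.foldr_append] at this
      rw [List.foldr_append, List.foldr_cons, List.foldr_nil, smul_eq_mul, Derivation.leibniz,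
        smul_eq_mul, smul_eq_mul, mul_comm f, foldr_derivation_add]
      exact (congrArg₂ (· + ·) (ih g _ hf' θ) (ih _ f hf θ)).trans (add_zero 0)

theorem apply_eq_zero_of_mem_flatIdeal (hΩ : IsOpen Ω) {f : JetFun Ω} (hf : f ∈ flatIdeal hΩ)
    (θ : Efc Ω) : f.1 (efcPoint θ) = 0 := hf [] θ

theorem jetD_mem_flatIdeal (hΩ : IsOpen Ω) (a : BaseIx n m) {f : JetFun Ω}
    (hf : f ∈ flatIdeal hΩ) : jetD hΩ a f ∈ flatIdeal hΩ := fun l θ => by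
  have := hf (l ++ [a]) θ
  rwa [List.foldr_append] at this

theorem flatFun_mem_flatIdeal (hΩ : IsOpen Ω) (i j : Fin n) (α : Fin m) :
    flatFun hΩ i j α ∈ flatIdeal hΩ := fun l θ => (mem_Efc_iff hΩ (efcPoint θ)).1 θ.2 l i j α

/-- The quotient of the functions on the infinite jets by the differential ideal of the
equation. -/
abbrev FlatQuot (hΩ : IsOpen Ω) : Type := JetFun Ω ⧸ flatIdeal hΩ

/-- The projection to the quotient by the differential ideal of the equation. -/
noncomputable def flatMk (hΩ : IsOpen Ω) : JetFun Ω →ₐ[ℝ] FlatQuot hΩ :=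
  Ideal.Quotient.mkₐ ℝ (flatIdeal hΩ)

theorem flatMk_surjective (hΩ : IsOpen Ω) : Function.Surjective (flatMk hΩ) :=
  Ideal.Quotient.mkₐ_surjective ℝ _

theorem flatMk_eq_zero_iff (hΩ : IsOpen Ω) (f : JetFun Ω) :
    flatMk hΩ f = 0 ↔ f ∈ flatIdeal hΩ := Ideal.Quotient.eq_zero_iff_mem

/-- The total derivatives on the quotient by the differential ideal of the equation. -/
noncomputable def flatD (hΩ : IsOpen Ω) (a : BaseIx n m) :
    Derivation ℝ (FlatQuot hΩ) (FlatQuot hΩ) :=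
  Derivation.liftOfSurjective (f := flatMk hΩ) (flatMk_surjective hΩ) (d := jetD hΩ a)
    fun f hf => (flatMk_eq_zero_iff hΩ _).2 (jetD_mem_flatIdeal hΩ a ((flatMk_eq_zero_iff hΩ f).1 hf))

theorem flatD_flatMk (hΩ : IsOpen Ω) (a : BaseIx n m) (f : JetFun Ω) :
    flatD hΩ a (flatMk hΩ f) = flatMk hΩ (jetD hΩ a f) :=
  Derivation.liftOfSurjective_apply _ _ f

theorem flatD_comm (hΩ : IsOpen Ω) (a b : BaseIx n m) (f : FlatQuot hΩ) :
    flatD hΩ a (flatD hΩ b f) = flatD hΩ b (flatD hΩ a f) := by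
  obtain ⟨f, rfl⟩ := flatMk_surjective hΩ f
  simp only [flatD_flatMk]
  rw [jetD_comm]

/-- Homomorphisms which respect the derivations and the connection respect the horizontal lifts. -/
theorem map_horLift {B C : Type} [CommRing B] [Algebra ℝ B] [CommRing C] [Algebra ℝ C]
    (φ : B →ₐ[ℝ] C) {D : BaseIx n m → Derivation ℝ B B} {D' : BaseIx n m → Derivation ℝ C C}
    (hD : ∀ a f, D' a (φ f) = φ (D a f)) {p : Fin n → Fin m → B} {p' : Fin n → Fin m → C}
    (hp : ∀ i α, p' i α = φ (p i α)) (i : Fin n) (f : B) :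
    horLift D' p' i (φ f) = φ (horLift D p i f) := by
  rw [horLift_apply, horLift_apply, map_add, map_sum, hD]
  simp_rw [hD, hp, map_mul]

end Jets

/-! ### The equation is isomorphic to its model -/

section Equivalence

variable {n m : ℕ} {Ω : Set (BaseIx n m → ℝ)}

/-- The iterated total derivatives of the connection coefficients on the model. -/
theorem exists_leafJet (hΩ : IsOpen Ω) : ∃ g : JetIx n m → LeafFun Ω,
    (∀ i α, IsJetFamily (B := LeafFun Ω) (leafD hΩ) fun σ => g (i, α, σ)) ∧
      ∀ i α, g (i, α, 0) = leafConn i α := by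
  choose g hg hg0 using fun (i : Fin n) (α : Fin m) =>
    exists_isJetFamily (B := LeafFun Ω) (leafD_comm hΩ) (leafConn i α)
  exact ⟨fun k => g k.1 k.2.1 k.2.2, hg, hg0⟩

section Pullback

variable (hΩ : IsOpen Ω) {g : JetIx n m → LeafFun Ω}

theorem leafD_subst (hg : ∀ i α, IsJetFamily (B := LeafFun Ω) (leafD hΩ) fun σ => g (i, α, σ))
    (a : BaseIx n m) (f : JetFun Ω) :
    leafD hΩ a (subst g f) = subst g (jetD hΩ a f) := by
  obtain ⟨s, h⟩ := exists_finset_subst hΩ g (jetD hΩ a) (leafD hΩ a) (fun h hh => by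
    classical
    rw [leafD_base, jetD_base, baseDeriv_base, baseDeriv_base, subst_base]) f
  refine sub_eq_zero.1 (h.trans (Finset.sum_eq_zero fun k _ => ?_))
  have hk : leafD hΩ a (g k) = subst g (jetD hΩ a (CylFun.coord k)) := by
    rw [jetD_coord, subst_coord]
    exact hg k.1 k.2.1 a k.2.2
  rw [hk, sub_self, zero_mul]

theorem subst_flatFun (hg : ∀ i α, IsJetFamily (B := LeafFun Ω) (leafD hΩ) fun σ => g (i, α, σ))
    (hg0 : ∀ i α, g (i, α, 0) = leafConn i α) (i j : Fin n) (α : Fin m) :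
    subst g (flatFun hΩ i j α) = 0 := by
  have h : ∀ i f, leafLift hΩ i (subst g f) = subst g (jetLift hΩ i f) :=
    map_horLift (B := JetFun Ω) (C := LeafFun Ω) (subst g) (leafD_subst hΩ hg) fun i α => (hg0 i α).symm
  have h1 : ∀ i α, subst g (jetConn i α : JetFun Ω) = leafConn i α := hg0
  rw [flatFun, map_sub, ← h, ← h, h1, h1, leafLift_leafConn, sub_self]

/-- Points of the model give points of the equation. -/
theorem leafPoint_mem_Efc (hg : ∀ i α, IsJetFamily (B := LeafFun Ω) (leafD hΩ) fun σ => g (i, α, σ))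
    (hg0 : ∀ i α, g (i, α, 0) = leafConn i α) (q : Ω × (LeafIx n m → ℝ)) :
    ((q.1 : BaseIx n m → ℝ), fun k => (g k).1 q) ∈ Efc Ω := by
  refine (mem_Efc_iff hΩ (q.1, fun k => (g k).1 q)).2 fun l i j α => ?_
  have h : ∀ l : List (BaseIx n m), subst g (l.foldr (fun a => jetD hΩ a) (flatFun hΩ i j α)) = 0 :=
    fun l => by
      induction l with
      | nil => exact subst_flatFun hΩ hg hg0 i j α
      | cons a l ih =>
        rw [List.foldr_cons, ← leafD_subst hΩ hg, ih, map_zero]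
  exact congrArg (fun f : LeafFun Ω => f.1 q) (h l)

theorem subst_eq_zero (hg : ∀ i α, IsJetFamily (B := LeafFun Ω) (leafD hΩ) fun σ => g (i, α, σ))
    (hg0 : ∀ i α, g (i, α, 0) = leafConn i α) {f : JetFun Ω}
    (hf : ∀ θ : Efc Ω, f.1 (efcPoint θ) = 0) : subst g f = 0 :=
  ext_apply fun q => hf ⟨_, leafPoint_mem_Efc hΩ hg hg0 q⟩

end Pullback

theorem horLift_flatMk_jetConn (hΩ : IsOpen Ω) (i j : Fin n) (α : Fin m) :
    horLift (B := FlatQuot hΩ) (flatD hΩ) (fun i α => flatMk hΩ (jetConn i α)) i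
        (flatMk hΩ (jetConn j α)) =
      horLift (B := FlatQuot hΩ) (flatD hΩ) (fun i α => flatMk hΩ (jetConn i α)) j
        (flatMk hΩ (jetConn i α)) := by
  have h := map_horLift (B := JetFun Ω) (C := FlatQuot hΩ) (flatMk hΩ) (flatD_flatMk hΩ)
    (p := jetConn) (p' := fun i α => flatMk hΩ (jetConn i α)) (fun _ _ => rfl)
  rw [h, h, ← sub_eq_zero, ← map_sub]
  exact (flatMk_eq_zero_iff hΩ _).2 (flatFun_mem_flatIdeal hΩ i j α)

variable (Ω) in
/-- The coordinate `v^α`, as a cylinder function. -/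
def fibreVar (I : Type) (α : Fin m) : CylFun Ω I :=
  base (fun x => x (.inr α)) (contDiff_apply ℝ ℝ _).contDiffOn

/-- The Taylor coefficients of the leaves, in the quotient by the differential ideal. -/
theorem exists_flatTaylor (hΩ : IsOpen Ω) :
    ∃ w : (Fin n →₀ ℕ) → Fin m → (Fin m →₀ ℕ) → FlatQuot hΩ,
      (∀ κ α, IsTaylor (B := FlatQuot hΩ) (fun β => flatD hΩ (.inr β)) (w κ α)) ∧
      (∀ i κ α, horLift (B := FlatQuot hΩ) (flatD hΩ) (fun i α => flatMk hΩ (jetConn i α)) i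
        (w κ α 0) = w (κ + Finsupp.single i 1) α 0) ∧
      ∀ i α, w (Finsupp.single i 1) α 0 = flatMk hΩ (jetConn i α) := by
  classical
  have h : ∀ a α, flatD hΩ a (flatMk hΩ (fibreVar Ω (JetIx n m) α)) =
      flatMk hΩ (if a = .inr α then 1 else 0) := by
    intro a α
    rw [flatD_flatMk, fibreVar, jetD_base, baseDeriv_base]
    congr 1
    refine ext_apply fun p => ?_
    have h1 : fderiv ℝ (fun x : BaseIx n m → ℝ => x (.inr α)) p.1 =
        ContinuousLinearMap.proj (.inr α) :=
      (ContinuousLinearMap.proj (R := ℝ) (φ := fun _ : BaseIx n m => ℝ) (.inr α)).fderiv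
    change fderiv ℝ (fun x : BaseIx n m → ℝ => x (.inr α)) p.1 _ = _
    rw [h1]
    change (Pi.single a (1 : ℝ) : BaseIx n m → ℝ) (.inr α) = _
    rcases eq_or_ne a (.inr α) with rfl | ha
    · rw [Pi.single_eq_same, if_pos rfl]
      rfl
    · rw [Pi.single_eq_of_ne ha.symm, if_neg ha]
      rfl
  refine exists_taylor_of_flat (B := FlatQuot hΩ) (flatD_comm hΩ) (horLift_flatMk_jetConn hΩ)
    (v := fun α => flatMk hΩ (fibreVar Ω (JetIx n m) α)) (fun i α => ?_) fun β α => ?_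
  · rw [h, if_neg (by simp), map_zero]
  · rw [h]
    by_cases hβ : β = α
    · rw [if_pos (by rw [hβ]), if_pos hβ, map_one]
    · rw [if_neg (by simpa using hβ), if_neg hβ, map_zero]

section Quotient

variable (hΩ : IsOpen Ω) {B : Type} [CommRing B] [Algebra ℝ B]
  {D : BaseIx n m → Derivation ℝ B B} {p : Fin n → Fin m → B}
  {w : (Fin n →₀ ℕ) → Fin m → (Fin m →₀ ℕ) → B}

/-- A homomorphism to the model which respects the total derivatives and the connection respects
the Taylor coefficients of the leaves. -/
theorem map_taylor_eq_leafCoord (hw : ∀ κ α, IsTaylor (fun β => D (.inr β)) (w κ α))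
    (hwL : ∀ i κ α, horLift D p i (w κ α 0) = w (κ + Finsupp.single i 1) α 0)
    (hw1 : ∀ i α, w (Finsupp.single i 1) α 0 = p i α) (G : B →ₐ[ℝ] LeafFun Ω)
    (hGD : ∀ a f, leafD hΩ a (G f) = G (D a f)) (hGp : ∀ i α, leafConn i α = G (p i α))
    {κ : Fin n →₀ ℕ} (hκ : κ ≠ 0) (α : Fin m) (τ : Fin m →₀ ℕ) :
    G (w κ α τ) = leafCoord κ α τ := by
  have hGL : ∀ i f, leafLift hΩ i (G f) = G (horLift D p i f) := map_horLift G hGD hGp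
  have key0 : ∀ κ : Fin n →₀ ℕ, κ ≠ 0 → ∀ α, G (w κ α 0) = leafCoord κ α 0 := by
    intro κ
    induction κ using multiIx_induction with
    | h0 => exact fun h => absurd rfl h
    | hadd κ i ih =>
      intro _ α
      by_cases hκ : κ = 0
      · rw [hκ, zero_add, hw1, ← hGp, leafConn]
      · rw [← hwL, ← hGL, ih hκ, leafLift_leafCoord hΩ i hκ]
  exact IsTaylor.ext (B := LeafFun Ω)
    ((hw κ α).map (D' := fun β => leafD hΩ (.inr β)) (G : B →ₗ[ℝ] LeafFun Ω) fun b f => hGD _ f)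
    (isTaylor_leafCoord hΩ κ α) (key0 κ hκ α) τ

/-- A substitution for the coordinates of the model which, modulo the kernel of `π`, gives the
Taylor coefficients of the leaves respects, modulo this kernel, the total derivatives. -/
theorem map_subst_leafD (hD : ∀ a b f, D a (D b f) = D b (D a f))
    (hw : ∀ κ α, IsTaylor (fun β => D (.inr β)) (w κ α))
    (hwL : ∀ i κ α, horLift D p i (w κ α 0) = w (κ + Finsupp.single i 1) α 0)
    (hw1 : ∀ i α, w (Finsupp.single i 1) α 0 = p i α) (π : JetFun Ω →ₐ[ℝ] B)
    (hπ : ∀ a f, D a (π f) = π (jetD hΩ a f)) {r : LeafIx n m → JetFun Ω}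
    (hr : ∀ k, π (r k) = w k.1 k.2.1 k.2.2) (a : BaseIx n m) (f : LeafFun Ω) :
    D a (π (subst r f)) = π (subst r (leafD hΩ a f)) := by
  have hR : ∀ (κ : Fin n →₀ ℕ), κ ≠ 0 → ∀ α τ, π (subst r (leafCoord κ α τ)) = w κ α τ := by
    intro κ hκ α τ
    rw [leafCoord_of_ne hκ]
    exact hr _
  have hcoord : ∀ k : LeafIx n m, D a (π (r k)) = π (subst r (leafD hΩ a (CylFun.coord k))) := by
    rintro ⟨⟨κ, hκ⟩, α, τ⟩
    rw [← leafCoord_of_ne hκ, hr]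
    rcases a with i | β
    · rw [leafD_inl_leafCoord hΩ i hκ α τ, leafDx, map_sub, map_sub, map_sum, map_sum,
        hR _ (add_single_ne_zero _ _), horLift_taylor hD hw hw1 i κ α (hwL i κ α)]
      congr 1
      refine Finset.sum_congr rfl fun γ _ => ?_
      rw [map_sum, map_sum]
      refine Finset.sum_congr rfl fun x _ => ?_
      rw [map_mul, map_mul, map_smul, map_smul, hR _ hκ, hR _ (single_one_ne_zero i)]
    · rw [isTaylor_leafCoord hΩ κ α β τ, map_smul, map_smul, hR _ hκ]
      exact hw κ α β τ
  obtain ⟨s, h⟩ := exists_finset_subst hΩ r (leafD hΩ a) (jetD hΩ a) (fun h hh => by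
    classical
    rw [leafD_base, jetD_base, baseDeriv_base, baseDeriv_base, subst_base]) f
  have h' := congrArg π h
  rw [map_sub, map_sum, ← hπ] at h'
  refine sub_eq_zero.1 (h'.trans (Finset.sum_eq_zero fun k _ => ?_))
  rw [map_mul, map_sub, ← hπ, hcoord, sub_self, zero_mul]

end Quotient

/-- Substitutions `g` and `r` between the jet coordinates and the coordinates of the model which are
mutually inverse, modulo the differential ideal of the equation, and which respect the total
derivatives. -/
theorem exists_substitutions (hΩ : IsOpen Ω) :
    ∃ (g : JetIx n m → LeafFun Ω) (r : LeafIx n m → JetFun Ω),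
      (∀ i α, IsJetFamily (B := LeafFun Ω) (leafD hΩ) fun σ => g (i, α, σ)) ∧
      (∀ i α, g (i, α, 0) = leafConn i α) ∧
      (∀ k, subst g (r k) = CylFun.coord k) ∧
      ∀ k, subst r (g k) - CylFun.coord k ∈ flatIdeal hΩ := by
  obtain ⟨g, hg, hg0⟩ := exists_leafJet hΩ
  obtain ⟨w, hw, hwL, hw1⟩ := exists_flatTaylor hΩ
  choose r hr using fun k : LeafIx n m => flatMk_surjective hΩ (w k.1 k.2.1 k.2.2)
  refine ⟨g, r, hg, hg0, fun k => ?_, fun k => ?_⟩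
  · -- the substitution of `g` descends to the quotient, where it sends `w` to the coordinates
    have hker : ∀ f ∈ flatIdeal hΩ, subst g f = 0 := fun f hf =>
      subst_eq_zero hΩ hg hg0 fun θ => apply_eq_zero_of_mem_flatIdeal hΩ hf θ
    have h1 := map_taylor_eq_leafCoord hΩ hw hwL hw1
      (Ideal.Quotient.liftₐ (flatIdeal hΩ) (subst g) hker) (fun a f => by
        obtain ⟨f, rfl⟩ := flatMk_surjective hΩ f
        rw [flatD_flatMk]
        exact leafD_subst hΩ hg a f) (fun i α => (hg0 i α).symm) k.1.2 k.2.1 k.2.2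
    rw [leafCoord_of_ne k.1.2, ← hr] at h1
    exact h1
  · have hRD := map_subst_leafD hΩ (flatD_comm hΩ) hw hwL hw1 (flatMk hΩ) (flatD_flatMk hΩ) hr
    have h0 : flatMk hΩ (subst r (g (k.1, k.2.1, 0))) = flatMk hΩ (jetConn k.1 k.2.1) := by
      rw [hg0, leafConn, leafCoord_of_ne (single_one_ne_zero _), subst_coord, hr, hw1]
    have h1 : IsJetFamily (B := FlatQuot hΩ) (flatD hΩ)
        fun σ => flatMk hΩ (subst r (g (k.1, k.2.1, σ))) := fun b σ =>
      (hRD b _).trans (congrArg (fun f => flatMk hΩ (subst r f)) (hg k.1 k.2.1 b σ))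
    have h2 := IsJetFamily.ext (B := FlatQuot hΩ) h1
      (a' := fun σ => flatMk hΩ (CylFun.coord (k.1, k.2.1, σ)))
      (fun b σ => by rw [flatD_flatMk, jetD_coord]) h0 k.2.2
    rw [← flatMk_eq_zero_iff, map_sub]
    exact sub_eq_zero.2 h2

/-- The restriction of functions on the infinite jets to the equation. -/
noncomputable def restrictHom : JetFun Ω →ₐ[ℝ] SmoothE Ω where
  toFun f := ⟨fun θ => f.1 (efcPoint θ), extendZero f, isSmooth_extendZero f,
    fun θ => (extendZero_apply f (efcPoint θ)).symm⟩
  map_one' := rfl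
  map_mul' _ _ := rfl
  map_zero' := rfl
  map_add' _ _ := rfl
  commutes' _ := rfl

theorem restrict_eq_restrictHom (F : Jet n m → ℝ) (hF : IsSmooth Ω F) :
    restrict F hF = restrictHom (toJetFun F hF) := rfl

theorem restrictHom_surjective : Function.Surjective (restrictHom (Ω := Ω)) := by
  rintro ⟨f, F, hF, e⟩
  refine ⟨toJetFun F hF, Subtype.ext (funext fun θ => (e θ).symm)⟩

theorem restrict_totalDeriv (hΩ : IsOpen Ω) (a : BaseIx n m) (F : Jet n m → ℝ)
    (hF : IsSmooth Ω F) : restrict (totalDeriv a F) (hF.totalDeriv hΩ a) =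
      restrictHom (jetD hΩ a (toJetFun F hF)) :=
  Subtype.ext (funext fun θ => totalDeriv_eq_jetD hΩ a (fun _ => rfl) (efcPoint θ))

/-- The algebra of functions on the equation is isomorphic to that of its model, and the total
derivatives correspond to each other. -/
theorem exists_equiv (hΩ : IsOpen Ω) : ∃ e : SmoothE Ω ≃ₐ[ℝ] LeafFun Ω,
    (∀ h hh, e (restrict (fun θ => h θ.1) (isSmooth_base hh)) = base h hh) ∧
    (∀ i α, e (coord i α) = leafConn i α) ∧
    ∀ a F hF, e (restrict (totalDeriv a F) (hF.totalDeriv hΩ a)) =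
      leafD hΩ a (e (restrict F hF)) := by
  obtain ⟨g, r, hg, hg0, hgr, hrg⟩ := exists_substitutions hΩ
  have h1 : ∀ f : LeafFun Ω, subst g (subst r f) = f := fun f => ext_apply fun q => by
    rw [subst_apply, subst_apply]
    exact congrArg (fun u => f.1 (q.1, u)) (funext fun k =>
      congrArg (fun f : LeafFun Ω => f.1 q) (hgr k))
  have h2 : ∀ f : JetFun Ω, restrictHom (subst r (subst g f)) = restrictHom f :=
    fun f => Subtype.ext (funext fun θ => by
      change (subst r (subst g f)).1 (efcPoint θ) = f.1 (efcPoint θ)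
      rw [subst_apply, subst_apply]
      exact congrArg (fun u => f.1 ((efcPoint θ).1, u)) (funext fun k =>
        sub_eq_zero.1 (apply_eq_zero_of_mem_flatIdeal hΩ (hrg k) θ)))
  have h3 : ∀ f : JetFun Ω, restrictHom f = 0 → subst g f = 0 := fun f hf =>
    subst_eq_zero hΩ hg hg0 fun θ => congrFun (congrArg Subtype.val hf) θ
  let ρ : LeafFun Ω →ₐ[ℝ] SmoothE Ω := restrictHom.comp (subst r)
  have hρ : Function.Bijective ρ := by
    constructor
    · refine (injective_iff_map_eq_zero ρ).2 fun f hf => ?_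
      rw [← h1 f]
      exact h3 _ hf
    · intro f
      obtain ⟨f, rfl⟩ := restrictHom_surjective f
      exact ⟨subst g f, h2 f⟩
  have he : ∀ f, (AlgEquiv.ofBijective ρ hρ).symm (restrictHom f) = subst g f := fun f => by
    rw [AlgEquiv.symm_apply_eq]
    exact (h2 f).symm
  refine ⟨(AlgEquiv.ofBijective ρ hρ).symm, fun h hh => ?_, fun i α => ?_, fun a F hF => ?_⟩
  · rw [restrict_eq_restrictHom, he]
    rfl
  · exact (he (jetConn i α)).trans (hg0 i α)
  · rw [restrict_totalDeriv, restrict_eq_restrictHom, he, he, leafD_subst hΩ hg]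

end Equivalence

/-! ### Partial derivatives and horizontal lifts on the model -/

section Partial

variable {n m : ℕ} {Ω : Set (BaseIx n m → ℝ)} (hΩ : IsOpen Ω)

/-- The partial derivative with respect to the coordinate `w_{κ,τ}^α` of the model, where
`t = (α, τ)`. By convention it vanishes for `κ = 0`. -/
noncomputable def leafPd (κ : Fin n →₀ ℕ) (t : Fin m × (Fin m →₀ ℕ)) :
    Derivation ℝ (LeafFun Ω) (LeafFun Ω) :=
  if h : κ ≠ 0 then fibreDeriv hΩ (⟨κ, h⟩, t) else 0

theorem leafPd_of_ne {κ : Fin n →₀ ℕ} (h : κ ≠ 0) (t : Fin m × (Fin m →₀ ℕ)) :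
    leafPd hΩ κ t = fibreDeriv hΩ (⟨κ, h⟩, t) := dif_pos h

theorem leafPd_zero (t : Fin m × (Fin m →₀ ℕ)) (f : LeafFun Ω) : leafPd hΩ 0 t f = 0 := by
  rw [leafPd, dif_neg (fun h => h rfl)]
  rfl

theorem leafPd_comm (κ κ' : Fin n →₀ ℕ) (t t' : Fin m × (Fin m →₀ ℕ)) (f : LeafFun Ω) :
    leafPd hΩ κ t (leafPd hΩ κ' t' f) = leafPd hΩ κ' t' (leafPd hΩ κ t f) := by
  by_cases h : κ = 0
  · subst h
    rw [leafPd_zero, leafPd_zero, map_zero]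
  · by_cases h' : κ' = 0
    · subst h'
      rw [leafPd_zero, leafPd_zero, map_zero]
    · rw [leafPd_of_ne hΩ h, leafPd_of_ne hΩ h', fibreDeriv_comm]

theorem leafPd_leafCoord_of_ne {κ κ' : Fin n →₀ ℕ} (h : κ' ≠ κ) (t t' : Fin m × (Fin m →₀ ℕ)) :
    leafPd hΩ κ t (leafCoord κ' t'.1 t'.2) = 0 := by
  classical
  by_cases h1 : κ = 0
  · rw [h1, leafPd_zero]
  · by_cases h2 : κ' = 0
    · rw [leafCoord, dif_neg (fun h => h h2), map_zero]
    · rw [leafPd_of_ne hΩ h1, leafCoord_of_ne h2, fibreDeriv_coord, if_neg]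
      simp [h]

theorem leafPd_leafCoord_self {κ : Fin n →₀ ℕ} (h : κ ≠ 0) (t t' : Fin m × (Fin m →₀ ℕ)) :
    leafPd hΩ κ t (leafCoord κ t'.1 t'.2) = if t' = t then 1 else 0 := by
  classical
  rw [leafPd_of_ne hΩ h, leafCoord_of_ne h, fibreDeriv_coord]
  by_cases h' : t' = t
  · rw [if_pos (by rw [← h']), if_pos h']
  · rw [if_neg (fun h => h' (Prod.ext_iff.1 h).2), if_neg h']

/-- The partial derivatives of the coordinates are constant. -/
theorem derivation_leafPd_leafCoord (Z : Derivation ℝ (LeafFun Ω) (LeafFun Ω))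
    (κ κ' : Fin n →₀ ℕ) (t t' : Fin m × (Fin m →₀ ℕ)) :
    Z (leafPd hΩ κ t (leafCoord κ' t'.1 t'.2)) = 0 := by
  classical
  by_cases h : κ' = κ
  · by_cases h0 : κ = 0
    · rw [h0, leafPd_zero, map_zero]
    · rw [h, leafPd_leafCoord_self hΩ h0, derivation_ite_one_zero]
  · rw [leafPd_leafCoord_of_ne hΩ h, map_zero]

theorem leafPd_base (κ : Fin n →₀ ℕ) (t : Fin m × (Fin m →₀ ℕ)) (h : (BaseIx n m → ℝ) → ℝ)
    (hh : ContDiffOn ℝ ∞ h Ω) : leafPd hΩ κ t (base h hh) = 0 := by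
  by_cases h0 : κ = 0
  · rw [h0, leafPd_zero]
  · rw [leafPd_of_ne hΩ h0, fibreDeriv_base]

theorem leafPd_leafD_base (κ : Fin n →₀ ℕ) (t : Fin m × (Fin m →₀ ℕ)) (a : BaseIx n m)
    (h : (BaseIx n m → ℝ) → ℝ) (hh : ContDiffOn ℝ ∞ h Ω) :
    leafPd hΩ κ t (leafD hΩ a (base h hh)) = 0 := by
  classical
  rw [leafD_base, baseDeriv_base, leafPd_base]

/-- The chain rule on the model. -/
theorem exists_leaf_chain (f : LeafFun Ω) :
    ∃ s : Finset (LeafIx n m), (∀ k ∉ s, leafPd hΩ k.1 k.2 f = 0) ∧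
      ∀ Z : Derivation ℝ (LeafFun Ω) (LeafFun Ω), (∀ h hh, Z (base h hh) = 0) →
        Z f = ∑ k ∈ s, Z (leafCoord k.1 k.2.1 k.2.2) * leafPd hΩ k.1 k.2 f := by
  obtain ⟨s, hs, h⟩ := exists_finset_derivation hΩ f
  refine ⟨s, fun k hk => ?_, fun Z hZ => (h Z hZ).trans (Finset.sum_congr rfl fun k _ => ?_)⟩
  · rw [leafPd_of_ne hΩ k.1.2]
    exact hs k hk
  · rw [leafPd_of_ne hΩ k.1.2, leafCoord_of_ne k.1.2]

/-- A function depends on coordinates with finitely many labels. -/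
theorem exists_finset_level (f : LeafFun Ω) :
    ∃ s : Finset (Fin n →₀ ℕ), ∀ κ ∉ s, ∀ t, leafPd hΩ κ t f = 0 := by
  classical
  obtain ⟨s, hs, -⟩ := exists_leaf_chain hΩ f
  refine ⟨s.image fun k => k.1.1, fun κ hκ t => ?_⟩
  by_cases h0 : κ = 0
  · rw [h0, leafPd_zero]
  · exact hs (⟨κ, h0⟩, t) fun h => hκ (Finset.mem_image.2 ⟨_, h, rfl⟩)

/-- The total derivative of a function on `Ω` is a function on `Ω`. -/
theorem leafPd_leafD_eq_zero {f : LeafFun Ω} (hf : ∀ κ t, leafPd hΩ κ t f = 0) (a : BaseIx n m)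
    (κ : Fin n →₀ ℕ) (t : Fin m × (Fin m →₀ ℕ)) : leafPd hΩ κ t (leafD hΩ a f) = 0 := by
  obtain ⟨s, -, h⟩ := exists_leaf_chain hΩ f
  have h1 := h ⁅leafPd hΩ κ t, leafD hΩ a⁆ fun h hh => by
    rw [Derivation.commutator_apply, leafPd_leafD_base, leafPd_base, map_zero, sub_zero]
  simp_rw [hf, mul_zero, Finset.sum_const_zero] at h1
  rw [Derivation.commutator_apply, hf, map_zero, sub_zero] at h1
  exact h1

theorem leafLift_apply (i : Fin n) (f : LeafFun Ω) : leafLift hΩ i f =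
    leafD hΩ (.inl i) f + ∑ β, leafConn i β * leafD hΩ (.inr β) f := horLift_apply _ _ _ _

theorem leafPd_leafConn_mul {κ : Fin n →₀ ℕ} {i : Fin n} (h : κ ≠ Finsupp.single i 1)
    (t t' : Fin m × (Fin m →₀ ℕ)) (f : LeafFun Ω) :
    leafPd hΩ κ t (leafCoord (Finsupp.single i 1) t'.1 t'.2 * f) =
      leafCoord (Finsupp.single i 1) t'.1 t'.2 * leafPd hΩ κ t f := by
  rw [Derivation.leibniz, leafPd_leafCoord_of_ne hΩ h.symm, smul_zero, add_zero, smul_eq_mul]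

theorem leafPd_leafLift_base {κ : Fin n →₀ ℕ} {i : Fin n} (hκ : κ ≠ Finsupp.single i 1)
    (t : Fin m × (Fin m →₀ ℕ)) (h : (BaseIx n m → ℝ) → ℝ) (hh : ContDiffOn ℝ ∞ h Ω) :
    leafPd hΩ κ t (leafLift hΩ i (base h hh)) = 0 := by
  rw [leafLift_apply, map_add, map_sum, leafPd_leafD_base, zero_add]
  refine Finset.sum_eq_zero fun β _ => ?_
  rw [leafConn, leafPd_leafConn_mul hΩ hκ t (β, 0), leafPd_leafD_base, mul_zero]

/-- On functions on `Ω`, the horizontal lift `D_i` is affine in the connection coefficients. -/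
theorem leafPd_single_leafLift {f : LeafFun Ω} (hf : ∀ κ t, leafPd hΩ κ t f = 0) (i : Fin n)
    (t : Fin m × (Fin m →₀ ℕ)) : leafPd hΩ (Finsupp.single i 1) t (leafLift hΩ i f) =
      if t.2 = 0 then leafD hΩ (.inr t.1) f else 0 := by
  rw [leafLift_apply, map_add, map_sum, leafPd_leafD_eq_zero hΩ hf, zero_add]
  have : ∀ β, leafPd hΩ (Finsupp.single i 1) t (leafConn i β * leafD hΩ (.inr β) f) =
      if (β, 0) = t then leafD hΩ (.inr β) f else 0 := fun β => by
    rw [Derivation.leibniz, leafPd_leafD_eq_zero hΩ hf, smul_zero, zero_add, smul_eq_mul, leafConn,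
      leafPd_leafCoord_self hΩ (single_one_ne_zero i) t (β, 0), mul_ite, mul_one, mul_zero]
  simp_rw [this]
  by_cases h : t.2 = 0
  · rw [if_pos h, Finset.sum_eq_single t.1]
    · have ht : (t.1, (0 : Fin m →₀ ℕ)) = t := Prod.ext rfl h.symm
      exact if_pos ht
    · exact fun β _ hβ => if_neg fun h => hβ (congrArg Prod.fst h)
    · exact fun h => absurd (Finset.mem_univ _) h
  · rw [if_neg h]
    exact Finset.sum_eq_zero fun β _ => if_neg fun h' => h (congrArg Prod.snd h').symm

theorem leafPd_leafLift_eq_zero {f : LeafFun Ω} (hf : ∀ κ t, leafPd hΩ κ t f = 0) (i : Fin n)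
    {κ : Fin n →₀ ℕ} (hκ : κ ≠ Finsupp.single i 1) (t : Fin m × (Fin m →₀ ℕ)) :
    leafPd hΩ κ t (leafLift hΩ i f) = 0 := by
  rw [leafLift_apply, map_add, map_sum, leafPd_leafD_eq_zero hΩ hf, zero_add]
  refine Finset.sum_eq_zero fun β _ => ?_
  rw [leafConn, leafPd_leafConn_mul hΩ hκ t (β, 0), leafPd_leafD_eq_zero hΩ hf, mul_zero]

theorem leafLift_leafCoord_eq (i : Fin n) {κ : Fin n →₀ ℕ} (h : κ ≠ 0) (α : Fin m)
    (τ : Fin m →₀ ℕ) : leafLift hΩ i (leafCoord κ α τ) =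
      leafCoord (κ + Finsupp.single i 1) α τ -
        ∑ γ, ∑ x ∈ antidiagonal τ, leafCoord (Finsupp.single i 1) γ x.1 *
          (((x.2 γ : ℝ) + 1) • leafCoord κ α (x.2 + Finsupp.single γ 1)) +
        ∑ γ, leafCoord (Finsupp.single i 1) γ 0 *
          (((τ γ : ℝ) + 1) • leafCoord κ α (τ + Finsupp.single γ 1)) := by
  rw [leafLift_apply, leafD_inl_leafCoord hΩ i h, leafDx]
  congr 1
  exact Finset.sum_congr rfl fun γ _ => by rw [isTaylor_leafCoord, leafConn]

/-- The partial derivatives of `D_i w` along coordinates other than the `w_{e_i,ρ}`. -/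
theorem leafPd_leafLift_leafCoord (i : Fin n) {κ κ' : Fin n →₀ ℕ} (hκ' : κ' ≠ 0)
    (hκ : κ ≠ Finsupp.single i 1) (t : Fin m × (Fin m →₀ ℕ)) (α : Fin m) (τ : Fin m →₀ ℕ) :
    leafPd hΩ κ t (leafLift hΩ i (leafCoord κ' α τ)) =
      leafPd hΩ κ t (leafCoord (κ' + Finsupp.single i 1) α τ) -
        ∑ γ, ∑ x ∈ antidiagonal τ, leafCoord (Finsupp.single i 1) γ x.1 *
          (((x.2 γ : ℝ) + 1) • leafPd hΩ κ t (leafCoord κ' α (x.2 + Finsupp.single γ 1))) +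
        ∑ γ, leafCoord (Finsupp.single i 1) γ 0 *
          (((τ γ : ℝ) + 1) • leafPd hΩ κ t (leafCoord κ' α (τ + Finsupp.single γ 1))) := by
  rw [leafLift_leafCoord_eq hΩ i hκ', map_add, map_sub, map_sum, map_sum]
  congr 1
  · congr 1
    refine Finset.sum_congr rfl fun γ _ => ?_
    rw [map_sum]
    refine Finset.sum_congr rfl fun x _ => ?_
    rw [leafPd_leafConn_mul hΩ hκ t (γ, x.1), Derivation.map_smul]
  · refine Finset.sum_congr rfl fun γ _ => ?_
    rw [leafPd_leafConn_mul hΩ hκ t (γ, 0), Derivation.map_smul]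

/-- A second partial derivative of `D_i w`, of which at least one is along a coordinate other than
the `w_{e_i,ρ}`. -/
theorem leafPd_leafPd_leafLift_leafCoord (i : Fin n) {κ κ' κ'' : Fin n →₀ ℕ} (hκ' : κ' ≠ 0)
    (hκ : κ ≠ Finsupp.single i 1) (t t'' : Fin m × (Fin m →₀ ℕ)) (α : Fin m) (τ : Fin m →₀ ℕ) :
    leafPd hΩ κ'' t'' (leafPd hΩ κ t (leafLift hΩ i (leafCoord κ' α τ))) =
      ∑ γ, leafPd hΩ κ'' t'' (leafCoord (Finsupp.single i 1) γ 0) *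
          (((τ γ : ℝ) + 1) • leafPd hΩ κ t (leafCoord κ' α (τ + Finsupp.single γ 1))) -
        ∑ γ, ∑ x ∈ antidiagonal τ, leafPd hΩ κ'' t'' (leafCoord (Finsupp.single i 1) γ x.1) *
          (((x.2 γ : ℝ) + 1) • leafPd hΩ κ t (leafCoord κ' α (x.2 + Finsupp.single γ 1))) := by
  have key : ∀ (c : ℝ) (f : LeafFun Ω) t', leafPd hΩ κ'' t''
      (f * c • leafPd hΩ κ t (leafCoord κ' α t')) =
        leafPd hΩ κ'' t'' f * c • leafPd hΩ κ t (leafCoord κ' α t') := fun c f t' => by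
    have h0 := derivation_leafPd_leafCoord hΩ (leafPd hΩ κ'' t'') κ κ' t (α, t')
    rw [Derivation.leibniz, (leafPd hΩ κ'' t'').map_smul, h0, smul_zero, smul_zero, zero_add,
      smul_eq_mul, mul_comm]
  have h0 := derivation_leafPd_leafCoord hΩ (leafPd hΩ κ'' t'') κ (κ' + Finsupp.single i 1) t (α, τ)
  rw [leafPd_leafLift_leafCoord hΩ i hκ' hκ, map_add, map_sub, h0, map_sum, map_sum, zero_sub,
    neg_add_eq_sub]
  congr 1
  · exact Finset.sum_congr rfl fun γ _ => key _ _ _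
  · refine Finset.sum_congr rfl fun γ _ => ?_
    rw [map_sum]
    exact Finset.sum_congr rfl fun x _ => key _ _ _

/-- The partial derivative with respect to `w_{κ-e_i,τ}^α`; it vanishes if `e_i ≤ κ` fails. -/
noncomputable def leafPdDown (i : Fin n) (κ : Fin n →₀ ℕ) (t : Fin m × (Fin m →₀ ℕ)) :
    Derivation ℝ (LeafFun Ω) (LeafFun Ω) :=
  if κ i = 0 then 0 else leafPd hΩ (κ - Finsupp.single i 1) t

theorem leafPdDown_of_eq_zero {i : Fin n} {κ : Fin n →₀ ℕ} (h : κ i = 0)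
    (t : Fin m × (Fin m →₀ ℕ)) (f : LeafFun Ω) : leafPdDown hΩ i κ t f = 0 := by
  rw [leafPdDown, if_pos h]
  rfl

theorem leafPdDown_add_single (i : Fin n) (κ : Fin n →₀ ℕ) (t : Fin m × (Fin m →₀ ℕ)) :
    leafPdDown hΩ i (κ + Finsupp.single i 1) t = leafPd hΩ κ t := by
  rw [leafPdDown, if_neg (by simp), add_tsub_cancel_right]

theorem exists_eq_add_single {i : Fin n} {κ : Fin n →₀ ℕ} (h : κ i ≠ 0) :
    ∃ μ, κ = μ + Finsupp.single i 1 :=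
  ⟨κ - Finsupp.single i 1, (tsub_add_cancel_of_le (by
    rw [Finsupp.single_le_iff]
    omega)).symm⟩

/-- The commutator of a partial derivative with a horizontal lift. -/
theorem exists_leafPd_leafLift (i : Fin n) {κ : Fin n →₀ ℕ} (hκ0 : κ ≠ 0)
    (hκ : κ ≠ Finsupp.single i 1) (t : Fin m × (Fin m →₀ ℕ)) (f : LeafFun Ω) :
    ∃ s : Finset (LeafIx n m), (∀ k ∉ s, leafPd hΩ k.1 k.2 f = 0) ∧
      leafPd hΩ κ t (leafLift hΩ i f) = leafLift hΩ i (leafPd hΩ κ t f) + leafPdDown hΩ i κ t f +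
        ∑ k ∈ s, if k.1.1 = κ then leafPd hΩ κ t (leafLift hΩ i (leafCoord κ k.2.1 k.2.2)) *
          leafPd hΩ κ k.2 f else 0 := by
  obtain ⟨s, hs, h⟩ := exists_leaf_chain hΩ f
  refine ⟨s, hs, ?_⟩
  have h1 := h ⁅leafPd hΩ κ t, leafLift hΩ i⁆ fun h hh => by
    rw [Derivation.commutator_apply, leafPd_leafLift_base hΩ hκ, leafPd_base, map_zero, sub_zero]
  have h2 : ∀ k : LeafIx n m, ⁅leafPd hΩ κ t, leafLift hΩ i⁆ (leafCoord k.1 k.2.1 k.2.2) *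
      leafPd hΩ k.1 k.2 f = (if k.1.1 + Finsupp.single i 1 = κ ∧ k.2 = t then
        leafPd hΩ k.1 k.2 f else 0) + if k.1.1 = κ then
        leafPd hΩ κ t (leafLift hΩ i (leafCoord κ k.2.1 k.2.2)) * leafPd hΩ κ k.2 f else 0 := by
    intro k
    have hc := derivation_leafPd_leafCoord hΩ (leafLift hΩ i) κ k.1.1 t k.2
    rw [Derivation.commutator_apply, hc, sub_zero]
    by_cases hk : k.1.1 = κ
    · have hne : ¬(k.1.1 + Finsupp.single i 1 = κ ∧ k.2 = t) := by
        rintro ⟨h, -⟩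
        rw [hk] at h
        exact single_one_ne_zero i (left_eq_add.1 h.symm)
      rw [if_neg hne, if_pos hk, zero_add, hk]
    · have hz : ∀ τ', leafPd hΩ κ t (leafCoord k.1.1 k.2.1 τ') = 0 :=
        fun τ' => leafPd_leafCoord_of_ne hΩ hk t (k.2.1, τ')
      rw [if_neg hk, add_zero, leafPd_leafLift_leafCoord hΩ i k.1.2 hκ]
      simp_rw [hz, smul_zero, mul_zero, Finset.sum_const_zero]
      rw [sub_zero, add_zero]
      by_cases h' : k.1.1 + Finsupp.single i 1 = κ
      · rw [h', leafPd_leafCoord_self hΩ hκ0]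
        by_cases h'' : k.2 = t
        · rw [if_pos h'', if_pos ⟨rfl, h''⟩, one_mul]
        · rw [if_neg h'', if_neg fun h => h'' h.2, zero_mul]
      · rw [leafPd_leafCoord_of_ne hΩ h', zero_mul, if_neg fun h => h' h.1]
  have h3 : ∑ k ∈ s, (if k.1.1 + Finsupp.single i 1 = κ ∧ k.2 = t then
      leafPd hΩ k.1 k.2 f else 0) = leafPdDown hΩ i κ t f := by
    by_cases hi : κ i = 0
    · rw [leafPdDown_of_eq_zero hΩ hi]
      refine Finset.sum_eq_zero fun k _ => if_neg ?_
      rintro ⟨rfl, -⟩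
      simp at hi
    · obtain ⟨μ, rfl⟩ := exists_eq_add_single hi
      have hμ : μ ≠ 0 := by
        rintro rfl
        exact hκ (zero_add _)
      rw [leafPdDown_add_single, Finset.sum_eq_single (⟨μ, hμ⟩, t)]
      · rw [if_pos ⟨rfl, rfl⟩]
      · rintro ⟨⟨κ', hκ'⟩, t'⟩ _ hne
        refine if_neg ?_
        rintro ⟨h, h'⟩
        obtain rfl := add_right_cancel h
        exact hne (by rw [← h'])
      · intro hn
        rw [if_pos ⟨rfl, rfl⟩]
        exact hs _ hn
  rw [Finset.sum_congr rfl fun k _ => h2 k, Finset.sum_add_distrib, h3,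
    Derivation.commutator_apply] at h1
  rw [add_assoc, ← h1]
  abel

end Partial

/-! ### The linearised gauge operators -/

section Nabla

variable {n m : ℕ} {Ω : Set (BaseIx n m → ℝ)} (hΩ : IsOpen Ω)

/-- The operator `(∇_i f)^α = D_i f^α - ∑_β D_{v^β}(v_i^α) f^β` on the model. -/
noncomputable def leafNabla (i : Fin n) (f : Fin m → LeafFun Ω) (α : Fin m) : LeafFun Ω :=
  leafLift hΩ i (f α) - ∑ β, leafD hΩ (.inr β) (leafConn i α) * f β

theorem leafD_inr_leafConn (β : Fin m) (i : Fin n) (α : Fin m) :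
    leafD hΩ (.inr β) (leafConn i α) = leafCoord (Finsupp.single i 1) α (Finsupp.single β 1) := by
  have h := isTaylor_leafCoord hΩ (Finsupp.single i 1) α β 0
  rw [zero_add, Finsupp.coe_zero, Pi.zero_apply, Nat.cast_zero, zero_add, one_smul] at h
  exact h

theorem leafNabla_apply (i : Fin n) (f : Fin m → LeafFun Ω) (α : Fin m) :
    leafNabla hΩ i f α = leafLift hΩ i (f α) -
      ∑ β, leafCoord (Finsupp.single i 1) α (Finsupp.single β 1) * f β := by
  simp_rw [leafNabla, leafD_inr_leafConn]

theorem leafNabla_sub (i : Fin n) (f g : Fin m → LeafFun Ω) :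
    leafNabla hΩ i (f - g) = leafNabla hΩ i f - leafNabla hΩ i g := by
  funext α
  simp only [leafNabla, Pi.sub_apply, map_sub, mul_sub, Finset.sum_sub_distrib]
  abel

theorem leafNabla_add (i : Fin n) (f g : Fin m → LeafFun Ω) :
    leafNabla hΩ i (f + g) = leafNabla hΩ i f + leafNabla hΩ i g := by
  funext α
  simp only [leafNabla, Pi.add_apply, map_add, mul_add, Finset.sum_add_distrib]
  abel

theorem leafPd_leafNabla (i : Fin n) {κ : Fin n →₀ ℕ} (hκ : κ ≠ Finsupp.single i 1)
    (t : Fin m × (Fin m →₀ ℕ)) (f : Fin m → LeafFun Ω) (α : Fin m) :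
    leafPd hΩ κ t (leafNabla hΩ i f α) = leafPd hΩ κ t (leafLift hΩ i (f α)) -
      ∑ β, leafCoord (Finsupp.single i 1) α (Finsupp.single β 1) * leafPd hΩ κ t (f β) := by
  rw [leafNabla_apply, map_sub, map_sum]
  congr 1
  exact Finset.sum_congr rfl fun β _ => leafPd_leafConn_mul hΩ hκ t (α, Finsupp.single β 1) _

/-- If `f` does not depend on the coordinates with label `κ`, then the dependence of `∇_i f` on them
comes from the coordinates with label `κ - e_i`. -/
theorem leafPd_leafNabla_of_eq_zero (i : Fin n) {κ : Fin n →₀ ℕ} (hκ0 : κ ≠ 0)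
    (hκ : κ ≠ Finsupp.single i 1) {f : Fin m → LeafFun Ω} (hf : ∀ t α, leafPd hΩ κ t (f α) = 0)
    (t : Fin m × (Fin m →₀ ℕ)) (α : Fin m) :
    leafPd hΩ κ t (leafNabla hΩ i f α) = leafPdDown hΩ i κ t (f α) := by
  obtain ⟨s, -, h⟩ := exists_leafPd_leafLift hΩ i hκ0 hκ t (f α)
  rw [leafPd_leafNabla hΩ i hκ, h]
  simp only [hf, map_zero, mul_zero, ite_self, Finset.sum_const_zero, zero_add, add_zero, sub_zero]

/-- The analogue for second derivatives: the operator `∇_i` lowers either of the two labels. -/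
theorem leafPd_leafPd_leafNabla_of_eq_zero (i : Fin n) {κ κ' : Fin n →₀ ℕ} (hκ0 : κ ≠ 0)
    (hκ : κ ≠ Finsupp.single i 1) (hκ0' : κ' ≠ 0) (hκ' : κ' ≠ Finsupp.single i 1)
    {f : Fin m → LeafFun Ω} (hf : ∀ t t' α, leafPd hΩ κ t (leafPd hΩ κ' t' (f α)) = 0)
    (t t' : Fin m × (Fin m →₀ ℕ)) (α : Fin m) :
    leafPd hΩ κ t (leafPd hΩ κ' t' (leafNabla hΩ i f α)) =
      leafPdDown hΩ i κ t (leafPd hΩ κ' t' (f α)) +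
        leafPd hΩ κ t (leafPdDown hΩ i κ' t' (f α)) := by
  obtain ⟨s, -, h⟩ := exists_leafPd_leafLift hΩ i hκ0' hκ' t' (f α)
  obtain ⟨s', -, h'⟩ := exists_leafPd_leafLift hΩ i hκ0 hκ t (leafPd hΩ κ' t' (f α))
  have h1 : ∀ k : LeafIx n m, leafPd hΩ κ t (if k.1.1 = κ' then
      leafPd hΩ κ' t' (leafLift hΩ i (leafCoord κ' k.2.1 k.2.2)) * leafPd hΩ κ' k.2 (f α)
        else 0) = 0 := by
    intro k
    split_ifs
    · have hz : ∀ γ τ, leafPd hΩ κ t (leafCoord (Finsupp.single i 1) γ τ) = 0 := fun γ τ =>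
        leafPd_leafCoord_of_ne hΩ hκ.symm t (γ, τ)
      rw [Derivation.leibniz, hf, smul_zero, zero_add,
        leafPd_leafPd_leafLift_leafCoord hΩ i hκ0' hκ']
      simp only [hz, zero_mul, Finset.sum_const_zero, sub_self, smul_zero]
    · exact map_zero _
  have h2 : ∀ β, leafPd hΩ κ t (leafCoord (Finsupp.single i 1) α (Finsupp.single β 1) *
      leafPd hΩ κ' t' (f β)) = 0 := fun β =>
    (leafPd_leafConn_mul hΩ hκ t (α, Finsupp.single β 1) _).trans (by rw [hf, mul_zero])
  rw [leafPd_leafNabla hΩ i hκ', h, map_sub, map_add, map_add, map_sum, map_sum, h']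
  simp only [h1, h2, hf, map_zero, mul_zero, ite_self, Finset.sum_const_zero, zero_add, add_zero,
    sub_zero]

/-- The mixed second derivatives of `D_i w_{e_j,τ}^α` along coordinates with labels `e_i`, `e_j`. -/
theorem leafPd_leafPd_leafLift_single {i j : Fin n} (hij : i ≠ j)
    (t t' : Fin m × (Fin m →₀ ℕ)) (α : Fin m) (τ : Fin m →₀ ℕ) :
    leafPd hΩ (Finsupp.single i 1) t (leafPd hΩ (Finsupp.single j 1) t'
      (leafLift hΩ i (leafCoord (Finsupp.single j 1) α τ))) =
      if t.2 ≠ 0 ∧ α = t'.1 ∧ τ + Finsupp.single t.1 1 = t.2 + t'.2 then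
        (-(t'.2 t.1 : ℝ)) • (1 : LeafFun Ω) else 0 := by
  classical
  have hji : (Finsupp.single j 1 : Fin n →₀ ℕ) ≠ Finsupp.single i 1 := fun h =>
    hij ((Finsupp.single_left_inj one_ne_zero).1 h).symm
  have hd : ∀ (i : Fin n) (t : Fin m × (Fin m →₀ ℕ)) (γ : Fin m) (ρ : Fin m →₀ ℕ),
      leafPd hΩ (Finsupp.single i 1) t (leafCoord (Finsupp.single i 1) γ ρ) =
        if (γ, ρ) = t then 1 else 0 := fun i t γ ρ =>
    leafPd_leafCoord_self hΩ (single_one_ne_zero i) t (γ, ρ)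
  rw [leafPd_leafPd_leafLift_leafCoord hΩ i (single_one_ne_zero j) hji]
  simp_rw [hd]
  obtain ⟨γ, ρ⟩ := t
  obtain ⟨γ', ρ'⟩ := t'
  have hs : ∀ (σ : Fin m →₀ ℕ) (F : Fin m → LeafFun Ω),
      ∑ δ, (if (δ, σ) = (γ, ρ) then (1 : LeafFun Ω) else 0) * F δ =
        if σ = ρ then F γ else 0 := by
    intro σ F
    rw [Finset.sum_eq_single γ]
    · by_cases h : σ = ρ
      · rw [if_pos (by rw [h]), if_pos h, one_mul]
      · rw [if_neg (fun h' => h (congrArg Prod.snd h')), if_neg h, zero_mul]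
    · intro δ _ hδ
      rw [if_neg (fun h' => hδ (congrArg Prod.fst h')), zero_mul]
    · exact fun h => absurd (Finset.mem_univ _) h
  rw [hs, Finset.sum_comm]
  simp_rw [fun x : (Fin m →₀ ℕ) × (Fin m →₀ ℕ) => hs x.1 fun δ =>
    ((x.2 δ : ℝ) + 1) • if (α, x.2 + Finsupp.single δ 1) = (γ', ρ') then (1 : LeafFun Ω) else 0]
  by_cases hρ : ρ = 0
  · subst hρ
    have hn : ¬((0 : Fin m →₀ ℕ) ≠ 0 ∧ α = γ' ∧ τ + Finsupp.single γ 1 = 0 + ρ') :=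
      fun h => h.1 rfl
    rw [if_pos rfl, if_neg hn, Finset.sum_eq_single (0, τ)]
    · exact sub_eq_zero.2 (if_pos rfl).symm
    · rintro ⟨x, y⟩ hx hne
      refine if_neg ?_
      rintro rfl
      rw [mem_antidiagonal, zero_add] at hx
      exact hne (by rw [← hx])
    · intro h
      exact absurd (mem_antidiagonal.2 (zero_add τ)) h
  · rw [if_neg (fun h => hρ h.symm), zero_sub]
    by_cases hc : α = γ' ∧ τ + Finsupp.single γ 1 = ρ + ρ'
    · obtain ⟨rfl, hτ⟩ := hc
      rw [if_pos ⟨hρ, rfl, hτ⟩]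
      by_cases hz : ρ' γ = 0
      · rw [hz, Nat.cast_zero, neg_zero, zero_smul, neg_eq_zero]
        refine Finset.sum_eq_zero fun x _ => ?_
        split_ifs with h1 h2
        · have := DFunLike.congr_fun (congrArg Prod.snd h2) γ
          simp [hz] at this
        · rw [smul_zero]
        · rfl
      · obtain ⟨σ, rfl⟩ := exists_eq_add_single hz
        have hτ' : τ = ρ + σ := by
          rw [← add_assoc] at hτ
          exact add_right_cancel hτ
        rw [Finset.sum_eq_single (ρ, σ), if_pos rfl, if_pos rfl, neg_smul]
        · simp
        · rintro ⟨x, y⟩ hx hne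
          by_cases h1 : x = ρ
          · have h2 : y = σ := by
              rw [mem_antidiagonal, hτ'] at hx
              simp only [h1] at hx
              exact add_left_cancel hx
            exact absurd (by rw [h1, h2]) hne
          · exact if_neg h1
        · intro h
          exact absurd (mem_antidiagonal.2 hτ'.symm) h
    · rw [if_neg (fun h => hc h.2), neg_eq_zero]
      refine Finset.sum_eq_zero fun x hx => ?_
      split_ifs with h1 h2
      · refine absurd ⟨congrArg Prod.fst h2, ?_⟩ hc
        rw [mem_antidiagonal] at hx
        rw [← hx, h1, add_assoc]
        exact congrArg (ρ + ·) (congrArg Prod.snd h2)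
      · rw [smul_zero]
      · rfl

/-- The mixed derivatives of `∇_i F` along coordinates with labels `e_i`, `e_j`, if the derivatives
`∂ F / ∂ w_{e_j,t}` are functions on `Ω`. The multi-index `τ` stands for `ρ + ρ' - e_γ`; it is
arbitrary if `e_γ ≤ ρ'` fails, since its coefficient vanishes in that case. -/
theorem leafPd_leafPd_leafNabla_single {i j : Fin n} (hij : i ≠ j) {F : Fin m → LeafFun Ω}
    (hF : ∀ κ t t' α, leafPd hΩ κ t (leafPd hΩ (Finsupp.single j 1) t' (F α)) = 0)
    (γ γ' α : Fin m) (ρ ρ' τ : Fin m →₀ ℕ)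
    (hτ : ρ' γ = 0 ∨ τ + Finsupp.single γ 1 = ρ + ρ') :
    leafPd hΩ (Finsupp.single i 1) (γ, ρ) (leafPd hΩ (Finsupp.single j 1) (γ', ρ')
      (leafNabla hΩ i F α)) =
      (if ρ = 0 then leafD hΩ (.inr γ) (leafPd hΩ (Finsupp.single j 1) (γ', ρ') (F α)) else
        (-(ρ' γ : ℝ)) • leafPd hΩ (Finsupp.single j 1) (γ', τ) (F α)) -
      ∑ β, if α = γ ∧ ρ = Finsupp.single β 1 then
        leafPd hΩ (Finsupp.single j 1) (γ', ρ') (F β) else 0 := by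
  classical
  have hji : (Finsupp.single j 1 : Fin n →₀ ℕ) ≠ Finsupp.single i 1 := fun h =>
    hij ((Finsupp.single_left_inj one_ne_zero).1 h).symm
  obtain ⟨s, hs, h⟩ := exists_leafPd_leafLift hΩ i (single_one_ne_zero j) hji (γ', ρ') (F α)
  have hdown : (Finsupp.single j 1 : Fin n →₀ ℕ) i = 0 := Finsupp.single_eq_of_ne hij
  rw [leafPd_leafNabla hΩ i hji, h, leafPdDown_of_eq_zero hΩ hdown, add_zero, map_sub, map_add,
    map_sum, map_sum, leafPd_single_leafLift hΩ fun κ t => hF κ t _ _]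
  have h1 : ∀ k : LeafIx n m, leafPd hΩ (Finsupp.single i 1) (γ, ρ)
      (if k.1.1 = Finsupp.single j 1 then leafPd hΩ (Finsupp.single j 1) (γ', ρ')
        (leafLift hΩ i (leafCoord (Finsupp.single j 1) k.2.1 k.2.2)) *
          leafPd hΩ (Finsupp.single j 1) k.2 (F α) else 0) =
      if k.1.1 = Finsupp.single j 1 ∧ ρ ≠ 0 ∧ k.2.1 = γ' ∧ k.2.2 + Finsupp.single γ 1 = ρ + ρ' then
        (-(ρ' γ : ℝ)) • leafPd hΩ (Finsupp.single j 1) k.2 (F α) else 0 := by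
    intro k
    by_cases hk : k.1.1 = Finsupp.single j 1
    · rw [if_pos hk, Derivation.leibniz, hF, smul_zero, zero_add,
        leafPd_leafPd_leafLift_single hΩ hij]
      by_cases hc : ρ ≠ 0 ∧ k.2.1 = γ' ∧ k.2.2 + Finsupp.single γ 1 = ρ + ρ'
      · rw [if_pos hc, if_pos ⟨hk, hc⟩, smul_eq_mul, mul_smul_comm, mul_one]
      · rw [if_neg hc, if_neg (fun h => hc h.2), smul_zero]
    · rw [if_neg hk, map_zero, if_neg (fun h => hk h.1)]
  have h2 : ∑ k ∈ s, leafPd hΩ (Finsupp.single i 1) (γ, ρ)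
      (if k.1.1 = Finsupp.single j 1 then leafPd hΩ (Finsupp.single j 1) (γ', ρ')
        (leafLift hΩ i (leafCoord (Finsupp.single j 1) k.2.1 k.2.2)) *
          leafPd hΩ (Finsupp.single j 1) k.2 (F α) else 0) =
      if ρ = 0 then 0 else (-(ρ' γ : ℝ)) • leafPd hΩ (Finsupp.single j 1) (γ', τ) (F α) := by
    rw [Finset.sum_congr rfl fun k _ => h1 k]
    by_cases hρ : ρ = 0
    · rw [if_pos hρ]
      exact Finset.sum_eq_zero fun k _ => if_neg fun h => h.2.1 hρ
    · rw [if_neg hρ]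
      rcases hτ with hz | hτ
      · rw [hz, Nat.cast_zero, neg_zero, zero_smul]
        exact Finset.sum_eq_zero fun k _ => by rw [zero_smul, ite_self]
      · rw [Finset.sum_eq_single (⟨Finsupp.single j 1, single_one_ne_zero j⟩, γ', τ)]
        · exact if_pos ⟨rfl, hρ, rfl, hτ⟩
        · rintro ⟨⟨κ, hκ⟩, δ, σ⟩ _ hne
          refine if_neg ?_
          rintro ⟨hk, -, hδ, hσ⟩
          refine hne ?_
          have hστ : σ = τ := add_right_cancel (hσ.trans hτ.symm)
          simp only at hk hδ
          subst hk hδ hστ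
          rfl
        · intro hn
          rw [if_pos ⟨rfl, hρ, rfl, hτ⟩]
          exact (congrArg _ (hs _ hn)).trans (smul_zero _)
  have h3 : ∀ β, leafPd hΩ (Finsupp.single i 1) (γ, ρ)
      (leafCoord (Finsupp.single i 1) α (Finsupp.single β 1) *
        leafPd hΩ (Finsupp.single j 1) (γ', ρ') (F β)) =
      if α = γ ∧ ρ = Finsupp.single β 1 then
        leafPd hΩ (Finsupp.single j 1) (γ', ρ') (F β) else 0 := by
    intro β
    have hd := leafPd_leafCoord_self hΩ (single_one_ne_zero i) (γ, ρ) (α, Finsupp.single β 1)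
    rw [Derivation.leibniz, hF, smul_zero, zero_add, hd, smul_eq_mul, mul_ite, mul_one, mul_zero]
    refine if_congr ?_ rfl rfl
    rw [Prod.mk.injEq, eq_comm (a := Finsupp.single β 1)]
  rw [h2, Finset.sum_congr rfl fun β _ => h3 β]
  congr 1
  by_cases hρ : ρ = 0
  · rw [if_pos hρ, if_pos hρ, if_pos hρ, add_zero]
  · rw [if_neg hρ, if_neg hρ, if_neg hρ, zero_add]

theorem leafLift_leafD_inr (i : Fin n) (γ : Fin m) (f : LeafFun Ω) :
    leafLift hΩ i (leafD hΩ (.inr γ) f) = leafD hΩ (.inr γ) (leafLift hΩ i f) -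
      ∑ β, leafD hΩ (.inr γ) (leafConn i β) * leafD hΩ (.inr β) f := by
  rw [leafLift_apply, leafLift_apply, map_add, map_sum, leafD_comm hΩ (.inr γ) (.inl i),
    add_sub_assoc, ← Finset.sum_sub_distrib]
  congr 1
  refine Finset.sum_congr rfl fun β _ => ?_
  rw [Derivation.leibniz, leafD_comm hΩ (.inr γ), smul_eq_mul, smul_eq_mul,
    mul_comm (leafD hΩ (.inr γ) (leafConn i β)), add_sub_cancel_right]

/-- The operators `∇_i` commute, since the connection is flat. -/
theorem leafNabla_comm (i j : Fin n) (f : Fin m → LeafFun Ω) :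
    leafNabla hΩ i (leafNabla hΩ j f) = leafNabla hΩ j (leafNabla hΩ i f) := by
  funext α
  have key : ∀ i j, leafNabla hΩ i (leafNabla hΩ j f) α =
      leafLift hΩ i (leafLift hΩ j (f α)) -
        (∑ β, (leafD hΩ (.inr β) (leafConn j α) * leafLift hΩ i (f β) +
          leafD hΩ (.inr β) (leafConn i α) * leafLift hΩ j (f β)) +
        ∑ γ, (leafD hΩ (.inr γ) (leafLift hΩ i (leafConn j α)) -
          ∑ β, (leafD hΩ (.inr γ) (leafConn i β) * leafD hΩ (.inr β) (leafConn j α) +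
            leafD hΩ (.inr γ) (leafConn j β) * leafD hΩ (.inr β) (leafConn i α))) * f γ) := by
    intro i j
    have h1 : ∀ γ, leafLift hΩ i (leafD hΩ (.inr γ) (leafConn j α) * f γ) =
        leafD hΩ (.inr γ) (leafConn j α) * leafLift hΩ i (f γ) +
          (leafD hΩ (.inr γ) (leafLift hΩ i (leafConn j α)) -
            ∑ β, leafD hΩ (.inr γ) (leafConn i β) * leafD hΩ (.inr β) (leafConn j α)) * f γ :=
      fun γ => by
        rw [Derivation.leibniz, leafLift_leafD_inr, smul_eq_mul, smul_eq_mul, mul_comm (f γ)]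
    rw [leafNabla, leafNabla, map_sub, map_sum]
    simp_rw [h1, leafNabla, mul_sub, sub_mul, Finset.sum_add_distrib, Finset.sum_sub_distrib,
      add_mul, Finset.sum_add_distrib, Finset.mul_sum, Finset.sum_mul]
    rw [Finset.sum_comm (f := fun β γ => leafD hΩ (.inr β) (leafConn i α) *
      (leafD hΩ (.inr γ) (leafConn j β) * f γ))]
    simp_rw [mul_left_comm (leafD hΩ (.inr _) (leafConn i α)), mul_assoc]
    abel
  have h2 : ∀ γ, ∑ β, (leafD hΩ (.inr γ) (leafConn i β) * leafD hΩ (.inr β) (leafConn j α) +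
      leafD hΩ (.inr γ) (leafConn j β) * leafD hΩ (.inr β) (leafConn i α)) =
      ∑ β, (leafD hΩ (.inr γ) (leafConn j β) * leafD hΩ (.inr β) (leafConn i α) +
        leafD hΩ (.inr γ) (leafConn i β) * leafD hΩ (.inr β) (leafConn j α)) := fun γ =>
    Finset.sum_congr rfl fun β _ => add_comm _ _
  have h3 : ∑ β, (leafD hΩ (.inr β) (leafConn j α) * leafLift hΩ i (f β) +
      leafD hΩ (.inr β) (leafConn i α) * leafLift hΩ j (f β)) =
      ∑ β, (leafD hΩ (.inr β) (leafConn i α) * leafLift hΩ j (f β) +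
        leafD hΩ (.inr β) (leafConn j α) * leafLift hΩ i (f β)) :=
    Finset.sum_congr rfl fun β _ => add_comm _ _
  rw [key, key, leafLift_comm, leafLift_leafConn hΩ i j, h3]
  simp_rw [h2]

end Nabla

/-! ### Vanishing of the linearised gauge cohomology -/

section Lex

variable {n : ℕ}

theorem toLex_lt_add_single (κ : Fin n →₀ ℕ) (i : Fin n) :
    toLex κ < toLex (κ + Finsupp.single i 1) := by
  refine lt_of_le_of_ne (Finsupp.toLex_monotone (le_add_of_nonneg_right zero_le)) fun h => ?_
  exact single_one_ne_zero i (left_eq_add.1 (toLex.injective h))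

theorem toLex_zero_lt {κ : Fin n →₀ ℕ} (h : κ ≠ 0) : toLex 0 < toLex κ :=
  lt_of_le_of_ne (Finsupp.toLex_monotone zero_le) fun h' => h (toLex.injective h').symm

theorem toLex_add_lt_add_iff (κ μ ν : Fin n →₀ ℕ) :
    toLex (κ + ν) < toLex (μ + ν) ↔ toLex κ < toLex μ :=
  add_lt_add_iff_right (toLex ν)

/-- The lexicographic order compares the component with the smallest index first. -/
theorem toLex_lt_of_apply_lt {i : Fin n} (hi : ∀ k, i ≤ k) {κ μ : Fin n →₀ ℕ} (h : κ i < μ i) :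
    toLex κ < toLex μ :=
  Finsupp.Lex.lt_iff.2 ⟨i, fun d hd => absurd (hi d) (not_le.2 hd), h⟩

end Lex

section Cohomology

variable {n m : ℕ} {Ω : Set (BaseIx n m → ℝ)} (hΩ : IsOpen Ω)

/-- A tuple of functions either consists of functions on `Ω`, or there is a greatest label on which
it depends. -/
theorem exists_top_level (f : Fin m → LeafFun Ω) :
    (∀ κ t α, leafPd hΩ κ t (f α) = 0) ∨ ∃ p : Fin n →₀ ℕ, p ≠ 0 ∧
      (∃ t α, leafPd hΩ p t (f α) ≠ 0) ∧
        ∀ κ, toLex p < toLex κ → ∀ t α, leafPd hΩ κ t (f α) = 0 := by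
  classical
  choose s hs using fun α => exists_finset_level hΩ (f α)
  let S := (Finset.univ.biUnion s).filter fun κ => ∃ t α, leafPd hΩ κ t (f α) ≠ 0
  have hS : ∀ κ ∉ S, ∀ t α, leafPd hΩ κ t (f α) = 0 := by
    intro κ hκ t α
    by_contra h
    refine hκ (Finset.mem_filter.2 ⟨Finset.mem_biUnion.2 ⟨α, Finset.mem_univ _, ?_⟩, t, α, h⟩)
    by_contra h'
    exact h (hs α κ h' t)
  rcases S.eq_empty_or_nonempty with h | h
  · exact .inl fun κ t α => hS κ (by rw [h]; exact Finset.notMem_empty κ) t α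
  · obtain ⟨p, hp, hmax⟩ := S.exists_max_image toLex h
    obtain ⟨-, t, α, hne⟩ := Finset.mem_filter.1 hp
    refine .inr ⟨p, ?_, ⟨t, α, hne⟩, fun κ hκ => hS κ fun h => absurd (hmax κ h) (not_le.2 hκ)⟩
    rintro rfl
    exact hne (leafPd_zero hΩ t _)

theorem leafPd_leafNabla_eq_zero_of_lt (i : Fin n) {f : Fin m → LeafFun Ω} {p : Fin n →₀ ℕ}
    (hf : ∀ κ, toLex p < toLex κ → ∀ t α, leafPd hΩ κ t (f α) = 0) {κ : Fin n →₀ ℕ}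
    (hκ : toLex (p + Finsupp.single i 1) < toLex κ) (t : Fin m × (Fin m →₀ ℕ)) (α : Fin m) :
    leafPd hΩ κ t (leafNabla hΩ i f α) = 0 := by
  have h0 : κ ≠ 0 := by
    rintro rfl
    exact absurd (Finsupp.toLex_monotone zero_le) (not_le.2 hκ)
  have h1 : κ ≠ Finsupp.single i 1 := by
    rintro rfl
    exact absurd (Finsupp.toLex_monotone (le_add_of_nonneg_left zero_le)) (not_le.2 hκ)
  rw [leafPd_leafNabla_of_eq_zero hΩ i h0 h1 (hf κ ((toLex_lt_add_single p i).trans hκ))]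
  by_cases hi : κ i = 0
  · exact leafPdDown_of_eq_zero hΩ hi t _
  · obtain ⟨μ, rfl⟩ := exists_eq_add_single hi
    rw [leafPdDown_add_single]
    exact hf μ ((toLex_add_lt_add_iff _ _ _).1 hκ) t α

theorem leafPd_add_single_leafNabla (i : Fin n) {f : Fin m → LeafFun Ω} {p : Fin n →₀ ℕ}
    (hp : p ≠ 0) (hf : ∀ κ, toLex p < toLex κ → ∀ t α, leafPd hΩ κ t (f α) = 0)
    (t : Fin m × (Fin m →₀ ℕ)) (α : Fin m) :
    leafPd hΩ (p + Finsupp.single i 1) t (leafNabla hΩ i f α) = leafPd hΩ p t (f α) := by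
  rw [leafPd_leafNabla_of_eq_zero hΩ i (add_single_ne_zero _ _)
    (fun h => hp (add_eq_right.1 h)) (hf _ (toLex_lt_add_single p i)), leafPdDown_add_single]

theorem leafPd_leafNabla_eq_zero {f : Fin m → LeafFun Ω} (hf : ∀ κ t α, leafPd hΩ κ t (f α) = 0)
    (i : Fin n) {κ : Fin n →₀ ℕ} (hκ : κ ≠ Finsupp.single i 1) (t : Fin m × (Fin m →₀ ℕ))
    (α : Fin m) : leafPd hΩ κ t (leafNabla hΩ i f α) = 0 := by
  rw [leafPd_leafNabla hΩ i hκ, leafPd_leafLift_eq_zero hΩ (fun κ t => hf κ t α) i hκ, zero_sub,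
    neg_eq_zero]
  exact Finset.sum_eq_zero fun β _ => by rw [hf, mul_zero]

theorem leafPd_single_leafNabla {f : Fin m → LeafFun Ω} (hf : ∀ κ t α, leafPd hΩ κ t (f α) = 0)
    (i : Fin n) (γ : Fin m) (ρ : Fin m →₀ ℕ) (α : Fin m) :
    leafPd hΩ (Finsupp.single i 1) (γ, ρ) (leafNabla hΩ i f α) =
      (if ρ = 0 then leafD hΩ (.inr γ) (f α) else 0) -
        ∑ β, if α = γ ∧ ρ = Finsupp.single β 1 then f β else 0 := by
  rw [leafNabla_apply, map_sub, map_sum, leafPd_single_leafLift hΩ fun κ t => hf κ t α]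
  congr 1
  refine Finset.sum_congr rfl fun β _ => ?_
  have hd := leafPd_leafCoord_self hΩ (single_one_ne_zero i) (γ, ρ) (α, Finsupp.single β 1)
  rw [Derivation.leibniz, hf, smul_zero, zero_add, hd, smul_eq_mul, mul_ite, mul_one, mul_zero]
  refine if_congr ?_ rfl rfl
  rw [Prod.mk.injEq, eq_comm (a := Finsupp.single β 1)]

theorem eq_zero_of_leafPd_single_leafNabla {f : Fin m → LeafFun Ω}
    (hf : ∀ κ t α, leafPd hΩ κ t (f α) = 0) (i : Fin n)
    (h : ∀ t α, leafPd hΩ (Finsupp.single i 1) t (leafNabla hΩ i f α) = 0) : f = 0 := by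
  funext β
  have h1 := h (β, Finsupp.single β 1) β
  rw [leafPd_single_leafNabla hΩ hf, if_neg (single_one_ne_zero β), zero_sub, neg_eq_zero,
    Finset.sum_eq_single β (fun γ _ hγ => if_neg fun h => hγ
      ((Finsupp.single_left_inj one_ne_zero).1 h.2).symm)
      (fun h => absurd (Finset.mem_univ _) h), if_pos ⟨rfl, rfl⟩] at h1
  exact h1

/-- The operators `∇_i` are injective: the derivative along `w_{p+e_i,t}` of `∇_i f` is that of `f`
along `w_{p,t}` if `p` is the greatest label on which `f` depends. -/
theorem eq_zero_of_leafNabla_eq_zero (i : Fin n) {f : Fin m → LeafFun Ω}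
    (h : leafNabla hΩ i f = 0) : f = 0 := by
  have h' : ∀ κ t α, leafPd hΩ κ t (leafNabla hΩ i f α) = 0 := fun κ t α => by
    rw [h]
    exact map_zero _
  rcases exists_top_level hΩ f with hf | ⟨p, hp, ⟨t, α, hne⟩, hf⟩
  · exact eq_zero_of_leafPd_single_leafNabla hΩ hf i (h' _)
  · exact absurd ((leafPd_add_single_leafNabla hΩ i hp hf t α).symm.trans (h' _ t α)) hne

section Closed

variable {i j : Fin n} {P Q : Fin m → LeafFun Ω}

/-- The greatest labels of `P` and `Q` are `r + e_i` and `r + e_j` for some `r`, and the leading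
derivatives of `P` and `Q` agree. -/
theorem exists_leading_label (hij : i ≠ j) (hPQ : leafNabla hΩ i Q = leafNabla hΩ j P)
    {p : Fin n →₀ ℕ} (hp : p ≠ 0) (hne : ∃ t α, leafPd hΩ p t (P α) ≠ 0)
    (hP : ∀ κ, toLex p < toLex κ → ∀ t α, leafPd hΩ κ t (P α) = 0) :
    ∃ r, p = r + Finsupp.single i 1 ∧
      (∀ κ, toLex (r + Finsupp.single j 1) < toLex κ → ∀ t α, leafPd hΩ κ t (Q α) = 0) ∧
      ∀ t α, leafPd hΩ (r + Finsupp.single j 1) t (Q α) = leafPd hΩ p t (P α) := by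
  obtain ⟨t, α, hne⟩ := hne
  have hA := leafPd_add_single_leafNabla hΩ j hp hP
  rcases exists_top_level hΩ Q with hQ | ⟨q, hq, ⟨t', α', hne'⟩, hQ⟩
  · refine absurd ?_ hne
    rw [← hA, ← hPQ]
    refine leafPd_leafNabla_eq_zero hΩ hQ i (fun h => ?_) t α
    have := DFunLike.congr_fun h j
    simp [hij] at this
  · have hB := leafPd_add_single_leafNabla hΩ i hq hQ
    have hpq : q + Finsupp.single i 1 = p + Finsupp.single j 1 := by
      rcases lt_trichotomy (toLex (q + Finsupp.single i 1)) (toLex (p + Finsupp.single j 1))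
        with h | h | h
      · refine absurd ?_ hne
        rw [← hA, ← hPQ]
        exact leafPd_leafNabla_eq_zero_of_lt hΩ i hQ h t α
      · exact toLex.injective h
      · refine absurd ?_ hne'
        rw [← hB, hPQ]
        exact leafPd_leafNabla_eq_zero_of_lt hΩ j hP h t' α'
    have hpi : p i ≠ 0 := by
      have := DFunLike.congr_fun hpq i
      simp [hij.symm] at this
      omega
    obtain ⟨r, rfl⟩ := exists_eq_add_single hpi
    have hqr : q = r + Finsupp.single j 1 := by
      rw [add_right_comm] at hpq
      exact add_right_cancel hpq
    subst hqr
    refine ⟨r, rfl, hQ, fun t α => ?_⟩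
    rw [← hA, ← hPQ, ← hpq, hB]

/-- The mixed derivatives of `P` whose labels `s`, `μ` are large vanish. If this holds for the label
`s + e_j` and all `μ`, then the derivative of `∇_i Q = ∇_j P` with labels `s + e_j` and `μ` gives it
for `s`; and `P` does not depend on the label `s + k e_j` for large `k`. -/
theorem leafPd_leafPd_eq_zero_of_closed (hij : i ≠ j) (hi : ∀ k, i ≤ k)
    (hPQ : leafNabla hΩ i Q = leafNabla hΩ j P) {r : Fin n →₀ ℕ}
    (hQ : ∀ κ, toLex (r + Finsupp.single j 1) < toLex κ → ∀ t α, leafPd hΩ κ t (Q α) = 0)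
    {s : Fin n →₀ ℕ} (hs : toLex r < toLex s) {μ : Fin n →₀ ℕ} (hμ : r i < μ i)
    (t t' : Fin m × (Fin m →₀ ℕ)) (α : Fin m) :
    leafPd hΩ s t (leafPd hΩ μ t' (P α)) = 0 := by
  classical
  have key : ∀ (N : ℕ) (s : Fin n →₀ ℕ), toLex r < toLex s →
      (∀ k, N ≤ k → ∀ t α, leafPd hΩ (s + Finsupp.single j k) t (P α) = 0) →
      ∀ μ : Fin n →₀ ℕ, r i < μ i → ∀ t t' α, leafPd hΩ s t (leafPd hΩ μ t' (P α)) = 0 := by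
    intro N
    induction N with
    | zero =>
      intro s _ h μ _ t t' α
      have h0 := h 0 le_rfl t α
      rw [Finsupp.single_zero, add_zero] at h0
      rw [leafPd_comm, h0, map_zero]
    | succ N ih =>
      intro s hs h μ hμ t t' α
      have ih' := ih (s + Finsupp.single j 1) (hs.trans (toLex_lt_add_single s j))
        fun k hk t α => by
          have := h (k + 1) (by omega) t α
          rwa [add_comm k 1, Finsupp.single_add, ← add_assoc] at this
      have hs0 : s ≠ 0 := by
        rintro rfl
        exact absurd (Finsupp.toLex_monotone zero_le) (not_le.2 hs)
      have hμ0 : μ ≠ 0 := by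
        rintro rfl
        exact absurd hμ (Nat.not_lt_zero _)
      have hμj : μ ≠ Finsupp.single j 1 := by
        rintro rfl
        rw [Finsupp.single_eq_of_ne hij] at hμ
        exact absurd hμ (Nat.not_lt_zero _)
      have h1 := leafPd_leafPd_leafNabla_of_eq_zero hΩ j (add_single_ne_zero s j)
        (fun h => hs0 (add_eq_right.1 h)) hμ0 hμj (fun t t' α => ih' μ hμ t t' α) t t' α
      have h2 : leafPd hΩ (s + Finsupp.single j 1) t (leafPdDown hΩ j μ t' (P α)) = 0 := by
        by_cases hz : μ j = 0
        · rw [leafPdDown_of_eq_zero hΩ hz, map_zero]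
        · obtain ⟨ν, rfl⟩ := exists_eq_add_single hz
          rw [leafPdDown_add_single]
          refine ih' ν ?_ t t' α
          rwa [Finsupp.add_apply, Finsupp.single_eq_of_ne hij, add_zero] at hμ
      have hμQ : ∀ t α, leafPd hΩ μ t (Q α) = 0 := hQ μ (toLex_lt_of_apply_lt hi (by
        rwa [Finsupp.add_apply, Finsupp.single_eq_of_ne hij, add_zero]))
      have hsQ : ∀ t α, leafPd hΩ (s + Finsupp.single j 1) t (Q α) = 0 :=
        hQ _ ((toLex_add_lt_add_iff _ _ _).2 hs)
      have hsi : s + Finsupp.single j 1 ≠ Finsupp.single i 1 := fun h => by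
        have := DFunLike.congr_fun h j
        simp [hij] at this
      have h3 : leafPd hΩ (s + Finsupp.single j 1) t (leafPd hΩ μ t' (leafNabla hΩ i Q α)) = 0 := by
        rw [leafPd_comm, leafPd_leafNabla_of_eq_zero hΩ i (add_single_ne_zero s j) hsi hsQ]
        by_cases hz : (s + Finsupp.single j 1 : Fin n →₀ ℕ) i = 0
        · rw [leafPdDown_of_eq_zero hΩ hz, map_zero]
        · obtain ⟨ν, hν⟩ := exists_eq_add_single hz
          rw [hν, leafPdDown_add_single, leafPd_comm, hμQ, map_zero]
      rw [← hPQ, h3, h2, add_zero, leafPdDown_add_single] at h1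
      exact h1.symm
  choose S hS using fun α => exists_finset_level hΩ (P α)
  refine key ((Finset.univ.biUnion S).sup (fun κ => κ j) + 1) s hs (fun k hk t α => ?_) μ hμ t t' α
  refine hS α _ (fun h => ?_) t
  have h1 := Finset.le_sup (f := fun κ : Fin n →₀ ℕ => κ j)
    (Finset.mem_biUnion.2 ⟨α, Finset.mem_univ _, h⟩)
  simp only [Finsupp.add_apply, Finsupp.single_eq_same] at h1
  omega

/-- A function whose derivatives along the coordinates with label `r` are given. -/
theorem exists_leafPd_eq {r : Fin n →₀ ℕ} (hr : r ≠ 0)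
    (A : Fin m × (Fin m →₀ ℕ) → LeafFun Ω) (S : Finset (Fin m × (Fin m →₀ ℕ)))
    (hS : ∀ t ∉ S, A t = 0)
    (hA : ∀ t t', leafPd hΩ r t (A t') = leafPd hΩ r t' (A t))
    (hA' : ∀ s, toLex r < toLex s → ∀ t t', leafPd hΩ s t (A t') = 0) :
    ∃ F : LeafFun Ω, (∀ t, leafPd hΩ r t F = A t) ∧
      ∀ s, toLex r < toLex s → ∀ t, leafPd hΩ s t F = 0 := by
  classical
  simp only [leafPd_of_ne hΩ hr] at hA
  obtain ⟨F, h1, h2⟩ := exists_potential hΩ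
    (S.image fun t => ((⟨r, hr⟩, t) : LeafIx n m)) (fun k => A k.2) fun k hk l hl => by
      obtain ⟨t, -, rfl⟩ := Finset.mem_image.1 hk
      obtain ⟨t', -, rfl⟩ := Finset.mem_image.1 hl
      exact hA t t'
  refine ⟨F, fun t => ?_, fun s hs t => ?_⟩
  · rw [leafPd_of_ne hΩ hr]
    by_cases ht : t ∈ S
    · exact h1 _ (Finset.mem_image_of_mem _ ht)
    · rw [hS t ht]
      refine h2 _ (fun h => ?_) fun k hk => ?_
      · obtain ⟨t', ht', h⟩ := Finset.mem_image.1 h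
        have ht2 : t' = t := (Prod.ext_iff.1 h).2
        exact ht (ht2 ▸ ht')
      · obtain ⟨t', -, rfl⟩ := Finset.mem_image.1 hk
        rw [hA, hS t ht, map_zero]
  · have hs0 : s ≠ 0 := by
      rintro rfl
      exact absurd (Finsupp.toLex_monotone zero_le) (not_le.2 hs)
    have hA2 := hA' s hs t
    rw [leafPd_of_ne hΩ hs0] at hA2 ⊢
    refine h2 _ (fun h => ?_) fun k hk => hA2 _
    obtain ⟨t', -, h⟩ := Finset.mem_image.1 h
    have := congrArg (fun k : LeafIx n m => toLex k.1.1) h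
    exact absurd hs (this ▸ lt_irrefl _)

/-- The leading derivatives of `P` are those of some `∇_i f`, if their label is not `e_i`: the mixed
derivatives of `∇_i Q = ∇_j P` with labels `r + e_j` and `r + e_i` are the integrability conditions
for `f`. -/
theorem exists_leafNabla_leading (hij : i ≠ j) (hi : ∀ k, i ≤ k)
    (hPQ : leafNabla hΩ i Q = leafNabla hΩ j P) {r : Fin n →₀ ℕ} (hr : r ≠ 0)
    (hQ : ∀ κ, toLex (r + Finsupp.single j 1) < toLex κ → ∀ t α, leafPd hΩ κ t (Q α) = 0)
    (hA : ∀ t α, leafPd hΩ (r + Finsupp.single j 1) t (Q α) =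
      leafPd hΩ (r + Finsupp.single i 1) t (P α)) :
    ∃ f : Fin m → LeafFun Ω,
      (∀ κ, toLex r < toLex κ → ∀ t α, leafPd hΩ κ t (f α) = 0) ∧
      ∀ t α, leafPd hΩ r t (f α) = leafPd hΩ (r + Finsupp.single i 1) t (P α) := by
  classical
  have hri : r i < (r + Finsupp.single i 1 : Fin n →₀ ℕ) i := by simp
  have hG : ∀ s, toLex r < toLex s → ∀ {μ : Fin n →₀ ℕ}, r i < μ i → ∀ t t' α,
      leafPd hΩ s t (leafPd hΩ μ t' (P α)) = 0 := fun s hs _ hμ =>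
    leafPd_leafPd_eq_zero_of_closed hΩ hij hi hPQ hQ hs hμ
  have hrj := toLex_lt_add_single r j
  have hclosed : ∀ t t' α,
      leafPd hΩ r t (leafPd hΩ (r + Finsupp.single i 1) t' (P α)) =
        leafPd hΩ r t' (leafPd hΩ (r + Finsupp.single i 1) t (P α)) := by
    intro t t' α
    have hne : r + Finsupp.single i 1 ≠ Finsupp.single j 1 := fun h => by
      have := DFunLike.congr_fun h i
      simp [hij.symm] at this
    have h1 := leafPd_leafPd_leafNabla_of_eq_zero hΩ j (add_single_ne_zero r j)
      (fun h => hr (add_eq_right.1 h)) (add_single_ne_zero r i) hne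
      (fun t t' α => hG _ hrj hri t t' α) t t' α
    have h2 : leafPd hΩ (r + Finsupp.single j 1) t
        (leafPdDown hΩ j (r + Finsupp.single i 1) t' (P α)) = 0 := by
      by_cases hz : (r + Finsupp.single i 1 : Fin n →₀ ℕ) j = 0
      · rw [leafPdDown_of_eq_zero hΩ hz, map_zero]
      · obtain ⟨ν, hν⟩ := exists_eq_add_single hz
        rw [hν, leafPdDown_add_single]
        refine hG _ hrj ?_ t t' α
        rw [hν, Finsupp.add_apply, Finsupp.single_eq_of_ne hij, add_zero] at hri
        exact hri
    have hiQ : ∀ t α, leafPd hΩ (r + Finsupp.single i 1) t (Q α) = 0 :=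
      hQ _ (toLex_lt_of_apply_lt hi (by
        rwa [Finsupp.add_apply _ (Finsupp.single j 1), Finsupp.single_eq_of_ne hij, add_zero]))
    rw [h2, add_zero, leafPdDown_add_single, ← hPQ,
      leafPd_leafNabla_of_eq_zero hΩ i (add_single_ne_zero r i) (fun h => hr (add_eq_right.1 h))
        hiQ, leafPdDown_add_single, leafPd_comm, hA] at h1
    exact h1.symm
  have hf : ∀ α, ∃ F : LeafFun Ω,
      (∀ t, leafPd hΩ r t F = leafPd hΩ (r + Finsupp.single i 1) t (P α)) ∧
      ∀ s, toLex r < toLex s → ∀ t, leafPd hΩ s t F = 0 := by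
    intro α
    obtain ⟨S, hS, -⟩ := exists_leaf_chain hΩ (P α)
    refine exists_leafPd_eq hΩ hr (fun t => leafPd hΩ (r + Finsupp.single i 1) t (P α))
      (S.image Prod.snd) (fun t ht => ?_) (fun t t' => hclosed t t' α)
      fun s hs t t' => hG s hs hri t t' α
    exact hS (⟨_, add_single_ne_zero r i⟩, t) fun h => ht (Finset.mem_image_of_mem Prod.snd h)
  choose f hf1 hf2 using hf
  exact ⟨f, fun κ hκ t α => hf2 α κ hκ t, fun t α => hf1 α t⟩

/-- The leading derivatives of `P` are those of some `∇_i f`, if their label is `e_i`: the mixed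
derivatives of the equation `∇_i Q = ∇_j P` determine `f`, by an argument of Euler type. -/
theorem exists_leafNabla_leading_single (hij : i ≠ j)
    (hPQ : leafNabla hΩ i Q = leafNabla hΩ j P)
    (hA : ∀ t α, leafPd hΩ (Finsupp.single j 1) t (Q α) = leafPd hΩ (Finsupp.single i 1) t (P α))
    (hP : ∀ κ t t' α, leafPd hΩ κ t (leafPd hΩ (Finsupp.single i 1) t' (P α)) = 0) :
    ∃ f : Fin m → LeafFun Ω, (∀ κ t α, leafPd hΩ κ t (f α) = 0) ∧
      ∀ t α, leafPd hΩ (Finsupp.single i 1) t (leafNabla hΩ i f α) =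
        leafPd hΩ (Finsupp.single i 1) t (P α) := by
  classical
  let A : Fin m → (Fin m →₀ ℕ) → Fin m → LeafFun Ω := fun γ ρ α =>
    leafPd hΩ (Finsupp.single i 1) (γ, ρ) (P α)
  let f : Fin m → LeafFun Ω := fun α => -∑ β, A β (Finsupp.single β 1) α
  have hf : ∀ κ t α, leafPd hΩ κ t (f α) = 0 := fun κ t α => by
    rw [map_neg, map_sum, neg_eq_zero]
    exact Finset.sum_eq_zero fun β _ => hP κ t _ α
  refine ⟨f, hf, ?_⟩
  rintro ⟨a, τ⟩ c
  rw [leafPd_single_leafNabla hΩ hf]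
  change _ = A a τ c
  have hQ : ∀ κ t t' α, leafPd hΩ κ t (leafPd hΩ (Finsupp.single j 1) t' (Q α)) = 0 :=
    fun κ t t' α => by rw [hA, hP]
  -- the derivative of `∇_i Q = ∇_j P` along `w_{e_i,e_β}^β` and `w_{e_j,τ}^a`
  have hU : ∀ β, (-(τ β : ℝ)) • A a τ c - (if c = β then A a τ c else 0) =
      (if τ = 0 then leafD hΩ (.inr a) (A β (Finsupp.single β 1) c) else
        if a = β then -A a τ c else 0) -
      ∑ ε, if c = a ∧ τ = Finsupp.single ε 1 then A β (Finsupp.single β 1) ε else 0 := by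
    intro β
    have h1 := leafPd_leafPd_leafNabla_single hΩ hij hQ β a c (Finsupp.single β 1) τ τ
      (.inr (add_comm _ _))
    have h2 := leafPd_leafPd_leafNabla_single hΩ hij.symm hP a β c τ (Finsupp.single β 1) τ (by
      by_cases h : a = β
      · exact .inr (by rw [h])
      · exact .inl (Finsupp.single_eq_of_ne h))
    rw [leafPd_comm, ← hPQ, h1] at h2
    simp only [hA] at h2
    rw [if_neg (single_one_ne_zero β)] at h2
    have h3 : (∑ ε, if c = β ∧ (Finsupp.single β 1 : Fin m →₀ ℕ) = Finsupp.single ε 1 then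
        A a τ ε else 0) = if c = β then A a τ c else 0 := by
      by_cases hc : c = β
      · subst hc
        rw [if_pos rfl, Finset.sum_eq_single c (fun ε _ hε => if_neg fun h => hε
          ((Finsupp.single_left_inj one_ne_zero).1 h.2).symm)
          (fun h => absurd (Finset.mem_univ _) h), if_pos ⟨rfl, rfl⟩]
      · rw [if_neg hc]
        exact Finset.sum_eq_zero fun ε _ => if_neg fun h => hc h.1
    have h4 : (-((Finsupp.single β 1 : Fin m →₀ ℕ) a : ℝ)) • A β τ c =
        if a = β then -A a τ c else 0 := by
      by_cases h : a = β
      · rw [if_pos h, h, Finsupp.single_eq_same, Nat.cast_one, neg_smul, one_smul]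
      · rw [if_neg h, Finsupp.single_eq_of_ne h, Nat.cast_zero, neg_zero, zero_smul]
    change _ - (∑ ε, if c = β ∧ (Finsupp.single β 1 : Fin m →₀ ℕ) = Finsupp.single ε 1 then
        A a τ ε else 0) = (if τ = 0 then _ else
        (-((Finsupp.single β 1 : Fin m →₀ ℕ) a : ℝ)) • A β τ c) - _ at h2
    rw [h3, h4] at h2
    exact h2
  -- the sum of these identities over `β`
  have hsum := Finset.sum_congr rfl fun β (_ : β ∈ Finset.univ) => hU β
  have hX : ∑ β, ∑ ε, (if c = a ∧ τ = Finsupp.single ε 1 then A β (Finsupp.single β 1) ε else 0) =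
      -∑ ε, if c = a ∧ τ = Finsupp.single ε 1 then f ε else 0 := by
    rw [Finset.sum_comm, ← Finset.sum_neg_distrib]
    refine Finset.sum_congr rfl fun ε _ => ?_
    split_ifs
    · exact (neg_neg _).symm
    · rw [Finset.sum_const_zero, neg_zero]
  rw [Finset.sum_sub_distrib, Finset.sum_sub_distrib, hX, ← Finset.sum_smul,
    Finset.sum_ite_eq Finset.univ c, if_pos (Finset.mem_univ c)] at hsum
  by_cases hτ : τ = 0
  · simp only [hτ, if_true] at hsum ⊢
    have hfc : leafD hΩ (.inr a) (f c) = -∑ β, leafD hΩ (.inr a) (A β (Finsupp.single β 1) c) := by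
      rw [map_neg, map_sum]
    rw [hfc]
    simp only [Finsupp.coe_zero, Pi.zero_apply, Nat.cast_zero, neg_zero, Finset.sum_const_zero,
      zero_smul, zero_sub] at hsum
    rw [← neg_inj, hsum]
    abel
  · simp only [hτ, if_false] at hsum ⊢
    rw [Finset.sum_ite_eq Finset.univ a, if_pos (Finset.mem_univ a), Finset.sum_neg_distrib,
      neg_smul] at hsum
    have hsum' : (∑ β, (τ β : ℝ)) • A a τ c =
        -∑ ε, if c = a ∧ τ = Finsupp.single ε 1 then f ε else 0 := by
      have h5 := congrArg (fun x => -(x + A a τ c)) hsum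
      simp only [sub_add_cancel, neg_neg] at h5
      rw [h5]
      abel
    rw [zero_sub]
    by_cases hε : ∃ ε, τ = Finsupp.single ε 1
    · obtain ⟨ε, rfl⟩ := hε
      rw [← hsum', Finset.sum_eq_single ε (fun β _ hβ => by
        rw [Finsupp.single_eq_of_ne hβ, Nat.cast_zero]) (fun h => absurd (Finset.mem_univ _) h),
        Finsupp.single_eq_same, Nat.cast_one, one_smul]
    · have h0 : (∑ ε, if c = a ∧ τ = Finsupp.single ε 1 then f ε else 0) = 0 :=
        Finset.sum_eq_zero fun ε _ => if_neg fun h => hε ⟨ε, h.2⟩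
      rw [h0, neg_zero] at hsum' ⊢
      have hpos : ∑ β, (τ β : ℝ) ≠ 0 := by
        intro h
        refine hτ (Finsupp.ext fun β => ?_)
        have := (Finset.sum_eq_zero_iff_of_nonneg fun β _ => Nat.cast_nonneg (α := ℝ) (τ β)).1 h β
          (Finset.mem_univ β)
        exact_mod_cast this
      rw [← inv_smul_smul₀ hpos (A a τ c), hsum', smul_zero]

/-- A closed pair is exact, by induction on the greatest label on which `P` depends. -/
theorem exists_eq_leafNabla (hij : i ≠ j) (hi : ∀ k, i ≤ k)
    (hPQ : leafNabla hΩ i Q = leafNabla hΩ j P) : ∃ f, P = leafNabla hΩ i f := by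
  have key : ∀ (p : Lex (Fin n →₀ ℕ)) (P Q : Fin m → LeafFun Ω),
      leafNabla hΩ i Q = leafNabla hΩ j P →
      (∀ κ, p ≤ toLex κ → ∀ t α, leafPd hΩ κ t (P α) = 0) → ∃ f, P = leafNabla hΩ i f := by
    intro p
    induction p using WellFoundedLT.induction with
    | ind p ih =>
    intro P Q hPQ hp
    rcases exists_top_level hΩ P with hP | ⟨p', hp', hne, hP⟩
    -- if `P` is a tuple of functions on `Ω`, then so is `Q`, and both vanish
    · have hQ : ∀ κ t α, leafPd hΩ κ t (Q α) = 0 := by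
        rcases exists_top_level hΩ Q with hQ | ⟨q, hq, ⟨t, α, hne⟩, hQ⟩
        · exact hQ
        · refine absurd ?_ hne
          rw [← leafPd_add_single_leafNabla hΩ i hq hQ, hPQ]
          refine leafPd_leafNabla_eq_zero hΩ hP j (fun h => ?_) t α
          have := DFunLike.congr_fun h i
          simp [hij.symm] at this
      have hQ0 : Q = 0 := eq_zero_of_leafPd_single_leafNabla hΩ hQ i fun t α => by
        rw [hPQ]
        exact leafPd_leafNabla_eq_zero hΩ hP j
          (fun h => hij ((Finsupp.single_left_inj one_ne_zero).1 h)) t α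
      have h0 : ∀ k, leafNabla hΩ k (0 : Fin m → LeafFun Ω) = 0 := fun k => by
        have h := leafNabla_sub hΩ k (0 : Fin m → LeafFun Ω) 0
        rwa [sub_self, sub_self] at h
      refine ⟨0, ?_⟩
      rw [h0]
      refine eq_zero_of_leafNabla_eq_zero hΩ j ?_
      rw [← hPQ, hQ0, h0]
    · have hlt : toLex p' < p := by
        by_contra h
        obtain ⟨t, α, hne⟩ := hne
        exact hne (hp p' (not_lt.1 h) t α)
      obtain ⟨r, rfl, hQ, hA⟩ := exists_leading_label hΩ hij hPQ hp' hne hP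
      obtain ⟨f, hf⟩ : ∃ f : Fin m → LeafFun Ω, ∀ κ, toLex (r + Finsupp.single i 1) ≤ toLex κ →
          ∀ t α, leafPd hΩ κ t (leafNabla hΩ i f α) = leafPd hΩ κ t (P α) := by
        by_cases hr : r = 0
        · subst hr
          simp only [zero_add] at hA hP ⊢
          obtain ⟨f, hf1, hf2⟩ := exists_leafNabla_leading_single hΩ hij hPQ hA (by
            intro κ t t' α
            by_cases hκ : κ = 0
            · rw [hκ, leafPd_zero]
            · exact leafPd_leafPd_eq_zero_of_closed hΩ hij hi hPQ hQ (toLex_zero_lt hκ)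
                (by simp) t t' α)
          refine ⟨f, fun κ hκ t α => ?_⟩
          rcases hκ.eq_or_lt with h | h
          · rw [← toLex.injective h, hf2]
          · rw [hP κ h, leafPd_leafNabla_eq_zero hΩ hf1]
            rintro rfl
            exact lt_irrefl _ h
        · obtain ⟨f, hf1, hf2⟩ := exists_leafNabla_leading hΩ hij hi hPQ hr hQ hA
          refine ⟨f, fun κ hκ t α => ?_⟩
          rcases hκ.eq_or_lt with h | h
          · rw [← toLex.injective h, leafPd_add_single_leafNabla hΩ i hr hf1, hf2]
          · rw [hP κ h, leafPd_leafNabla_eq_zero_of_lt hΩ i hf1 h]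
      obtain ⟨g, hg⟩ := ih _ hlt (P - leafNabla hΩ i f) (Q - leafNabla hΩ j f)
        (by rw [leafNabla_sub, leafNabla_sub, hPQ, leafNabla_comm])
        fun κ hκ t α => by rw [Pi.sub_apply, map_sub, hf κ hκ, sub_self]
      exact ⟨g + f, by rw [leafNabla_add, ← hg, sub_add_cancel]⟩
  obtain hP | ⟨p, -, -, hP⟩ := exists_top_level hΩ P
  · exact key 0 P Q hPQ fun κ _ => hP κ
  · exact key (toLex (p + Finsupp.single i 1)) P Q hPQ
      fun κ hκ => hP κ ((toLex_lt_add_single p i).trans_le hκ)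

end Closed

/-- Solutions of the linearised equation of flat connections are gauge. -/
theorem existsUnique_leafNabla (hn : 2 ≤ n) {φ : Fin n → Fin m → LeafFun Ω}
    (hφ : ∀ i j, leafNabla hΩ i (φ j) = leafNabla hΩ j (φ i)) :
    ∃! f : Fin m → LeafFun Ω, ∀ i, φ i = leafNabla hΩ i f := by
  let i : Fin n := ⟨0, by omega⟩
  let j : Fin n := ⟨1, by omega⟩
  have hij : i ≠ j := by simp [i, j]
  have hi : ∀ k, i ≤ k := fun k => Nat.zero_le _
  obtain ⟨f, hf⟩ := exists_eq_leafNabla hΩ hij hi (hφ i j)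
  refine ⟨f, fun k => ?_, fun g hg => ?_⟩
  · refine sub_eq_zero.1 (eq_zero_of_leafNabla_eq_zero hΩ i ?_)
    rw [leafNabla_sub, hφ i k, leafNabla_comm hΩ i k, ← hf, sub_self]
  · refine sub_eq_zero.1 (eq_zero_of_leafNabla_eq_zero hΩ i ?_)
    rw [leafNabla_sub, ← hg, ← hf, sub_self]

end Cohomology

/-! ### Symmetries on the model -/

section Symmetry

variable {n m : ℕ} {Ω : Set (BaseIx n m → ℝ)} (hΩ : IsOpen Ω)

/-- A symmetry of the model: a derivation which kills the functions on `Ω` and commutes with the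
total derivatives. -/
def IsLeafSymmetry (T : Derivation ℝ (LeafFun Ω) (LeafFun Ω)) : Prop :=
  (∀ h hh, T (base h hh) = 0) ∧ ∀ a f, T (leafD hΩ a f) = leafD hΩ a (T f)

variable {hΩ} in
theorem IsLeafSymmetry.leafLift {T : Derivation ℝ (LeafFun Ω) (LeafFun Ω)}
    (hT : IsLeafSymmetry hΩ T) (i : Fin n) (f : LeafFun Ω) :
    T (leafLift hΩ i f) =
      leafLift hΩ i (T f) + ∑ β, T (leafConn i β) * leafD hΩ (.inr β) f := by
  rw [leafLift_apply, leafLift_apply, map_add, map_sum, hT.2, add_assoc,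
    ← Finset.sum_add_distrib]
  congr 1
  refine Finset.sum_congr rfl fun β _ => ?_
  rw [Derivation.leibniz, hT.2, smul_eq_mul, smul_eq_mul, mul_comm (T _)]

variable {hΩ} in
/-- The linearised equation of flat connections. -/
theorem IsLeafSymmetry.leafNabla_comm {T : Derivation ℝ (LeafFun Ω) (LeafFun Ω)}
    (hT : IsLeafSymmetry hΩ T) (i j : Fin n) :
    leafNabla hΩ i (fun α => T (leafConn j α)) = leafNabla hΩ j fun α => T (leafConn i α) := by
  funext α
  have h := congrArg T (leafLift_leafConn hΩ i j α)
  rw [hT.leafLift, hT.leafLift] at h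
  have h1 : ∀ i j, ∑ β, T (leafConn i β) * leafD hΩ (.inr β) (leafConn j α) =
      ∑ β, leafD hΩ (.inr β) (leafConn j α) * T (leafConn i β) := fun i j =>
    Finset.sum_congr rfl fun β _ => mul_comm _ _
  rw [h1, h1] at h
  rw [leafNabla, leafNabla, sub_eq_sub_iff_add_eq_add, h]

/-- A symmetry is determined by its generating section. -/
theorem IsLeafSymmetry.eq_zero {T : Derivation ℝ (LeafFun Ω) (LeafFun Ω)}
    (hT : IsLeafSymmetry hΩ T) (h : ∀ i α, T (leafConn i α) = 0) : T = 0 := by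
  have key : ∀ κ : Fin n →₀ ℕ, κ ≠ 0 → ∀ α, T (leafCoord κ α 0) = 0 := by
    intro κ
    induction κ using multiIx_induction with
    | h0 => exact fun h => absurd rfl h
    | hadd κ i ih =>
      intro _ α
      by_cases hκ : κ = 0
      · rw [hκ, zero_add]
        exact h i α
      · rw [← leafLift_leafCoord hΩ i hκ, hT.leafLift, ih hκ, map_zero, zero_add]
        exact Finset.sum_eq_zero fun β _ => by rw [h, zero_mul]
  refine derivation_eq_zero hΩ hT.1 ?_
  rintro ⟨⟨κ, hκ⟩, α, τ⟩
  rw [← leafCoord_of_ne hκ]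
  exact IsTaylor.ext (B := LeafFun Ω)
    ((isTaylor_leafCoord hΩ κ α).map (T : LeafFun Ω →ₗ[ℝ] LeafFun Ω) fun b f => (hT.2 _ f).symm)
    (isTaylor_zero (B := LeafFun Ω)) (key κ hκ α) τ

theorem IsLeafSymmetry.ext {T T' : Derivation ℝ (LeafFun Ω) (LeafFun Ω)}
    (hT : IsLeafSymmetry hΩ T) (hT' : IsLeafSymmetry hΩ T')
    (h : ∀ i α, T (leafConn i α) = T' (leafConn i α)) : T = T' := by
  have h0 : T - T' = 0 := by
    refine IsLeafSymmetry.eq_zero hΩ ⟨fun h hh => ?_, fun a g => ?_⟩ fun i α => ?_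
    · rw [Derivation.sub_apply, hT.1, hT'.1, sub_zero]
    · rw [Derivation.sub_apply, Derivation.sub_apply, hT.2, hT'.2, map_sub]
    · rw [Derivation.sub_apply, h, sub_self]
  ext1 f
  have h1 := congrArg (fun Z : Derivation ℝ (LeafFun Ω) (LeafFun Ω) => Z f) h0
  exact sub_eq_zero.1 ((Derivation.sub_apply f).symm.trans h1)

/-- Every tuple of functions on the model defines a symmetry, which maps the leaf coordinate
`w_{κ,0}^α` to `D^κ f^α - ∑_β f^β D_{v^β} w_{κ,0}^α`. -/
theorem exists_isLeafSymmetry (f : Fin m → LeafFun Ω) :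
    ∃ T, IsLeafSymmetry hΩ T ∧ ∀ i α, T (leafConn i α) = leafNabla hΩ i f α := by
  choose g hg hg0 using fun α =>
    exists_isJetFamily (B := LeafFun Ω) (D := leafLift hΩ) (leafLift_comm hΩ) (f α)
  let u : (Fin n →₀ ℕ) → Fin m → LeafFun Ω := fun κ α =>
    g α κ - ∑ β, leafD hΩ (.inr β) (leafCoord κ α 0) * f β
  choose U hU hU0 using fun κ α => exists_isTaylor (B := LeafFun Ω)
    (D := fun β => leafD hΩ (.inr β)) (leafD_inr_comm hΩ) (u κ α)
  have hu1 : ∀ i α, u (Finsupp.single i 1) α = leafNabla hΩ i f α := by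
    intro i α
    have h := hg α i 0
    rw [zero_add, hg0] at h
    rw [leafNabla, h, leafConn]
  -- `u` satisfies the relation imposed by `T(D_i w) = D_i(T w) + ∑ γ, T(v_i^γ) D_{v^γ} w`
  have hu : ∀ i (κ : Fin n →₀ ℕ), κ ≠ 0 → ∀ α, leafLift hΩ i (u κ α) =
      u (κ + Finsupp.single i 1) α -
        ∑ γ, leafNabla hΩ i f γ * leafD hΩ (.inr γ) (leafCoord κ α 0) := by
    intro i κ hκ α
    have h1 : ∀ β, leafLift hΩ i (leafD hΩ (.inr β) (leafCoord κ α 0) * f β) =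
        leafLift hΩ i (f β) * leafD hΩ (.inr β) (leafCoord κ α 0) +
          (leafD hΩ (.inr β) (leafCoord (κ + Finsupp.single i 1) α 0) -
          ∑ γ, leafD hΩ (.inr β) (leafConn i γ) * leafD hΩ (.inr γ) (leafCoord κ α 0)) * f β :=
      fun β => by
        rw [Derivation.leibniz, leafLift_leafD_inr, leafLift_leafCoord hΩ i hκ, smul_eq_mul,
          smul_eq_mul, mul_comm (f β), mul_comm (leafLift hΩ i (f β)), add_comm]
    have h2 := hg α i κ
    change leafLift hΩ i (g α κ - _) = _
    rw [map_sub, map_sum, h2]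
    have h3 : ∑ β, (∑ γ, leafD hΩ (.inr β) (leafConn i γ) *
        leafD hΩ (.inr γ) (leafCoord κ α 0)) * f β =
        ∑ γ, (∑ β, leafD hΩ (.inr β) (leafConn i γ) * f β) *
          leafD hΩ (.inr γ) (leafCoord κ α 0) := by
      simp_rw [Finset.sum_mul]
      rw [Finset.sum_comm]
      exact Finset.sum_congr rfl fun γ _ => Finset.sum_congr rfl fun β _ => mul_right_comm _ _ _
    rw [Finset.sum_congr rfl fun β _ => h1 β]
    simp_rw [sub_mul, Finset.sum_add_distrib, Finset.sum_sub_distrib]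
    rw [h3]
    simp_rw [u, leafNabla, sub_mul, Finset.sum_sub_distrib]
    abel
  let T := vecField hΩ 0 fun k : LeafIx n m => U k.1 k.2.1 k.2.2
  have hTc : ∀ (κ : Fin n →₀ ℕ), κ ≠ 0 → ∀ α τ, T (leafCoord κ α τ) = U κ α τ := by
    intro κ hκ α τ
    rw [leafCoord_of_ne hκ]
    exact vecField_coord _ _ _ _
  have hTb : ∀ h hh, T (base h hh) = 0 := fun h hh => ext_apply fun p =>
    (vecField_base _ _ _ _ _ _).trans (map_zero _)
  have hTDb : ∀ a h hh, ⁅T, leafD hΩ a⁆ (base h hh) = 0 := by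
    classical
    intro a h hh
    rw [Derivation.commutator_apply, hTb, leafD_base, baseDeriv_base, hTb, map_zero, sub_zero]
  have hcomm : ∀ a, ⁅T, leafD hΩ a⁆ = 0 → ∀ f, T (leafD hΩ a f) = leafD hΩ a (T f) := by
    intro a h f
    have := congrArg (fun Z : Derivation ℝ (LeafFun Ω) (LeafFun Ω) => Z f) h
    exact sub_eq_zero.1 ((Derivation.commutator_apply f).symm.trans this)
  have hTr : ∀ β f, T (leafD hΩ (.inr β) f) = leafD hΩ (.inr β) (T f) := by
    refine fun β => hcomm _ (derivation_eq_zero hΩ (hTDb _) ?_)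
    rintro ⟨⟨κ, hκ⟩, α, τ⟩
    rw [← leafCoord_of_ne hκ, Derivation.commutator_apply, hTc κ hκ, isTaylor_leafCoord hΩ κ α β τ,
      T.map_smul, hTc κ hκ]
    exact sub_eq_zero.2 (hU κ α β τ).symm
  have hTl : ∀ i f, T (leafD hΩ (.inl i) f) = leafD hΩ (.inl i) (T f) := by
    refine fun i => hcomm _ (derivation_eq_zero hΩ (hTDb _) ?_)
    rintro ⟨⟨κ, hκ⟩, α, τ⟩
    rw [← leafCoord_of_ne hκ, Derivation.commutator_apply, hTc κ hκ, leafD_inl_leafCoord hΩ i hκ,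
      sub_eq_zero]
    -- both sides are Taylor coefficients, so it suffices to compare them for `τ = 0`
    refine IsTaylor.ext (B := LeafFun Ω) (D := fun β => leafD hΩ (.inr β))
      ((isTaylor_leafDx hΩ i κ α).map (T : LeafFun Ω →ₗ[ℝ] LeafFun Ω) fun b f => (hTr b f).symm)
      ((hU κ α).map (leafD hΩ (.inl i) : LeafFun Ω →ₗ[ℝ] LeafFun Ω)
        fun b f => leafD_inr_inl_comm hΩ b i f) ?_ τ
    change T (leafDx i κ α 0) = leafD hΩ (.inl i) (U κ α 0)
    have h1 := leafLift_apply hΩ i (leafCoord κ α 0)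
    rw [leafLift_leafCoord hΩ i hκ, leafD_inl_leafCoord hΩ i hκ] at h1
    have h2 := leafLift_apply hΩ i (u κ α)
    have h3 : ∀ β, T (leafConn i β * leafD hΩ (.inr β) (leafCoord κ α 0)) =
        leafConn i β * leafD hΩ (.inr β) (u κ α) +
          leafNabla hΩ i f β * leafD hΩ (.inr β) (leafCoord κ α 0) := fun β => by
      rw [Derivation.leibniz, hTr, hTc κ hκ, hU0, leafConn, hTc _ (single_one_ne_zero i), hU0, hu1,
        smul_eq_mul, smul_eq_mul, mul_comm (leafD hΩ _ _) (leafNabla hΩ i f β)]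
    have h4 := congrArg T h1
    rw [map_add, map_sum, hTc _ (add_single_ne_zero _ _), hU0, Finset.sum_congr rfl fun β _ => h3 β,
      Finset.sum_add_distrib] at h4
    rw [hu i κ hκ] at h2
    rw [hU0, ← sub_eq_zero]
    have h5 : T (leafDx i κ α 0) = u (κ + Finsupp.single i 1) α -
        (∑ β, leafConn i β * leafD hΩ (.inr β) (u κ α) +
          ∑ β, leafNabla hΩ i f β * leafD hΩ (.inr β) (leafCoord κ α 0)) :=
      (sub_eq_of_eq_add h4).symm
    have h6 : leafD hΩ (.inl i) (u κ α) = u (κ + Finsupp.single i 1) α -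
        ∑ β, leafNabla hΩ i f β * leafD hΩ (.inr β) (leafCoord κ α 0) -
          ∑ β, leafConn i β * leafD hΩ (.inr β) (u κ α) :=
      (sub_eq_of_eq_add h2).symm
    rw [h5, h6]
    abel
  refine ⟨T, ⟨hTb, ?_⟩, fun i α => ?_⟩
  · rintro (i | β) f
    exacts [hTl i f, hTr β f]
  · rw [leafConn, hTc _ (single_one_ne_zero i), hU0, hu1]

end Symmetry

/-! ### Symmetries of the equation -/

section Equation

variable {n m : ℕ} {Ω : Set (BaseIx n m → ℝ)}

/-- Transport of derivations along an isomorphism of algebras. -/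
def conjDerivation {A B : Type} [CommRing A] [Algebra ℝ A] [CommRing B] [Algebra ℝ B]
    (e : A ≃ₐ[ℝ] B) (Z : Derivation ℝ A A) : Derivation ℝ B B :=
  Derivation.mk' ((e : A →ₗ[ℝ] B) ∘ₗ (Z : A →ₗ[ℝ] A) ∘ₗ (e.symm : B →ₗ[ℝ] A)) fun f g => by
    change e (Z (e.symm (f * g))) = f * e (Z (e.symm g)) + g * e (Z (e.symm f))
    rw [map_mul, Derivation.leibniz, map_add, smul_eq_mul, smul_eq_mul, map_mul, map_mul,
      e.apply_symm_apply, e.apply_symm_apply]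

theorem restrict_extend (f : SmoothE Ω) : restrict (extend f) (isSmooth_extend f) = f :=
  Subtype.ext (funext fun θ => ((Classical.choose_spec f.2).2 θ).symm)

/-- A base coordinate, as a function on the equation. -/
def baseCoord (a : BaseIx n m) : SmoothE Ω :=
  restrict (fun θ => θ.1 a) (isSmooth_base (contDiff_apply ℝ ℝ a).contDiffOn)

/-- The derivations `D` of the algebra of functions on the equation are the total derivatives. -/
def IsTotal (D : BaseIx n m → VectorField Ω) : Prop :=
  ∀ a F (hF : IsSmooth Ω F) (hF' : IsSmooth Ω (totalDeriv a F)),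
    restrict (totalDeriv a F) hF' = D a (restrict F hF)

section TotalDerivations

variable {D : BaseIx n m → VectorField Ω}

theorem totalDerivE_eq (hΩ : IsOpen Ω) (hD : IsTotal D) (a : BaseIx n m) (f : SmoothE Ω) :
    totalDerivE hΩ a f = D a f := by
  rw [totalDerivE, hD _ _ (isSmooth_extend f), restrict_extend]

theorem inCartan_iff (hΩ : IsOpen Ω) (hD : IsTotal D) (Y : VectorField Ω) :
    InCartan Y ↔ ∀ θ : Efc Ω, ∃ c : BaseIx n m → ℝ, ∀ f : SmoothE Ω,
      (Y f).1 θ = ∑ a, c a * (D a f).1 θ := by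
  have h : ∀ a F hF (θ : Efc Ω), totalDeriv a F θ = (D a (restrict F hF)).1 θ :=
    fun a F hF θ => congrArg (fun g : SmoothE Ω => g.1 θ) (hD a F hF (hF.totalDeriv hΩ a))
  refine forall_congr' fun θ => exists_congr fun c => ⟨fun H f => ?_, fun H F hF => ?_⟩
  · have := H (extend f) (isSmooth_extend f)
    simp_rw [fun a => h a (extend f) (isSmooth_extend f) θ, restrict_extend] at this
    exact this
  · rw [H]
    exact Finset.sum_congr rfl fun a _ => by rw [h a F hF]

theorem derivation_baseCoord (hΩ : IsOpen Ω) (hD : IsTotal D)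
    (a b : BaseIx n m) : D b (baseCoord a) = if a = b then 1 else 0 := by
  have hb := isSmooth_base (Ω := Ω) (contDiff_apply ℝ ℝ a).contDiffOn
  rw [baseCoord, ← hD b _ hb (hb.totalDeriv hΩ b)]
  refine Subtype.ext (funext fun θ => ?_)
  have h : HasDerivAt (fun t : ℝ => (θ.1 + t • cartanVec b θ.1).1 a) ((cartanVec b θ.1).1 a) 0 := by
    change HasDerivAt (fun t : ℝ => θ.1.1 a + t * (cartanVec b θ.1).1 a) _ 0
    simpa using ((hasDerivAt_id (0 : ℝ)).mul_const ((cartanVec b θ.1).1 a)).const_add (θ.1.1 a)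
  refine h.deriv.trans ?_
  dsimp only [cartanVec]
  by_cases hab : a = b
  · rw [hab, Pi.single_eq_same, if_pos rfl]
    rfl
  · rw [Pi.single_eq_of_ne hab, if_neg hab]
    rfl

theorem inCartan_totalDerivation (hΩ : IsOpen Ω) (hD : IsTotal D)
    (b : BaseIx n m) : InCartan (D b) := by
  classical
  refine (inCartan_iff hΩ hD _).2 fun θ => ⟨Pi.single b 1, fun f => ?_⟩
  rw [Finset.sum_eq_single b (fun a _ ha => by rw [Pi.single_eq_of_ne ha, zero_mul])
    (fun h => absurd (Finset.mem_univ _) h), Pi.single_eq_same, one_mul]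

theorem smoothE_sum_apply {K : Type} (s : Finset K) (f : K → SmoothE Ω) (θ : Efc Ω) :
    (∑ k ∈ s, f k).1 θ = ∑ k ∈ s, (f k).1 θ := by
  rw [AddSubmonoidClass.coe_finsetSum, Finset.sum_apply]

/-- The coefficients of a Cartan field are its values on the base coordinates. -/
theorem InCartan.eq_sum (hΩ : IsOpen Ω) (hD : IsTotal D)
    {Y : VectorField Ω} (hY : InCartan Y) (f : SmoothE Ω) :
    Y f = ∑ a, Y (baseCoord a) * D a f := by
  classical
  refine Subtype.ext (funext fun θ => ?_)
  obtain ⟨c, hc⟩ := (inCartan_iff hΩ hD Y).1 hY θ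
  have hca : ∀ a, (Y (baseCoord a)).1 θ = c a := by
    intro a
    rw [hc, Finset.sum_eq_single a]
    · rw [derivation_baseCoord hΩ hD, if_pos rfl]
      exact mul_one _
    · intro b _ hb
      rw [derivation_baseCoord hΩ hD, if_neg hb.symm]
      exact mul_zero _
    · exact fun h => absurd (Finset.mem_univ _) h
  rw [smoothE_sum_apply, hc]
  exact Finset.sum_congr rfl fun a _ => congrArg (· * _) (hca a).symm

/-- Symmetries are the derivations which kill the functions of `(x, v)` and commute with the total
derivatives. -/
theorem isSymmetry_iff (hΩ : IsOpen Ω) (hD : IsTotal D)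
    (S : VectorField Ω) : IsSymmetry S ↔
      (∀ (h : (BaseIx n m → ℝ) → ℝ) (hh : ContDiffOn ℝ ∞ h Ω),
        S (restrict (fun θ => h θ.1) (isSmooth_base hh)) = 0) ∧
      ∀ a f, S (D a f) = D a (S f) := by
  classical
  refine and_congr_right fun h0 => ⟨fun h a f => ?_, fun h Y hY => ?_⟩
  · have h1 := (h _ (inCartan_totalDerivation hΩ hD a)).eq_sum hΩ hD f
    have h2 : ∀ b, ⁅S, D a⁆ (baseCoord b) = 0 := fun b => by
      have hb : S (baseCoord b) = 0 :=
        h0 (fun x => x b) (contDiff_apply ℝ ℝ b).contDiffOn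
      rw [Derivation.commutator_apply, hb, map_zero, sub_zero, derivation_baseCoord hΩ hD]
      split_ifs
      exacts [S.map_one_eq_zero, map_zero S]
    simp_rw [h2, zero_mul, Finset.sum_const_zero] at h1
    rw [Derivation.commutator_apply] at h1
    exact sub_eq_zero.1 h1
  · refine (inCartan_iff hΩ hD _).2 fun θ => ⟨fun a => (S (Y (baseCoord a))).1 θ, fun f => ?_⟩
    have h1 : ⁅S, Y⁆ f = ∑ a, S (Y (baseCoord a)) * D a f := by
      rw [Derivation.commutator_apply, hY.eq_sum hΩ hD f, hY.eq_sum hΩ hD (S f), map_sum,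
        ← Finset.sum_sub_distrib]
      refine Finset.sum_congr rfl fun a _ => ?_
      rw [Derivation.leibniz, h, smul_eq_mul, smul_eq_mul, add_sub_cancel_left, mul_comm]
    rw [h1, smoothE_sum_apply]
    rfl

end TotalDerivations

end Equation

section Transport

variable {n m : ℕ} {Ω : Set (BaseIx n m → ℝ)}

/-- The total derivatives on the equation, transported from the model. -/
noncomputable def modelD (hΩ : IsOpen Ω) (e : SmoothE Ω ≃ₐ[ℝ] LeafFun Ω) (a : BaseIx n m) :
    VectorField Ω := conjDerivation e.symm (leafD hΩ a)

variable {hΩ : IsOpen Ω} {e : SmoothE Ω ≃ₐ[ℝ] LeafFun Ω}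

theorem apply_modelD (a : BaseIx n m) (f : SmoothE Ω) : e (modelD hΩ e a f) = leafD hΩ a (e f) :=
  e.apply_symm_apply _

theorem isTotal_modelD (h : ∀ a F hF, e (restrict (totalDeriv a F) (IsSmooth.totalDeriv hΩ hF a)) =
    leafD hΩ a (e (restrict F hF))) : IsTotal (modelD hΩ e) := fun a F hF _ =>
  e.injective ((h a F hF).trans (apply_modelD a _).symm)

theorem apply_gaugeSection (hD : IsTotal (modelD hΩ e)) (hc : ∀ i α, e (coord i α) = leafConn i α)
    (f : Fin m → SmoothE Ω) (i : Fin n) (α : Fin m) :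
    e (gaugeSection hΩ f i α) = leafNabla hΩ i (fun β => e (f β)) α := by
  simp only [gaugeSection, liftDeriv, leafNabla, leafLift_apply, totalDerivE_eq hΩ hD, map_sub,
    map_add, map_sum, map_mul, apply_modelD, hc]

theorem isSymmetry_conjDerivation_iff (hD : IsTotal (modelD hΩ e))
    (hb : ∀ h hh, e (restrict (fun θ => h θ.1) (isSmooth_base hh)) = base h hh)
    (T : Derivation ℝ (LeafFun Ω) (LeafFun Ω)) :
    IsSymmetry (conjDerivation e.symm T) ↔ IsLeafSymmetry hΩ T := by
  have hS : ∀ f, e (conjDerivation e.symm T f) = T (e f) := fun f => e.apply_symm_apply _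
  rw [isSymmetry_iff hΩ hD]
  refine and_congr (forall_congr' fun h => forall_congr' fun hh => ?_)
    ⟨fun H a f => ?_, fun H a f => e.injective ?_⟩
  · rw [← hb h hh, ← hS]
    exact (map_eq_zero_iff e e.injective).symm
  · have h1 := congrArg e (H a (e.symm f))
    rwa [hS, apply_modelD, apply_modelD, hS, e.apply_symm_apply] at h1
  · rw [hS, apply_modelD, apply_modelD, hS, H]

theorem conjDerivation_symm_conjDerivation (S : VectorField Ω) :
    conjDerivation e.symm (conjDerivation e S) = S := by
  ext1 f
  change e.symm (e (S (e.symm (e f)))) = S f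
  rw [e.symm_apply_apply, e.symm_apply_apply]

end Transport

end FlatConn

theorem corollary3p3 (n m : ℕ) (hn : 2 ≤ n) (Ω : Set (FlatConn.BaseIx n m → ℝ)) (hΩ : IsOpen Ω) :
    -- the total derivatives on `𝓔_fc` do not depend on the choice of extensions
    (∀ (a : FlatConn.BaseIx n m) (F : FlatConn.Jet n m → ℝ) (hF : FlatConn.IsSmooth Ω F),
      FlatConn.totalDerivE hΩ a (FlatConn.restrict F hF) =
        FlatConn.restrict (FlatConn.totalDeriv a F) (hF.totalDeriv hΩ a)) ∧
    -- every symmetry comes from exactly one tuple of functions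
    (∀ S : FlatConn.VectorField Ω, FlatConn.IsSymmetry S →
      ∃! f : Fin m → FlatConn.SmoothE Ω, ∀ (i : Fin n) (α : Fin m),
        FlatConn.generatingSection S i α = FlatConn.gaugeSection hΩ f i α) ∧
    -- the functions are arbitrary
    (∀ f : Fin m → FlatConn.SmoothE Ω,
      ∃! S : FlatConn.VectorField Ω, FlatConn.IsSymmetry S ∧ ∀ (i : Fin n) (α : Fin m),
        FlatConn.generatingSection S i α = FlatConn.gaugeSection hΩ f i α) := by
  obtain ⟨e, hb, hc, ht⟩ := FlatConn.exists_equiv hΩ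
  have hD : FlatConn.IsTotal (FlatConn.modelD hΩ e) := FlatConn.isTotal_modelD ht
  have hsym := FlatConn.isSymmetry_conjDerivation_iff hD hb
  -- the equation for the generating section, on the model
  have hgen : ∀ (T : Derivation ℝ (FlatConn.LeafFun Ω) (FlatConn.LeafFun Ω))
      (f : Fin m → FlatConn.SmoothE Ω) (i : Fin n) (α : Fin m),
      FlatConn.generatingSection (FlatConn.conjDerivation e.symm T) i α =
        FlatConn.gaugeSection hΩ f i α ↔
      T (FlatConn.leafConn i α) = FlatConn.leafNabla hΩ i (fun β => e (f β)) α := by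
    intro T f i α
    rw [← FlatConn.apply_gaugeSection hD hc, ← hc, ← e.injective.eq_iff]
    exact Eq.congr_left (e.apply_symm_apply _)
  have hconj := FlatConn.conjDerivation_symm_conjDerivation (e := e)
  refine ⟨fun a F hF => ?_, fun S hS => ?_, fun f => ?_⟩
  · rw [FlatConn.totalDerivE_eq hΩ hD, hD a F hF]
  · rw [← hconj S] at hS ⊢
    have hT := (hsym _).1 hS
    obtain ⟨f, hf, hfu⟩ := FlatConn.existsUnique_leafNabla hΩ hn fun i j => hT.leafNabla_comm i j
    refine ⟨fun β => e.symm (f β), fun i α => ?_, fun g hg => ?_⟩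
    · rw [hgen]
      simp_rw [e.apply_symm_apply]
      exact congrFun (hf i) α
    · have h1 := hfu (fun β => e (g β)) fun i => funext fun α => (hgen _ g i α).1 (hg i α)
      funext β
      rw [← h1, e.symm_apply_apply]
  · obtain ⟨T, hT, hTf⟩ := FlatConn.exists_isLeafSymmetry hΩ fun β => e (f β)
    refine ⟨FlatConn.conjDerivation e.symm T, ⟨(hsym T).2 hT, fun i α => (hgen T f i α).2 (hTf i α)⟩,
      fun S hS => ?_⟩
    rw [← hconj S] at hS ⊢
    have hS1 := (hsym _).1 hS.1
    rw [FlatConn.IsLeafSymmetry.ext hΩ hS1 hT fun i α => by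
      rw [hTf, (hgen _ f i α).1 (hS.2 i α)]]
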